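/- Let $\mathcal H$ be a separable complex Hilbert space with a fixed orthogonal decomposition $\mathcal H=\mathcal H_+\oplus\mathcal H_-$ into infinite-dimensional closed subspaces. Let $\mathcal L$ be the set of orthogonal projections of $\mathcal H$ (identified with the closed subspaces of $\mathcal H$), with the real smooth Banach manifold structure given by the graph charts: at $W\in\mathcal L$ the chart is defined on $\{V : V\oplus W^\perp=\mathcal H\}$ and sends $V$ to the bounded operator $P_{W^\perp}(P_W|_V)^{-1}\in L^\infty(W,W^\perp)$ whose graph is $V$. Let $\mathfrak U(\mathcal H)\rightrightarrows\mathcal L$ be the groupoid of all partial isometries of $\mathcal H$, with source $u^*u$, target $uu^*$, the product of operators, units the projections and inversion $u\mapsto u^*$. Its manifold structure has around $u_0$, with initial space $W$ and final space $W'$, the chart consisting of the graph coordinates in $L^\infty(W',W'^\perp)$ and $L^\infty(W,W^\perp)$ of the final and initial space of $u$, and of a chart of the Banach Lie group of unitaries of $W$, with values in the bounded skew-adjoint operators on $W$, applied to $u_0^*\,\sigma_{W'}(uu^*)^*\,u\,\sigma_W(u^*u)$; here $\sigma_W(V)$ is the unitary $W\to V$ given by the polar decomposition of $1_W+A:W\to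 V$, $A$ being the graph coordinate of $V$. Let $\mathrm{Gr}^0_{\rm res}\subset\mathcal L$ be the set of closed subspaces $W$ for which the orthogonal projection $W\to\mathcal H_+$ is Fredholm and the orthogonal projection $W\to\mathcal H_-$ is compact, and let $\mathfrak U^0_{\rm res}$ be the set of partial isometries whose initial and final spaces belong to $\mathrm{Gr}^0_{\rm res}$. Give $\mathrm{Gr}^0_{\rm res}$ and $\mathfrak U^0_{\rm res}$ the manifold structures defined by the same charts at their points, with the graph coordinates now taken in the spaces of compact operators $L^0(W,W^\perp)$ with the operator norm, instead of $L^\infty(W,W^\perp)$. An injective smooth map between Banach manifolds makes its domain an immersed submanifold if all its tangent maps are injective with closed range, and a split immersed submanifold if moreover all these ranges are complemented. Proposition. With these structures $\mathfrak U(\mathcal H)\rightrightarrows\mathcal L$ and $\mathfrak U^0_{\rm res}\rightrightarrows\mathrm{Gr}^0_{\rm res}$ are Banach Lie groupoids (Hausdorff Banach manifolds, with source and target surjective submersions, multiplication smooth, identity section a topological embedding, and inversion a diffeomorphism), and the inclusion is a morphism of groupoids. Both inclusions $\mathfrak U^0_{\rm res}\subset\mathfrak U(\mathcal H)$ and $\mathrm{Gr}^0_{\rm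 res}\subset\mathcal L$ are immersed submanifolds, and neither of them is a split immersed submanifold. -/

import Mathlib

open scoped ContDiff

universe u

noncomputable section

/-! ### Banach manifolds given by an atlas whose charts may take values in different Banach spaces

The Grassmannian of all closed subspaces is not modelled on a single Banach space, so charts carry
their own model space. All manifolds are real. -/

/-- A chart on a set `M`: a subset of `M` together with a map to a real Banach space
(only the values on `source` matter). -/
structure BanachChart (M : Type u) where
  /-- the Banach space in which the chart takes its values -/
  model : Type u
  [normedAddCommGroup : NormedAddCommGroup model]
  [normedSpace : NormedSpace ℝ model]
  [completeSpace : CompleteSpace model]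
  /-- the domain of the chart -/
  source : Set M
  /-- the coordinate map -/
  toFun : M → model

attribute [instance] BanachChart.normedAddCommGroup BanachChart.normedSpace
  BanachChart.completeSpace

section Manifold

variable {M N : Type u} {ι κ : Type u}

/-- The map `f : M → N` read in the charts `φ` and `ψ`, that is `ψ ∘ f ∘ φ⁻¹` on `φ(source φ)`,
and `0` elsewhere. -/
def localRep (φ : BanachChart M) (ψ : BanachChart N) (f : M → N) : φ.model → ψ.model :=
  Function.extend (fun x : φ.source => φ.toFun x) (fun x => ψ.toFun (f x)) 0

/-- The part of the image of the chart `φ` on which the local representative of `f` with respect to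
`φ`, `ψ` is defined. -/
def localDomain (φ : BanachChart M) (ψ : BanachChart N) (f : M → N) : Set φ.model :=
  φ.toFun '' (φ.source ∩ f ⁻¹' ψ.source)

/-- The topology defined by an atlas: it is generated by the preimages of open subsets of the model
spaces under the charts. -/
@[reducible] def atlasTopology (A : ι → BanachChart M) : TopologicalSpace M :=
  TopologicalSpace.generateFrom
    {S | ∃ i, ∃ O : Set (A i).model, IsOpen O ∧ S = (A i).source ∩ (A i).toFun ⁻¹' O}

/-- A family of charts is a smooth atlas of a Hausdorff Banach manifold: the chart domains cover,
the charts are injective with open images of overlaps (in particular, with `i = j`, open images),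
and the transition maps are smooth. -/
structure IsBanachManifold (A : ι → BanachChart M) : Prop where
  covers : ∀ x, ∃ i, x ∈ (A i).source
  injOn : ∀ i, Set.InjOn (A i).toFun (A i).source
  isOpen_overlap : ∀ i j, IsOpen (localDomain (A i) (A j) id)
  contDiffOn_transition : ∀ i j,
    ContDiffOn ℝ ∞ (localRep (A i) (A j) id) (localDomain (A i) (A j) id)
  t2 : @T2Space M (atlasTopology A)

/-- Smooth maps between Banach manifolds. Openness of the domains of the local representatives is
the continuity of the map. -/
def IsSmoothMap (A : ι → BanachChart M) (B : κ → BanachChart N) (f : M → N) : Prop :=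
  ∀ i j, IsOpen (localDomain (A i) (B j) f) ∧
    ContDiffOn ℝ ∞ (localRep (A i) (B j) f) (localDomain (A i) (B j) f)

/-- The tangent map of `f` at `x`, read in the charts `φ` around `x` and `ψ` around `f x`. -/
def tangentRep (φ : BanachChart M) (ψ : BanachChart N) (f : M → N) (x : M) :
    φ.model →L[ℝ] ψ.model :=
  fderiv ℝ (localRep φ ψ f) (φ.toFun x)

/-- Submersions: all tangent maps are onto, with split kernel. -/
def IsSubmersion (A : ι → BanachChart M) (B : κ → BanachChart N) (f : M → N) : Prop :=
  IsSmoothMap A B f ∧ ∀ x i j, x ∈ (A i).source → f x ∈ (B j).source →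
    Function.Surjective (tangentRep (A i) (B j) f x) ∧
      (LinearMap.ker (tangentRep (A i) (B j) f x : (A i).model →ₗ[ℝ] (B j).model)).ClosedComplemented

/-- `f` makes `M` an immersed submanifold of `N`: it is injective and smooth, and all its tangent
maps are injective with closed range. -/
def IsImmersedSubmanifold (A : ι → BanachChart M) (B : κ → BanachChart N) (f : M → N) : Prop :=
  Function.Injective f ∧ IsSmoothMap A B f ∧
    ∀ x i j, x ∈ (A i).source → f x ∈ (B j).source →
      Function.Injective (tangentRep (A i) (B j) f x) ∧
        IsClosed (Set.range (tangentRep (A i) (B j) f x))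

/-- `f` makes `M` a split immersed submanifold of `N`: moreover the ranges of all tangent maps
are complemented. -/
def IsSplitImmersedSubmanifold (A : ι → BanachChart M) (B : κ → BanachChart N) (f : M → N) :
    Prop :=
  IsImmersedSubmanifold A B f ∧
    ∀ x i j, x ∈ (A i).source → f x ∈ (B j).source →
      (LinearMap.range
        (tangentRep (A i) (B j) f x : (A i).model →ₗ[ℝ] (B j).model)).ClosedComplemented

end Manifold

/-! ### Banach Lie groupoids -/

/-- A groupoid with set of arrows `G` and set of objects `M`; `mul g h` is defined when
`s g = t h`. -/
structure SetGroupoid (G M : Type u) where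
  /-- source -/
  s : G → M
  /-- target -/
  t : G → M
  /-- identity section -/
  unit : M → G
  /-- inversion -/
  inv : G → G
  /-- multiplication of composable arrows -/
  mul : (g h : G) → s g = t h → G
  s_mul : ∀ g h e, s (mul g h e) = s h
  t_mul : ∀ g h e, t (mul g h e) = t g
  mul_assoc : ∀ g h k (e : s g = t h) (e' : s h = t k),
    mul (mul g h e) k ((s_mul g h e).trans e') = mul g (mul h k e') (e.trans (t_mul h k e').symm)
  s_unit : ∀ x, s (unit x) = x
  t_unit : ∀ x, t (unit x) = x
  mul_unit : ∀ g, mul g (unit (s g)) (t_unit _).symm = g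
  unit_mul : ∀ g, mul (unit (t g)) g (s_unit _) = g
  s_inv : ∀ g, s (inv g) = t g
  t_inv : ∀ g, t (inv g) = s g
  mul_inv : ∀ g, mul g (inv g) (t_inv g).symm = unit (t g)
  inv_mul : ∀ g, mul (inv g) g (s_inv g) = unit (s g)

namespace SetGroupoid

variable {G M G' M' : Type u} {ι κ : Type u}

/-- The full subgroupoid `s⁻¹(S) ∩ t⁻¹(S) ⇉ S` over a subset `S` of the base. -/
def restrict (𝒢 : SetGroupoid G M) (S : Set M) :
    SetGroupoid {g : G // 𝒢.s g ∈ S ∧ 𝒢.t g ∈ S} {x : M // x ∈ S} where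
  s g := ⟨𝒢.s g, g.2.1⟩
  t g := ⟨𝒢.t g, g.2.2⟩
  unit x := ⟨𝒢.unit x, by rw [𝒢.s_unit]; exact x.2, by rw [𝒢.t_unit]; exact x.2⟩
  inv g := ⟨𝒢.inv g, by rw [𝒢.s_inv]; exact g.2.2, by rw [𝒢.t_inv]; exact g.2.1⟩
  mul g h e := ⟨𝒢.mul g h (congrArg Subtype.val e),
    by rw [𝒢.s_mul]; exact h.2.1, by rw [𝒢.t_mul]; exact g.2.2⟩
  s_mul _ _ _ := Subtype.ext (𝒢.s_mul _ _ _)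
  t_mul _ _ _ := Subtype.ext (𝒢.t_mul _ _ _)
  mul_assoc _ _ _ _ _ := Subtype.ext (𝒢.mul_assoc _ _ _ _ _)
  s_unit _ := Subtype.ext (𝒢.s_unit _)
  t_unit _ := Subtype.ext (𝒢.t_unit _)
  mul_unit _ := Subtype.ext (𝒢.mul_unit _)
  unit_mul _ := Subtype.ext (𝒢.unit_mul _)
  s_inv _ := Subtype.ext (𝒢.s_inv _)
  t_inv _ := Subtype.ext (𝒢.t_inv _)
  mul_inv _ := Subtype.ext (𝒢.mul_inv _)
  inv_mul _ := Subtype.ext (𝒢.inv_mul _)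

/-- `F` on arrows and `f` on objects form a morphism of groupoids. -/
structure IsHom (𝒢 : SetGroupoid G M) (ℋ : SetGroupoid G' M') (F : G → G') (f : M → M') :
    Prop where
  map_s : ∀ g, ℋ.s (F g) = f (𝒢.s g)
  map_t : ∀ g, ℋ.t (F g) = f (𝒢.t g)
  map_unit : ∀ x, F (𝒢.unit x) = ℋ.unit (f x)
  map_inv : ∀ g, F (𝒢.inv g) = ℋ.inv (F g)
  map_mul : ∀ g h (e : 𝒢.s g = 𝒢.t h) (e' : ℋ.s (F g) = ℋ.t (F h)),
    F (𝒢.mul g h e) = ℋ.mul (F g) (F h) e'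

/-- The multiplication is smooth on the set of composable pairs, a subset of the manifold `G × G`:
in charts it is locally the restriction of a smooth map defined on an open set. -/
def IsSmoothMul (𝒢 : SetGroupoid G M) (A : ι → BanachChart G) : Prop :=
  ∀ (g h : G) (e : 𝒢.s g = 𝒢.t h) (i j k : ι),
    g ∈ (A i).source → h ∈ (A j).source → 𝒢.mul g h e ∈ (A k).source →
    ∃ (O : Set ((A i).model × (A j).model)) (F : (A i).model × (A j).model → (A k).model),
      IsOpen O ∧ ((A i).toFun g, (A j).toFun h) ∈ O ∧ ContDiffOn ℝ ∞ F O ∧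
      ∀ (g' h' : G) (e' : 𝒢.s g' = 𝒢.t h'), g' ∈ (A i).source → h' ∈ (A j).source →
        ((A i).toFun g', (A j).toFun h') ∈ O →
        𝒢.mul g' h' e' ∈ (A k).source ∧
          (A k).toFun (𝒢.mul g' h' e') = F ((A i).toFun g', (A j).toFun h')

/-- A groupoid with manifold structures on arrows (atlas `A`) and objects (atlas `B`) is a
(Hausdorff) Banach Lie groupoid. As the inversion is an involution, it is a diffeomorphism as soon
as it is smooth. -/
structure IsBanachLieGroupoid (𝒢 : SetGroupoid G M) (A : ι → BanachChart G)
    (B : κ → BanachChart M) : Prop where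
  manifold_arrows : IsBanachManifold A
  manifold_objects : IsBanachManifold B
  surjective_s : Function.Surjective 𝒢.s
  surjective_t : Function.Surjective 𝒢.t
  submersion_s : IsSubmersion A B 𝒢.s
  submersion_t : IsSubmersion A B 𝒢.t
  smooth_mul : 𝒢.IsSmoothMul A
  embedding_unit : @Topology.IsEmbedding M G (atlasTopology B) (atlasTopology A) 𝒢.unit
  bijective_inv : Function.Bijective 𝒢.inv
  smooth_inv : IsSmoothMap A A 𝒢.inv

end SetGroupoid

/-! ### The groupoid of partial isometries over the lattice of projections -/

section Hilbert

variable (H : Type u) [NormedAddCommGroup H] [InnerProductSpace ℂ H] [CompleteSpace H]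

/-- The set of orthogonal projections of `H`; a projection is identified with the closed
subspace that is its range. -/
abbrev Proj : Type u := {p : H →L[ℂ] H // IsStarProjection p}

/-- The set of partial isometries of `H`: operators `u` such that `u* u` is a projection. -/
abbrev PIso : Type u := {u : H →L[ℂ] H // IsStarProjection (star u * u)}

variable {H}

theorem PIso.mul_star_mul (v : PIso H) : v.1 * (star v.1 * v.1) = v.1 := by
  have h := v.2.isIdempotentElem.eq
  have h0 : star (v.1 - v.1 * (star v.1 * v.1)) * (v.1 - v.1 * (star v.1 * v.1)) = 0 := by
    have e : star (v.1 - v.1 * (star v.1 * v.1)) * (v.1 - v.1 * (star v.1 * v.1))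
        = star v.1 * v.1 - star v.1 * v.1 * (star v.1 * v.1) - star v.1 * v.1 * (star v.1 * v.1)
          + star v.1 * v.1 * (star v.1 * v.1) * (star v.1 * v.1) := by
      simp only [star_sub, star_mul, star_star]
      noncomm_ring
    rw [e, h, h]
    abel
  have := CStarRing.star_mul_self_eq_zero_iff _ |>.1 h0
  exact (sub_eq_zero.1 this).symm

theorem PIso.isStarProjection_mul_star (v : PIso H) : IsStarProjection (v.1 * star v.1) where
  isIdempotentElem := by
    have h := v.mul_star_mul
    change v.1 * star v.1 * (v.1 * star v.1) = v.1 * star v.1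
    calc v.1 * star v.1 * (v.1 * star v.1) = v.1 * (star v.1 * v.1) * star v.1 := by
          simp only [mul_assoc]
      _ = _ := by rw [h]
  isSelfAdjoint := by simp [IsSelfAdjoint]

/-- The source `u* u` of a partial isometry (the projection onto its initial space). -/
def PIso.src (v : PIso H) : Proj H := ⟨star v.1 * v.1, v.2⟩

/-- The target `u u*` of a partial isometry (the projection onto its final space). -/
def PIso.tgt (v : PIso H) : Proj H := ⟨v.1 * star v.1, v.isStarProjection_mul_star⟩

theorem Proj.mul_self (p : Proj H) : p.1 * p.1 = p.1 := p.2.isIdempotentElem.eq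

theorem Proj.star_eq (p : Proj H) : star p.1 = p.1 := p.2.isSelfAdjoint.star_eq

variable (H) in
/-- The groupoid of partial isometries of `H` over the lattice of orthogonal projections, with
source `u* u`, target `u u*`, product of operators, units the projections, and inverse `u*`. -/
def partialIsometryGroupoid : SetGroupoid (PIso H) (Proj H) where
  s := PIso.src
  t := PIso.tgt
  unit p := ⟨p.1, by rw [p.star_eq, p.mul_self]; exact p.2⟩
  inv v := ⟨star v.1, by rw [star_star]; exact v.isStarProjection_mul_star⟩
  mul v w e := ⟨v.1 * w.1, by
    have e' : star v.1 * v.1 = w.1 * star w.1 := congrArg Subtype.val e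
    have : star (v.1 * w.1) * (v.1 * w.1) = star w.1 * w.1 := by
      calc star (v.1 * w.1) * (v.1 * w.1) = star w.1 * (star v.1 * v.1) * w.1 := by
            simp only [star_mul, mul_assoc]
        _ = star w.1 * (w.1 * (star w.1 * w.1)) := by rw [e']; simp only [mul_assoc]
        _ = _ := by rw [w.mul_star_mul]
    rw [this]; exact w.2⟩
  s_mul v w e := Subtype.ext <| by
    have e' : star v.1 * v.1 = w.1 * star w.1 := congrArg Subtype.val e
    change star (v.1 * w.1) * (v.1 * w.1) = star w.1 * w.1
    calc star (v.1 * w.1) * (v.1 * w.1) = star w.1 * (star v.1 * v.1) * w.1 := by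
            simp only [star_mul, mul_assoc]
        _ = star w.1 * (w.1 * (star w.1 * w.1)) := by rw [e']; simp only [mul_assoc]
        _ = _ := by rw [w.mul_star_mul]
  t_mul v w e := Subtype.ext <| by
    have e' : star v.1 * v.1 = w.1 * star w.1 := congrArg Subtype.val e
    change v.1 * w.1 * star (v.1 * w.1) = v.1 * star v.1
    calc v.1 * w.1 * star (v.1 * w.1) = v.1 * (w.1 * star w.1) * star v.1 := by
            simp only [star_mul, mul_assoc]
        _ = v.1 * (star v.1 * v.1) * star v.1 := by rw [e']
        _ = _ := by rw [v.mul_star_mul]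
  mul_assoc v w x _ _ := Subtype.ext (_root_.mul_assoc v.1 w.1 x.1)
  s_unit p := Subtype.ext <| by
    change star p.1 * p.1 = p.1
    rw [p.star_eq, p.mul_self]
  t_unit p := Subtype.ext <| by
    change p.1 * star p.1 = p.1
    rw [p.star_eq, p.mul_self]
  mul_unit v := Subtype.ext v.mul_star_mul
  unit_mul v := Subtype.ext <| by
    change v.1 * star v.1 * v.1 = v.1
    rw [_root_.mul_assoc, v.mul_star_mul]
  s_inv v := Subtype.ext <| by
    change star (star v.1) * star v.1 = v.1 * star v.1
    rw [star_star]
  t_inv v := Subtype.ext <| by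
    change star v.1 * star (star v.1) = star v.1 * v.1
    rw [star_star]
  mul_inv v := rfl
  inv_mul v := rfl

/-! ### Charts

For a projection `p` with range `W`, operators `W → Wᗮ` are identified with the operators `A` on `H`
such that `(1 - p) A p = A`, and operators on `W` with the operators `X` such that `p X p = X`. -/

/-- The space of bounded operators `W → Wᗮ`, where `W` is the range of `p`. -/
def offDiag (p : Proj H) : Submodule ℝ (H →L[ℂ] H) where
  carrier := {A | (1 - p.1) * A * p.1 = A}
  add_mem' {A B} hA hB := by
    have hA : (1 - p.1) * A * p.1 = A := hA
    have hB : (1 - p.1) * B * p.1 = B := hB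
    change (1 - p.1) * (A + B) * p.1 = A + B
    rw [mul_add, add_mul, hA, hB]
  zero_mem' := by simp
  smul_mem' c A hA := by
    have hA : (1 - p.1) * A * p.1 = A := hA
    change (1 - p.1) * (c • A) * p.1 = c • A
    rw [mul_smul_comm, smul_mul_assoc, hA]

/-- The space of compact operators `W → Wᗮ` with the operator norm, where `W` is the range
of `p`. -/
def compactOffDiag (p : Proj H) : Submodule ℝ (H →L[ℂ] H) :=
  offDiag p ⊓ (compactOperator (RingHom.id ℂ) H H).restrictScalars ℝ

/-- The space of bounded skew-adjoint operators on the range of `p`. -/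
def skewCorner (p : Proj H) : Submodule ℝ (H →L[ℂ] H) where
  carrier := {X | star X = -X ∧ p.1 * X * p.1 = X}
  add_mem' {X Y} hX hY := by
    refine ⟨?_, ?_⟩
    · rw [star_add, hX.1, hY.1, neg_add]
    · rw [mul_add, add_mul, hX.2, hY.2]
  zero_mem' := by simp
  smul_mem' c X hX := by
    refine ⟨?_, ?_⟩
    · rw [star_smul, hX.1, star_trivial, smul_neg]
    · rw [mul_smul_comm, smul_mul_assoc, hX.2]

theorem isClosed_offDiag (p : Proj H) : IsClosed (offDiag p : Set (H →L[ℂ] H)) :=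
  isClosed_eq (f := fun A : H →L[ℂ] H => (1 - p.1) * A * p.1) (g := fun A => A)
    (by fun_prop) continuous_id

theorem isClosed_compactOffDiag (p : Proj H) :
    IsClosed (compactOffDiag p : Set (H →L[ℂ] H)) :=
  (isClosed_offDiag p).inter
    (isClosed_setOfPred_isCompactOperator (σ₁₂ := RingHom.id ℂ) (M₁ := H) (M₂ := H))

theorem isClosed_skewCorner (p : Proj H) : IsClosed (skewCorner p : Set (H →L[ℂ] H)) :=
  (isClosed_eq (f := fun A : H →L[ℂ] H => star A) (g := fun A => -A)
    continuous_star continuous_neg).inter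
    (isClosed_eq (f := fun A : H →L[ℂ] H => p.1 * A * p.1) (g := fun A => A)
      (by fun_prop) continuous_id)

instance (p : Proj H) : CompleteSpace (offDiag p) := (isClosed_offDiag p).completeSpace_coe

instance (p : Proj H) : CompleteSpace (compactOffDiag p) :=
  (isClosed_compactOffDiag p).completeSpace_coe

instance (p : Proj H) : CompleteSpace (skewCorner p) := (isClosed_skewCorner p).completeSpace_coe

/-- The domain of the graph chart at `W = range p`: closed subspaces `V` with `V ⊕ Wᗮ = H`
(direct sum of Banach spaces, not necessarily orthogonal). -/
def graphDomain (p : Proj H) : Set (Proj H) :=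
  {q | IsCompl (LinearMap.range (q.1 : H →ₗ[ℂ] H)) (LinearMap.range (p.1 : H →ₗ[ℂ] H))ᗮ}

/-- The graph coordinate `(1 - p) q p (p q p)⁻¹` of a projection `q`, the inverse of `p q p` being
taken in the operators on `W = range p`. For `q` in `graphDomain p` with range `V` this is the
operator `P_{Wᗮ} (P_W|_V)⁻¹ : W → Wᗮ` whose graph is `V`. -/
def graphCoord (p q : Proj H) : H →L[ℂ] H :=
  (1 - p.1) * q.1 * p.1 * Ring.inverse (p.1 * q.1 * p.1 + (1 - p.1)) * p.1

theorem graphCoord_mem (p q : Proj H) : graphCoord p q ∈ offDiag p := by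
  change (1 - p.1) * graphCoord p q * p.1 = graphCoord p q
  have h1 : (1 - p.1) * (1 - p.1) = 1 - p.1 := p.2.one_sub.isIdempotentElem.eq
  have h2 := p.mul_self
  unfold graphCoord
  simp only [mul_assoc, h2]
  simp only [← mul_assoc, h1]

/-- The graph chart of the Grassmannian at `p`. -/
def grassmannianChart (p : Proj H) : BanachChart (Proj H) where
  model := offDiag p
  source := graphDomain p
  toFun q := ⟨graphCoord p q, graphCoord_mem p q⟩

variable (H) in
/-- The atlas of the Grassmannian of all closed subspaces of `H`. -/
def grassmannianAtlas : Proj H → BanachChart (Proj H) := grassmannianChart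

/-- The local cross-section of the Grassmannian at `W = range p`: for `q` in `graphDomain p` with
range `V` and graph coordinate `A`, this is the partial isometry `(1_W + A) (1 + A* A)^{-1/2}` with
initial space `W` and final space `V`, the unitary part of the isomorphism `1_W + A : W → V`. -/
def crossSection (p q : Proj H) : H →L[ℂ] H :=
  (p.1 + graphCoord p q) *
    CFC.sqrt (Ring.inverse (1 + star (graphCoord p q) * graphCoord p q)) * p.1

/-- For `v` near `u₀`, the operator `u₀* σ(v v*)* v σ(v* v)`, which is unitary on the initial space
of `u₀`. Here `σ` are the cross-sections at the target and at the source of `u₀`. -/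
def unitaryPart (u₀ v : PIso H) : H →L[ℂ] H :=
  star u₀.1 * star (crossSection u₀.tgt v.tgt) * v.1 * crossSection u₀.src v.src

/-- The Cayley coordinate on the unitary group of `W = range p`. For `g` unitary on `W` with
`1 + g` invertible it is `(g - p) (g + p)⁻¹`, since `(g + p)* (g - p) = g - g*`; we write it as
`c* (g - g*) c` with `c = (g + p)⁻¹` (inverse in the operators on `W`), which is visibly
skew-adjoint. -/
def cayleyCoord (p : Proj H) (g : H →L[ℂ] H) : H →L[ℂ] H :=
  star (p.1 * Ring.inverse (1 + g) * p.1) * (g - star g) * (p.1 * Ring.inverse (1 + g) * p.1)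

theorem cayleyCoord_mem (p : Proj H) (g : H →L[ℂ] H) : cayleyCoord p g ∈ skewCorner p := by
  have h2 := p.mul_self
  have h3 := p.star_eq
  refine ⟨?_, ?_⟩
  · unfold cayleyCoord
    simp only [star_mul, star_sub, star_star, h3]
    noncomm_ring
  · unfold cayleyCoord
    simp only [star_mul, h3, mul_assoc, h2]
    simp only [← mul_assoc, h2]

/-- The domain of the chart of the set of partial isometries at `u₀`. -/
def partialIsometryDomain (u₀ : PIso H) : Set (PIso H) :=
  {v | v.tgt ∈ graphDomain u₀.tgt ∧ v.src ∈ graphDomain u₀.src ∧ IsUnit (1 + unitaryPart u₀ v)}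

/-- The chart of the set of partial isometries at `u₀`: the graph coordinates of the final and
of the initial space, and the Cayley coordinate of the unitary part. -/
def partialIsometryChart (u₀ : PIso H) : BanachChart (PIso H) where
  model := offDiag u₀.tgt × offDiag u₀.src × skewCorner u₀.src
  source := partialIsometryDomain u₀
  toFun v := (⟨graphCoord u₀.tgt v.tgt, graphCoord_mem _ _⟩,
    ⟨graphCoord u₀.src v.src, graphCoord_mem _ _⟩,
    ⟨cayleyCoord u₀.src (unitaryPart u₀ v), cayleyCoord_mem _ _⟩)

variable (H) in
/-- The atlas of the set of all partial isometries of `H`. -/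
def partialIsometryAtlas : PIso H → BanachChart (PIso H) := partialIsometryChart

/-! ### The restricted Grassmannian and its groupoid, for the ideal of compact operators -/

section Restricted

variable (Hp : Submodule ℂ H) [Hp.HasOrthogonalProjection]

/-- The restricted Grassmannian with respect to the polarization `H = Hp ⊕ Hpᗮ` and the ideal of
compact operators: closed subspaces `W` (ranges of projections) such that the orthogonal projection
`W → Hp` is Fredholm and the orthogonal projection `W → Hpᗮ` is compact. -/
def resGrassmannian : Set (Proj H) :=
  {p | (Hp.orthogonalProjectionOnto ∘L
          (LinearMap.range (p.1 : H →ₗ[ℂ] H)).subtypeL).IsFredholm ∧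
       IsCompactOperator (Hpᗮ.orthogonalProjectionOnto ∘L
          (LinearMap.range (p.1 : H →ₗ[ℂ] H)).subtypeL)}

variable {Hp}

theorem isCompactOperator_of_hasNoetherianRange {E F : Type u} [NormedAddCommGroup E]
    [NormedSpace ℂ E] [NormedAddCommGroup F] [NormedSpace ℂ F] (f : E →L[ℂ] F)
    (hf : (f : E →ₗ[ℂ] F).HasNoetherianRange) : IsCompactOperator f := by
  have hfin : FiniteDimensional ℂ (LinearMap.range (f : E →ₗ[ℂ] F)) :=
    haveI := hf.isNoetherian_range
    inferInstance
  have : ProperSpace (LinearMap.range (f : E →ₗ[ℂ] F)) := FiniteDimensional.proper ℂ _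
  have h : IsCompactOperator (f.codRestrict (LinearMap.range (f : E →ₗ[ℂ] F))
      (fun x => LinearMap.mem_range_self _ x)) :=
    (isCompactOperator_id (E := LinearMap.range (f : E →ₗ[ℂ] F))).comp_clm
      (f.codRestrict (LinearMap.range (f : E →ₗ[ℂ] F)) (fun x => LinearMap.mem_range_self _ x))
  exact h.clm_comp (LinearMap.range (f : E →ₗ[ℂ] F)).subtypeL

theorem isCompactOperator_one_sub_comp_subtypeL {p : Proj H} (hp : p ∈ resGrassmannian Hp) :
    IsCompactOperator ((1 - p.1) ∘L Hp.subtypeL) := by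
  let W := LinearMap.range (p.1 : H →ₗ[ℂ] H)
  let T : W →L[ℂ] Hp := Hp.orthogonalProjectionOnto ∘L W.subtypeL
  have hT : T.IsFredholm := hp.1
  obtain ⟨S, hS⟩ := hT.exists_isQuasiInverse
  have hF : IsCompactOperator (T ∘L S - ContinuousLinearMap.id ℂ Hp) :=
    isCompactOperator_of_hasNoetherianRange _ (LinearMap.FiniteRangeSetoid.equiv_iff_hasNoetherianRange.1 hS.2)
  have h1 := ((hp.2.clm_comp Hpᗮ.subtypeL).clm_comp (1 - p.1)).comp_clm S
  have h2 := hF.clm_comp ((1 - p.1) ∘L Hp.subtypeL)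
  refine (congrArg IsCompactOperator (funext fun x => ?_)).mpr (h1.add h2).neg
  have hw : (1 - p.1) ((S x : W) : H) = 0 := by
    obtain ⟨y, hy⟩ := (S x).2
    have hy' : p.1 y = (S x : H) := hy
    rw [← hy']
    change ((1 - p.1) * p.1) y = 0
    rw [p.2.one_sub_mul_self]; rfl
  have hsum : ((S x : W) : H) = (T (S x) : H) +
      (Hpᗮ.orthogonalProjectionOnto ((S x : W) : H) : H) :=
    (Hp.starProjection_add_starProjection_orthogonal _).symm
  rw [hsum, map_add] at hw
  have hval : (((T ∘L S - ContinuousLinearMap.id ℂ Hp) x : Hp) : H) = (T (S x) : H) - x := rfl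
  change (1 - p.1) (x : H) = -((1 - p.1) (Hpᗮ.orthogonalProjectionOnto ((S x : W) : H) : H) +
    (1 - p.1) (((T ∘L S - ContinuousLinearMap.id ℂ Hp) x : Hp) : H))
  rw [hval, map_sub, ← sub_eq_zero, ← hw]
  abel

/-- If the ranges of `p` and `q` are in the restricted Grassmannian, then `(1 - p) q` is compact. -/
theorem isCompactOperator_one_sub_mul {p q : Proj H} (hp : p ∈ resGrassmannian Hp)
    (hq : q ∈ resGrassmannian Hp) :
    IsCompactOperator ((1 - p.1) * q.1 : H →L[ℂ] H) := by
  have h1 := (isCompactOperator_one_sub_comp_subtypeL hp).comp_clm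
    (Hp.orthogonalProjectionOnto ∘L q.1)
  have h2 := ((hq.2.clm_comp Hpᗮ.subtypeL).clm_comp (1 - p.1)).comp_clm
    ((q.1).codRestrict (LinearMap.range (q.1 : H →ₗ[ℂ] H)) (fun x => LinearMap.mem_range_self _ x))
  refine (congrArg IsCompactOperator (funext fun x => ?_)).mpr (h1.add h2)
  have hsum : q.1 x = (Hp.orthogonalProjectionOnto (q.1 x) : H) +
      (Hpᗮ.orthogonalProjectionOnto (q.1 x) : H) :=
    (Hp.starProjection_add_starProjection_orthogonal _).symm
  change (1 - p.1) (q.1 x) = (1 - p.1) (Hp.orthogonalProjectionOnto (q.1 x) : H) +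
    (1 - p.1) (Hpᗮ.orthogonalProjectionOnto (q.1 x) : H)
  rw [← map_add, ← hsum]

theorem graphCoord_mem_compactOffDiag {p q : Proj H} (hp : p ∈ resGrassmannian Hp)
    (hq : q ∈ resGrassmannian Hp) : graphCoord p q ∈ compactOffDiag p := by
  refine ⟨graphCoord_mem p q, ?_⟩
  have h := (isCompactOperator_one_sub_mul hp hq).comp_clm
    (p.1 * Ring.inverse (p.1 * q.1 * p.1 + (1 - p.1)) * p.1)
  have e : graphCoord p q = ((1 - p.1) * q.1) *
    (p.1 * Ring.inverse (p.1 * q.1 * p.1 + (1 - p.1)) * p.1) := by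
    unfold graphCoord; simp only [mul_assoc]
  rw [e]
  exact h

variable (Hp)

/-- The graph charts of the restricted Grassmannian, with values in compact operators. -/
def resGrassmannianAtlas :
    {p // p ∈ resGrassmannian Hp} → BanachChart {p // p ∈ resGrassmannian Hp} := fun p =>
  { model := compactOffDiag p.1
    source := {q | q.1 ∈ graphDomain p.1}
    toFun := fun q => ⟨graphCoord p.1 q.1, graphCoord_mem_compactOffDiag p.2 q.2⟩ }

/-- The set of partial isometries with initial and final space in the restricted Grassmannian. -/
abbrev ResPIso : Type u :=
  {v : PIso H // (partialIsometryGroupoid H).s v ∈ resGrassmannian Hp ∧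
    (partialIsometryGroupoid H).t v ∈ resGrassmannian Hp}

/-- The groupoid of partial isometries over the restricted Grassmannian. -/
def resPartialIsometryGroupoid :
    SetGroupoid (ResPIso Hp) {p // p ∈ resGrassmannian Hp} :=
  (partialIsometryGroupoid H).restrict (resGrassmannian Hp)

/-- The charts of the set of partial isometries over the restricted Grassmannian: the graph
coordinates are taken in compact operators, the unitary part is arbitrary. -/
def resPartialIsometryAtlas : ResPIso Hp → BanachChart (ResPIso Hp) := fun u₀ =>
  { model := compactOffDiag u₀.1.tgt × compactOffDiag u₀.1.src × skewCorner u₀.1.src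
    source := {v | v.1 ∈ partialIsometryDomain u₀.1}
    toFun := fun v =>
      (⟨graphCoord u₀.1.tgt v.1.tgt, graphCoord_mem_compactOffDiag u₀.2.2 v.2.2⟩,
        ⟨graphCoord u₀.1.src v.1.src, graphCoord_mem_compactOffDiag u₀.2.1 v.2.1⟩,
        ⟨cayleyCoord u₀.1.src (unitaryPart u₀.1 v.1), cayleyCoord_mem _ _⟩) }

end Restricted

end Hilbert

end

/-! Both groupoids and both bases embed injectively into the Banach algebra of bounded operators on
`H`, and every chart is compared with this ambient space. A `SliceChart` records that a chart is
onto its model, extends smoothly to an open set of operators, and has an inverse that is smooth as a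
map into operators. The atlas topology is then the operator-norm topology
(`atlasTopology_eq_induced`), so Hausdorffness and the embedding of the units are immediate. Source,
target, inversion and inclusion are restrictions of `star v * v`, `v * star v`, `star` and the
identity, hence smooth. The extended charts land in an ambient space larger than the model;
`LinearIsometry.contDiffOn_of_comp` brings smoothness back to the closed model space, which need not
be complemented.

The slice property is operator algebra. A projection `q` lies in the graph domain of `p` exactly
when `intertwiner p q.1` is invertible, an open condition, and then `q` is the graph projection of
its coordinate `A`. The factor `(1 + A* A)^{-1/2}` is smooth in `A` because `(1 + A* A)⁻¹` always
lies in the open unit ball around `1`, where the binomial series converges. For partial isometries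
the remaining coordinate is inverted by the Cayley transform (`cayleyInv_facts`,
`cayleyInv_cayleyCoord`). In the restricted case the charts stay onto because compact perturbations
preserve the Fredholm property (`graphProj_mem_resGrassmannian`).

In charts with a common center, source and target are coordinate projections and the inclusions are
linear isometries. This gives submersions and immersions at once. A splitting would produce a
bounded operator on the operators `W → Wᗮ` whose kernel is exactly the compact ones. Whitley's
argument for `c₀ ⊂ ℓ^∞`, moved to diagonal operators, excludes this: on an uncountable almost
disjoint family of subsets of `ℕ`, an operator that kills finitely supported sequences and has a
countable separating family of functionals on its target must kill the indicator of some infinite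
set, whose diagonal operator is not compact. -/

noncomputable section

/-! ### Smooth maps into closed subspaces -/

section ClosedSubspace

variable {X F G : Type u} [NormedAddCommGroup X] [NormedSpace ℝ X]
  [NormedAddCommGroup F] [NormedSpace ℝ F] [NormedAddCommGroup G] [NormedSpace ℝ G]

/-- A map whose composition with an isometric embedding of a complete space is differentiable is
itself differentiable. -/
theorem LinearIsometry.exists_hasFDerivAt_of_comp [CompleteSpace F] (ι : F →ₗᵢ[ℝ] G)
    {g : X → F} {x : X} {D : X →L[ℝ] G} (h : HasFDerivAt (fun y => ι (g y)) D x) :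
    ∃ D' : X →L[ℝ] F, ι.toContinuousLinearMap ∘L D' = D ∧ HasFDerivAt g D' x := by
  have hcl : IsClosed (Set.range ι) := ι.isometry.isClosedEmbedding.isClosed_range
  -- Each directional derivative is a limit of difference quotients, which lie in the range of `ι`;
  -- this range is closed because `F` is complete.
  have hmem : ∀ v, D v ∈ LinearMap.range ι.toLinearMap := by
    intro v
    have h1 : HasDerivAt (fun t : ℝ => x + t • v) v 0 := by
      simpa using ((hasDerivAt_id (0 : ℝ)).smul_const v).const_add x
    have h2 : HasFDerivAt (fun y => ι (g y)) D (x + (0 : ℝ) • v) := by simpa using h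
    have h3 := h2.comp_hasDerivAt (0 : ℝ) h1
    rw [hasDerivAt_iff_tendsto_slope] at h3
    refine hcl.mem_of_tendsto h3 (Filter.Eventually.of_forall fun t => ?_)
    refine ⟨slope (fun t : ℝ => g (x + t • v)) 0 t, ?_⟩
    simp [slope_def_module]
  let D' : X →L[ℝ] F := ι.equivRange.symm.toContinuousLinearEquiv.toContinuousLinearMap ∘L
    (D.codRestrict (LinearMap.range ι.toLinearMap) hmem)
  have hD' : ∀ v, ι (D' v) = D v := fun v =>
    congrArg Subtype.val (ι.equivRange.apply_symm_apply ⟨D v, hmem v⟩)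
  refine ⟨D', ContinuousLinearMap.ext hD', ?_⟩
  rw [hasFDerivAt_iff_isLittleO] at h ⊢
  -- `ι` preserves norms, so the two remainders have the same size.
  refine Asymptotics.IsLittleO.congr_left (f₁ := fun y => ‖ι (g y) - ι (g x) - D (y - x)‖)
    h.norm_left ?_ |>.of_norm_left
  intro y
  rw [← hD', ← map_sub, ← map_sub, ι.norm_map]

/-- Induction on the order of smoothness. The spaces are quantified inside the statement because the
induction step passes to derivatives: postcomposition with `ι` is an isometry `J` from `X →L[ℝ] F`
to `X →L[ℝ] G`, with complete domain. -/
theorem LinearIsometry.contDiffOn_nat_of_comp {s : Set X} (hs : IsOpen s) (n : ℕ) :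
    ∀ {F G : Type u} [NormedAddCommGroup F] [NormedSpace ℝ F] [NormedAddCommGroup G]
      [NormedSpace ℝ G] [CompleteSpace F] (ι : F →ₗᵢ[ℝ] G) {g : X → F},
      ContDiffOn ℝ n (fun y => ι (g y)) s → ContDiffOn ℝ n g s := by
  induction n with
  | zero =>
    intro F G _ _ _ _ _ ι g h
    simp only [Nat.cast_zero, contDiffOn_zero] at h ⊢
    exact ι.isometry.isEmbedding.continuousOn_iff.2 h
  | succ n ih =>
    intro F G _ _ _ _ _ ι g h
    rw [Nat.cast_succ, contDiffOn_succ_iff_fderiv_of_isOpen hs] at h ⊢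
    have key : ∀ x ∈ s, DifferentiableAt ℝ g x ∧
        ι.toContinuousLinearMap ∘L fderiv ℝ g x = fderiv ℝ (fun y => ι (g y)) x := by
      intro x hx
      obtain ⟨D', h1, h2⟩ := ι.exists_hasFDerivAt_of_comp
        ((h.1 x hx).differentiableAt (hs.mem_nhds hx)).hasFDerivAt
      exact ⟨h2.differentiableAt, by rw [h2.fderiv, h1]⟩
    refine ⟨fun x hx => (key x hx).1.differentiableWithinAt, by simp, ?_⟩
    let J : (X →L[ℝ] F) →ₗᵢ[ℝ] (X →L[ℝ] G) :=
      { toLinearMap := (ContinuousLinearMap.compL ℝ X F G ι.toContinuousLinearMap).toLinearMap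
        norm_map' := fun D => ι.norm_toContinuousLinearMap_comp }
    exact ih J (h.2.2.congr fun x hx => (key x hx).2)

/-- A map whose composition with an isometric embedding of a complete space is smooth is itself
smooth. -/
theorem LinearIsometry.contDiffOn_of_comp [CompleteSpace F] (ι : F →ₗᵢ[ℝ] G) {s : Set X}
    (hs : IsOpen s) {g : X → F} (h : ContDiffOn ℝ ∞ (fun y => ι (g y)) s) :
    ContDiffOn ℝ ∞ g s := by
  rw [contDiffOn_infty] at h ⊢
  exact fun n => ι.contDiffOn_nat_of_comp hs n (h n)

end ClosedSubspace

/-! ### Charts of subsets of a normed space -/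

section Slice

variable {M N : Type u} {E E' : Type u} [NormedAddCommGroup E] [NormedSpace ℝ E]
  [NormedAddCommGroup E'] [NormedSpace ℝ E']

/-- A chart `φ` of `M` adapted to a map `e : M → E`: it is onto its model space, it is the
restriction of a smooth map on an open subset of `E` with values in a larger space, and its inverse
is smooth as a map into `E`. -/
structure SliceChart (e : M → E) (φ : BanachChart M) where
  /-- a normed space that contains the model space of the chart -/
  amb : Type u
  [normedAddCommGroup : NormedAddCommGroup amb]
  [normedSpace : NormedSpace ℝ amb]
  /-- the embedding of the model space -/
  ι : φ.model →ₗᵢ[ℝ] amb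
  /-- the domain of the extended chart -/
  U : Set E
  /-- the extended chart -/
  Φ : E → amb
  /-- the inverse of the chart -/
  Ψ : φ.model → E
  isOpen_U : IsOpen U
  contDiffOn_Φ : ContDiffOn ℝ ∞ Φ U
  contDiff_Ψ : ContDiff ℝ ∞ Ψ
  mem_source : ∀ x, x ∈ φ.source ↔ e x ∈ U
  Φ_apply : ∀ x ∈ φ.source, Φ (e x) = ι (φ.toFun x)
  Ψ_toFun : ∀ x ∈ φ.source, Ψ (φ.toFun x) = e x
  surj : ∀ y, ∃ x ∈ φ.source, φ.toFun x = y

attribute [instance] SliceChart.normedAddCommGroup SliceChart.normedSpace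

namespace SliceChart

variable {e : M → E} {e' : N → E'} {φ : BanachChart M} {ψ : BanachChart N}

theorem injOn (S : SliceChart e φ) (he : Function.Injective e) : Set.InjOn φ.toFun φ.source :=
  fun x hx y hy h => he (by rw [← S.Ψ_toFun x hx, h, S.Ψ_toFun y hy])

theorem localRep_toFun (S : SliceChart e φ) (he : Function.Injective e) (ψ : BanachChart N)
    (f : M → N) {x : M} (hx : x ∈ φ.source) :
    localRep φ ψ f (φ.toFun x) = ψ.toFun (f x) := by
  have hinj : Function.Injective (fun x : φ.source => φ.toFun x) :=
    fun a b h => Subtype.ext (S.injOn he a.2 b.2 h)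
  exact hinj.extend_apply (fun x : φ.source => ψ.toFun (f x)) 0 ⟨x, hx⟩

/-- Surjectivity of the chart makes every vector of the model a coordinate, so the domain can be
tested through `Ψ` alone; this turns its openness into continuity. -/
theorem localDomain_eq (S : SliceChart e φ) (T : SliceChart e' ψ) {f : M → N} {F : E → E'}
    (hF : ∀ x, e' (f x) = F (e x)) : localDomain φ ψ f = {y | F (S.Ψ y) ∈ T.U} := by
  ext y
  constructor
  · rintro ⟨x, ⟨hx, hfx⟩, rfl⟩
    change F (S.Ψ _) ∈ T.U
    rw [S.Ψ_toFun x hx, ← hF]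
    exact (T.mem_source _).1 hfx
  · intro hy
    obtain ⟨x, hx, rfl⟩ := S.surj y
    change F (S.Ψ _) ∈ T.U at hy
    rw [S.Ψ_toFun x hx, ← hF] at hy
    exact ⟨x, ⟨hx, (T.mem_source _).2 hy⟩, rfl⟩

/-- Up to the isometry `T.ι`, the local representative is `T.Φ ∘ F ∘ S.Ψ`. -/
theorem isSmoothAt (S : SliceChart e φ) (T : SliceChart e' ψ) (he : Function.Injective e)
    {f : M → N} {F : E → E'} (hF : ∀ x, e' (f x) = F (e x)) (hs : ContDiff ℝ ∞ F) :
    IsOpen (localDomain φ ψ f) ∧ ContDiffOn ℝ ∞ (localRep φ ψ f) (localDomain φ ψ f) := by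
  have hopen : IsOpen (localDomain φ ψ f) := by
    rw [S.localDomain_eq T hF]
    exact T.isOpen_U.preimage (hs.continuous.comp S.contDiff_Ψ.continuous)
  refine ⟨hopen, T.ι.contDiffOn_of_comp hopen ?_⟩
  have h1 : ContDiffOn ℝ ∞ (fun y => T.Φ (F (S.Ψ y))) (localDomain φ ψ f) :=
    T.contDiffOn_Φ.comp (hs.comp S.contDiff_Ψ).contDiffOn
      (fun y hy => by rw [S.localDomain_eq T hF] at hy; exact hy)
  refine h1.congr ?_
  rintro _ ⟨x, ⟨hx, hfx⟩, rfl⟩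
  rw [S.localRep_toFun he ψ f hx, S.Ψ_toFun x hx, ← hF, T.Φ_apply _ hfx]

variable {ψ' : BanachChart N}

/-- The derivatives of the transition maps are isomorphisms. -/
theorem exists_hasFDerivAt_transition (T : SliceChart e' ψ) (T' : SliceChart e' ψ')
    (he : Function.Injective e') {z : N} (hz : z ∈ ψ.source) (hz' : z ∈ ψ'.source) :
    ∃ D : ψ.model ≃L[ℝ] ψ'.model,
      HasFDerivAt (localRep ψ ψ' id) (D : ψ.model →L[ℝ] ψ'.model) (ψ.toFun z) := by
  -- Stated for an arbitrary pair of charts so that it applies in both directions; the chain rule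
  -- then makes the two derivatives mutually inverse.
  have key : ∀ {χ χ' : BanachChart N} (R : SliceChart e' χ) (R' : SliceChart e' χ'),
      z ∈ χ.source → z ∈ χ'.source →
      DifferentiableAt ℝ (localRep χ χ' id) (χ.toFun z) ∧
      (fun y => localRep χ' χ id (localRep χ χ' id y)) =ᶠ[nhds (χ.toFun z)] id := by
    intro χ χ' R R' h h'
    obtain ⟨ho, hd⟩ := R.isSmoothAt R' he (f := id) (F := id) (fun _ => rfl) contDiff_id
    have hm : χ.toFun z ∈ localDomain χ χ' id := ⟨z, ⟨h, h'⟩, rfl⟩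
    refine ⟨(hd.differentiableOn (by simp)).differentiableAt (ho.mem_nhds hm), ?_⟩
    filter_upwards [ho.mem_nhds hm]
    rintro _ ⟨x, ⟨hx, hx'⟩, rfl⟩
    rw [R.localRep_toFun he χ' id hx]
    exact R'.localRep_toFun he χ id hx'
  obtain ⟨d1, k1⟩ := key T T' hz hz'
  obtain ⟨d2, k2⟩ := key T' T hz' hz
  have e1 : localRep ψ ψ' id (ψ.toFun z) = ψ'.toFun z := T.localRep_toFun he ψ' id hz
  have e2 : localRep ψ' ψ id (ψ'.toFun z) = ψ.toFun z := T'.localRep_toFun he ψ id hz'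
  have c1 := (HasFDerivAt.comp (ψ.toFun z) (g := localRep ψ' ψ id)
    (by rw [e1]; exact d2.hasFDerivAt) d1.hasFDerivAt).congr_of_eventuallyEq k1.symm
  have c2 := (HasFDerivAt.comp (ψ'.toFun z) (g := localRep ψ ψ' id)
    (by rw [e2]; exact d1.hasFDerivAt) d2.hasFDerivAt).congr_of_eventuallyEq k2.symm
  have u1 := c1.unique (hasFDerivAt_id _)
  have u2 := c2.unique (hasFDerivAt_id _)
  exact ⟨ContinuousLinearEquiv.equivOfInverse _ _
    (fun v => DFunLike.congr_fun u1 v) (fun v => DFunLike.congr_fun u2 v), d1.hasFDerivAt⟩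

/-- The tangent map in arbitrary charts of a map that is linear in suitable charts. -/
theorem exists_tangentRep_eq (S : SliceChart e φ) (he : Function.Injective e)
    (T : SliceChart e' ψ) (T' : SliceChart e' ψ') (he' : Function.Injective e') {f : M → N}
    (L : φ.model →L[ℝ] ψ.model) (hf : ∀ x ∈ φ.source, f x ∈ ψ.source)
    (hL : ∀ x ∈ φ.source, ψ.toFun (f x) = L (φ.toFun x)) {x : M} (hx : x ∈ φ.source)
    (hx' : f x ∈ ψ'.source) :
    ∃ D : ψ.model ≃L[ℝ] ψ'.model,
      tangentRep φ ψ' f x = (D : ψ.model →L[ℝ] ψ'.model) ∘L L := by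
  obtain ⟨D, hD⟩ := T.exists_hasFDerivAt_transition T' he' (hf x hx) hx'
  refine ⟨D, HasFDerivAt.fderiv ?_⟩
  -- The chart is onto, so this equality holds on the whole model space.
  have h : localRep φ ψ' f = fun y => localRep ψ ψ' id (L y) := by
    funext y
    obtain ⟨x, hx, rfl⟩ := S.surj y
    rw [S.localRep_toFun he ψ' f hx, ← hL x hx]
    exact (T.localRep_toFun he' ψ' id (hf x hx)).symm
  rw [h]
  rw [hL x hx] at hD
  exact hD.comp _ L.hasFDerivAt

end SliceChart

variable {ι κ : Type u} {e : M → E} {e' : N → E'} {A : ι → BanachChart M} {B : κ → BanachChart N}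

/-- One inclusion comes from continuity of the inverses `Ψ`, the other from continuity of the
extended charts `Φ` on the open sets `U`. -/
theorem atlasTopology_eq_induced (S : ∀ i, SliceChart e (A i))
    (hc : ∀ x, ∃ i, x ∈ (A i).source) :
    atlasTopology A = TopologicalSpace.induced e inferInstance := by
  apply le_antisymm
  · rintro _ ⟨O, hO, rfl⟩
    have h : e ⁻¹' O = ⋃ i, (A i).source ∩ (A i).toFun ⁻¹' ((S i).Ψ ⁻¹' O) := by
      ext x
      simp only [Set.mem_preimage, Set.mem_iUnion, Set.mem_inter_iff]
      constructor
      · intro hx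
        obtain ⟨i, hi⟩ := hc x
        exact ⟨i, hi, by rwa [(S i).Ψ_toFun x hi]⟩
      · rintro ⟨i, hi, hx⟩
        rwa [(S i).Ψ_toFun x hi] at hx
    rw [h]
    refine @isOpen_iUnion _ _ (atlasTopology A) _ fun i =>
      TopologicalSpace.isOpen_generateFrom_of_mem ⟨i, _, ?_, rfl⟩
    exact hO.preimage (S i).contDiff_Ψ.continuous
  · refine le_generateFrom ?_
    rintro _ ⟨i, O, hO, rfl⟩
    obtain ⟨O', hO', rfl⟩ := ((S i).ι.isometry.isEmbedding.isInducing.isOpen_iff).1 hO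
    refine ⟨(S i).U ∩ (S i).Φ ⁻¹' O',
      (S i).contDiffOn_Φ.continuousOn.isOpen_inter_preimage (S i).isOpen_U hO', ?_⟩
    ext x
    simp only [Set.mem_preimage, Set.mem_inter_iff, ← (S i).mem_source]
    refine and_congr_right fun hx => ?_
    rw [(S i).Φ_apply x hx]

theorem isBanachManifold_of_sliceChart (S : ∀ i, SliceChart e (A i)) (he : Function.Injective e)
    (hc : ∀ x, ∃ i, x ∈ (A i).source) : IsBanachManifold A where
  covers := hc
  injOn i := (S i).injOn he
  isOpen_overlap i j := ((S i).isSmoothAt (S j) he (F := id) (fun _ => rfl) contDiff_id).1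
  contDiffOn_transition i j := ((S i).isSmoothAt (S j) he (F := id) (fun _ => rfl) contDiff_id).2
  t2 := by
    rw [atlasTopology_eq_induced S hc]
    let := TopologicalSpace.induced e inferInstance
    exact T2Space.of_injective_continuous he continuous_induced_dom

theorem isSmoothMap_of_sliceChart (S : ∀ i, SliceChart e (A i)) (T : ∀ j, SliceChart e' (B j))
    (he : Function.Injective e) {f : M → N} {F : E → E'} (hF : ∀ x, e' (f x) = F (e x))
    (hs : ContDiff ℝ ∞ F) : IsSmoothMap A B f :=
  fun i j => (S i).isSmoothAt (T j) he hF hs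

theorem isEmbedding_of_sliceChart {e' : N → E} (S : ∀ i, SliceChart e (A i))
    (T : ∀ j, SliceChart e' (B j)) (he' : Function.Injective e')
    (hc : ∀ x, ∃ i, x ∈ (A i).source) (hc' : ∀ x, ∃ i, x ∈ (B i).source) {f : N → M}
    (hf : ∀ x, e (f x) = e' x) :
    @Topology.IsEmbedding N M (atlasTopology B) (atlasTopology A) f := by
  rw [atlasTopology_eq_induced S hc, atlasTopology_eq_induced T hc']
  let : TopologicalSpace M := TopologicalSpace.induced e inferInstance
  let : TopologicalSpace N := TopologicalSpace.induced e' inferInstance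
  refine ⟨⟨?_⟩, fun x y h => he' (by rw [← hf, ← hf, h])⟩
  rw [induced_compose]
  congr 1
  exact (funext hf).symm

/-- It suffices to find, for each chart upstairs, one chart downstairs in which `f` is linear: any
other choice changes the tangent map by an isomorphism of the target, which affects neither
surjectivity nor the kernel. -/
theorem isSubmersion_of_sliceChart (S : ∀ i, SliceChart e (A i)) (T : ∀ j, SliceChart e' (B j))
    (he : Function.Injective e) (he' : Function.Injective e') {f : M → N} {F : E → E'}
    (hF : ∀ x, e' (f x) = F (e x)) (hs : ContDiff ℝ ∞ F)
    (hL : ∀ i, ∃ (j : κ) (L : (A i).model →L[ℝ] (B j).model), Function.Surjective L ∧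
      (LinearMap.ker (L : (A i).model →ₗ[ℝ] (B j).model)).ClosedComplemented ∧
      (∀ x ∈ (A i).source, f x ∈ (B j).source) ∧
      ∀ x ∈ (A i).source, (B j).toFun (f x) = L ((A i).toFun x)) :
    IsSubmersion A B f := by
  refine ⟨isSmoothMap_of_sliceChart S T he hF hs, fun x i k hx hfx => ?_⟩
  obtain ⟨j, L, h1, h2, h3, h4⟩ := hL i
  obtain ⟨D, hD⟩ := (S i).exists_tangentRep_eq he (T j) (T k) he' L h3 h4 hx hfx
  rw [hD]
  refine ⟨D.surjective.comp h1, ?_⟩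
  have hk : LinearMap.ker (((D : (B j).model →L[ℝ] (B k).model) ∘L L :
      (A i).model →L[ℝ] (B k).model) : (A i).model →ₗ[ℝ] (B k).model) =
      LinearMap.ker (L : (A i).model →ₗ[ℝ] (B j).model) := by
    ext v; simp
  rw [hk]
  exact h2

/-- The linear model is an isometry of a complete space, so its range is closed, and an isomorphism
of the target keeps it closed. -/
theorem isImmersedSubmanifold_of_sliceChart (S : ∀ i, SliceChart e (A i))
    (T : ∀ j, SliceChart e' (B j)) (he : Function.Injective e) (he' : Function.Injective e')
    {f : M → N} (hinj : Function.Injective f) {F : E → E'}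
    (hF : ∀ x, e' (f x) = F (e x)) (hs : ContDiff ℝ ∞ F)
    (hL : ∀ i, ∃ (j : κ) (L : (A i).model →ₗᵢ[ℝ] (B j).model),
      (∀ x ∈ (A i).source, f x ∈ (B j).source) ∧
      ∀ x ∈ (A i).source, (B j).toFun (f x) = L ((A i).toFun x)) :
    IsImmersedSubmanifold A B f := by
  refine ⟨hinj, isSmoothMap_of_sliceChart S T he hF hs, fun x i k hx hfx => ?_⟩
  obtain ⟨j, L, h3, h4⟩ := hL i
  obtain ⟨D, hD⟩ := (S i).exists_tangentRep_eq he (T j) (T k) he' L.toContinuousLinearMap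
    h3 h4 hx hfx
  rw [hD]
  refine ⟨D.injective.comp L.injective, ?_⟩
  have hr : Set.range ((D : (B j).model →L[ℝ] (B k).model) ∘L L.toContinuousLinearMap) =
      D '' Set.range L := by
    rw [← Set.range_comp]; rfl
  rw [hr]
  exact D.toHomeomorph.isClosedMap _ L.isometry.isClosedEmbedding.isClosed_range

/-- Conjugating by the derivative `D` of a transition map carries a projection onto the tangent
range to a projection onto the range of the linear model `L`. The base point is the one with
coordinate `0`. -/
theorem exists_range_eq_of_isSplitImmersedSubmanifold (S : ∀ i, SliceChart e (A i))
    (T : ∀ j, SliceChart e' (B j)) (he : Function.Injective e) (he' : Function.Injective e')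
    {f : M → N} {i : ι} {j : κ} (L : (A i).model →L[ℝ] (B j).model)
    (h3 : ∀ x ∈ (A i).source, f x ∈ (B j).source)
    (h4 : ∀ x ∈ (A i).source, (B j).toFun (f x) = L ((A i).toFun x))
    (h : IsSplitImmersedSubmanifold A B f) :
    (LinearMap.range (L : (A i).model →ₗ[ℝ] (B j).model)).ClosedComplemented := by
  obtain ⟨x, hx, -⟩ := (S i).surj 0
  have h5 := h.2 x i j hx (h3 x hx)
  obtain ⟨D, hD⟩ := (S i).exists_tangentRep_eq he (T j) (T j) he' L h3 h4 hx (h3 x hx)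
  rw [hD] at h5
  obtain ⟨P, hP⟩ := h5
  have hm : ∀ v : (B j).model, D.symm (P (D v) : (B j).model) ∈
      LinearMap.range (L : (A i).model →ₗ[ℝ] (B j).model) := by
    intro v
    obtain ⟨w, hw⟩ := (P (D v)).2
    refine ⟨w, ?_⟩
    rw [← hw]
    simp
  refine ⟨((D.symm : (B j).model →L[ℝ] (B j).model) ∘L (Submodule.subtypeL _) ∘L P ∘L
    (D : (B j).model →L[ℝ] (B j).model)).codRestrict _ hm, ?_⟩
  rintro ⟨_, w, rfl⟩
  apply Subtype.ext
  have := hP ⟨D (L w), ⟨w, rfl⟩⟩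
  change D.symm (P (D (L w)) : (B j).model) = L w
  rw [this]
  simp

end Slice

/-! ### Smoothness of the multiplication -/

namespace SetGroupoid

variable {G M : Type u} {ι : Type u} {E : Type u} [NormedRing E] [NormedAlgebra ℝ E]
  {e : G → E} {A : ι → BanachChart G}

/-- The product of operators is smooth on all pairs, composable or not. The hypothesis `hΦ` ensures
that the extended chart still takes values in the model space at products of pairs that are not
composable, so that the extension `F` exists on an open set. -/
theorem isSmoothMul_of_sliceChart (𝒢 : SetGroupoid G M) (S : ∀ i, SliceChart e (A i))
    (hmul : ∀ g h (c : 𝒢.s g = 𝒢.t h), e (𝒢.mul g h c) = e g * e h)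
    (hΦ : ∀ g h k, e g * e h ∈ (S k).U → (S k).Φ (e g * e h) ∈ Set.range (S k).ι) :
    𝒢.IsSmoothMul A := by
  intro g h c i j k hg hh hk
  have hr : ∀ z : (A i).model × (A j).model, (S i).Ψ z.1 * (S j).Ψ z.2 ∈ (S k).U →
      ∃ y, (S k).ι y = (S k).Φ ((S i).Ψ z.1 * (S j).Ψ z.2) := by
    intro z hz
    obtain ⟨g', hg', e1⟩ := (S i).surj z.1
    obtain ⟨h', hh', e2⟩ := (S j).surj z.2
    rw [← e1, ← e2, (S i).Ψ_toFun _ hg', (S j).Ψ_toFun _ hh'] at hz ⊢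
    exact hΦ g' h' k hz
  have hP : ContDiff ℝ ∞ fun z : (A i).model × (A j).model => (S i).Ψ z.1 * (S j).Ψ z.2 :=
    ((S i).contDiff_Ψ.comp contDiff_fst).mul ((S j).contDiff_Ψ.comp contDiff_snd)
  let O : Set ((A i).model × (A j).model) := {z | (S i).Ψ z.1 * (S j).Ψ z.2 ∈ (S k).U}
  have hO : IsOpen O := (S k).isOpen_U.preimage hP.continuous
  -- Outside `O` the value of `F` is arbitrary; smoothness is only asserted on `O`.
  choose! F hF using hr
  have hmem : ∀ g' h' (c' : 𝒢.s g' = 𝒢.t h'), g' ∈ (A i).source → h' ∈ (A j).source →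
      (S i).Ψ ((A i).toFun g') * (S j).Ψ ((A j).toFun h') = e (𝒢.mul g' h' c') := by
    intro g' h' c' hg' hh'
    rw [(S i).Ψ_toFun _ hg', (S j).Ψ_toFun _ hh', hmul]
  refine ⟨O, F, hO, ?_, ?_, ?_⟩
  · change (S i).Ψ ((A i).toFun g) * (S j).Ψ ((A j).toFun h) ∈ (S k).U
    rw [hmem g h c hg hh]
    exact ((S k).mem_source _).1 hk
  · refine (S k).ι.contDiffOn_of_comp hO ?_
    exact ((S k).contDiffOn_Φ.comp hP.contDiffOn (fun z hz => hz)).congr fun z hz => hF z hz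
  · intro g' h' c' hg' hh' hz
    have hz' : (S i).Ψ ((A i).toFun g') * (S j).Ψ ((A j).toFun h') ∈ (S k).U := hz
    have h1 := hF ((A i).toFun g', (A j).toFun h') hz'
    simp only at h1
    rw [hmem g' h' c' hg' hh'] at hz' h1
    have h2 := ((S k).mem_source _).2 hz'
    refine ⟨h2, (S k).ι.injective ?_⟩
    rw [h1, (S k).Φ_apply _ h2]

end SetGroupoid

/-! ### The inverse square root of `1 + A* A` -/

section SqrtSmooth

variable {H : Type u} [NormedAddCommGroup H] [InnerProductSpace ℂ H] [CompleteSpace H]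

/-- Coefficient norms agree with those of the scalar series; `Nontrivial H` is what gives the
identity operator norm one. -/
theorem binomialSeries_radius_ge_one_clm [Nontrivial H] (a : ℝ) :
    1 ≤ (binomialSeries (H →L[ℂ] H) a).radius := by
  have h : (binomialSeries (H →L[ℂ] H) a).radius = (binomialSeries ℝ a).radius := by
    unfold FormalMultilinearSeries.radius binomialSeries
    simp only [FormalMultilinearSeries.ofScalars_norm]
  rw [h]
  exact binomialSeries_radius_ge_one

/-- For a self-adjoint operator `B` with `‖B - 1‖ < 1`, the binomial series gives the square
root of `B`. -/
theorem sum_binomialSeries_eq_sqrt [Nontrivial H] {B : H →L[ℂ] H} (hB : IsSelfAdjoint B)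
    (h1 : ‖B - 1‖ < 1) :
    (binomialSeries (H →L[ℂ] H) (1 / 2 : ℝ)).sum (B - 1) = CFC.sqrt B := by
  set x := B - 1 with hx
  have hxs : IsSelfAdjoint x := hB.sub (IsSelfAdjoint.one _)
  have hspec : ∀ y ∈ spectrum ℝ x, |y| ≤ ‖x‖ := fun y hy => spectrum.norm_le_norm_of_mem hy
  obtain ⟨r, hr1, hr2⟩ := exists_between h1
  have hr0 : 0 ≤ r := (norm_nonneg _).trans hr1.le
  -- The spectrum of `x` lies in a closed ball of radius less than one, so the scalar partial sums
  -- converge uniformly there and the functional calculus passes to the limit.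
  have hunif : TendstoUniformlyOn
      (fun n (y : ℝ) => (binomialSeries ℝ (1 / 2 : ℝ)).partialSum n y)
      (fun y : ℝ => (1 + y) ^ (1 / 2 : ℝ)) Filter.atTop (spectrum ℝ x) := by
    have := (Real.one_add_rpow_hasFPowerSeriesOnBall_zero (a := 1 / 2)).tendstoUniformlyOn
      (r' := r.toNNReal) (by
        rw [← ENNReal.coe_one, ENNReal.coe_lt_coe]
        exact Real.toNNReal_lt_one.2 hr2)
    simp only [zero_add] at this
    refine this.mono fun y hy => ?_
    rw [Metric.mem_ball, dist_zero_right, Real.coe_toNNReal r hr0]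
    exact (hspec y hy).trans_lt hr1
  have hlim := tendsto_cfc_fun (a := x) hunif (Filter.Eventually.of_forall fun n =>
    (FormalMultilinearSeries.partialSum_continuous _ n).continuousOn)
  have hpart : ∀ n, cfc (fun y : ℝ => (binomialSeries ℝ (1 / 2 : ℝ)).partialSum n y) x =
      (binomialSeries (H →L[ℂ] H) (1 / 2 : ℝ)).partialSum n x := by
    intro n
    simp only [FormalMultilinearSeries.partialSum, binomialSeries_apply, List.ofFn_const,
      List.prod_replicate]
    have := cfc_sum (fun (k : ℕ) (y : ℝ) => Ring.choose (1 / 2 : ℝ) k • y ^ k) x (Finset.range n)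
      (fun k _ => by fun_prop)
    rw [Finset.sum_fn] at this
    rw [this]
    refine Finset.sum_congr rfl fun k _ => ?_
    rw [cfc_smul _ _ _ (by fun_prop), cfc_pow_id x k]
  have hlim2 : Filter.Tendsto
      (fun n => (binomialSeries (H →L[ℂ] H) (1 / 2 : ℝ)).partialSum n x) Filter.atTop
      (nhds ((binomialSeries (H →L[ℂ] H) (1 / 2 : ℝ)).sum x)) := by
    have hr := binomialSeries_radius_ge_one_clm (H := H) (1 / 2)
    have := (FormalMultilinearSeries.hasFPowerSeriesOnBall _
      (zero_lt_one.trans_le hr)).tendsto_partialSum (y := x) (by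
        rw [Metric.mem_eball, edist_zero_right]
        refine lt_of_lt_of_le ?_ hr
        rw [← ofReal_norm]
        exact ENNReal.ofReal_lt_one.2 h1)
    simpa only [zero_add] using this
  simp only [hpart] at hlim
  rw [tendsto_nhds_unique hlim2 hlim]
  symm
  have h1y : ∀ y ∈ spectrum ℝ x, 0 ≤ 1 + y := fun y hy => by
    linarith [neg_le_of_abs_le (hspec y hy)]
  have hc : ContinuousOn (fun y : ℝ => (1 + y) ^ (1 / 2 : ℝ)) (spectrum ℝ x) :=
    Continuous.continuousOn (by fun_prop (disch := norm_num))
  -- The limit is nonnegative with square `1 + x = B`; nonnegative square roots are unique.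
  refine CFC.sqrt_unique ?_ (cfc_nonneg fun y hy => Real.rpow_nonneg (h1y y hy) _)
  rw [← cfc_mul _ _ x hc hc]
  have : cfc (fun y : ℝ => (1 + y) ^ (1 / 2 : ℝ) * (1 + y) ^ (1 / 2 : ℝ)) x =
      cfc (fun y : ℝ => 1 + y) x := by
    refine cfc_congr fun y hy => ?_
    simp only [← Real.sqrt_eq_rpow]
    exact Real.mul_self_sqrt (h1y y hy)
  rw [this, cfc_const_add 1 (fun y => y) x, cfc_id' ℝ x, hx]
  simp

/-- The operator `1 + A* A` is invertible; its inverse is self-adjoint and close to `1`. -/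
theorem isUnit_one_add_star_mul_self (A : H →L[ℂ] H) :
    IsUnit (1 + star A * A) ∧ IsSelfAdjoint (Ring.inverse (1 + star A * A)) ∧
      0 ≤ Ring.inverse (1 + star A * A) ∧ ‖Ring.inverse (1 + star A * A) - 1‖ < 1 := by
  set S := star A * A with hS
  have hS0 : 0 ≤ S := star_mul_self_nonneg A
  have hSs : IsSelfAdjoint S := IsSelfAdjoint.star_mul_self A
  have hsp : ∀ t ∈ spectrum ℝ S, 0 ≤ t := fun t ht => spectrum_nonneg_of_nonneg hS0 ht
  have hc : ContinuousOn (fun t : ℝ => (1 + t)⁻¹) (spectrum ℝ S) :=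
    ContinuousOn.inv₀ (by fun_prop) fun t ht => by linarith [hsp t ht]
  have hadd : cfc (fun t : ℝ => 1 + t) S = 1 + S := by
    rw [cfc_const_add 1 (fun y => y) S, cfc_id' ℝ S]
    simp
  have hm : (1 + S) * cfc (fun t : ℝ => (1 + t)⁻¹) S = 1 := by
    rw [← hadd, ← cfc_mul _ _ S (by fun_prop) hc]
    have : cfc (fun t : ℝ => (1 + t) * (1 + t)⁻¹) S = cfc (fun _ : ℝ => (1 : ℝ)) S :=
      cfc_congr fun t ht => mul_inv_cancel₀ (by linarith [hsp t ht])
    rw [this, cfc_const_one ℝ S]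
  have hm' : cfc (fun t : ℝ => (1 + t)⁻¹) S * (1 + S) = 1 := by
    rw [← hadd, ← cfc_mul _ _ S hc (by fun_prop)]
    have : cfc (fun t : ℝ => (1 + t)⁻¹ * (1 + t)) S = cfc (fun _ : ℝ => (1 : ℝ)) S :=
      cfc_congr fun t ht => inv_mul_cancel₀ (by linarith [hsp t ht])
    rw [this, cfc_const_one ℝ S]
  have hinv : Ring.inverse (1 + S) = cfc (fun t : ℝ => (1 + t)⁻¹) S :=
    Ring.inverse_unit ⟨1 + S, _, hm, hm'⟩
  rw [hinv]
  refine ⟨⟨⟨1 + S, _, hm, hm'⟩, rfl⟩, cfc_predicate _ _,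
    cfc_nonneg fun t ht => inv_nonneg.2 (by linarith [hsp t ht]), ?_⟩
  have : cfc (fun t : ℝ => (1 + t)⁻¹) S - 1 = cfc (fun t : ℝ => (1 + t)⁻¹ - 1) S := by
    rw [cfc_sub _ _ S hc (by fun_prop), cfc_const_one ℝ S]
  rw [this]
  -- The spectrum of `S` is nonnegative, where `(1 + t)⁻¹ - 1` lies in `(-1, 0]`.
  refine norm_cfc_lt one_pos fun t ht => ?_
  have h0 := hsp t ht
  rw [Real.norm_eq_abs, abs_lt]
  have h1 : 0 < (1 + t)⁻¹ := inv_pos.2 (by linarith)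
  have h2 : (1 + t)⁻¹ ≤ 1 := inv_le_one_of_one_le₀ (by linarith)
  constructor <;> linarith

theorem contDiff_star_clm : ContDiff ℝ ∞ (star : (H →L[ℂ] H) → H →L[ℂ] H) := by
  let L : (H →L[ℂ] H) →L[ℝ] (H →L[ℂ] H) :=
    { toFun := star
      map_add' := star_add
      map_smul' := fun c A => by simp [star_smul]
      cont := continuous_star }
  exact L.contDiff

/-- The operator `(1 + A* A)^{-1/2}` depends smoothly on `A`. -/
theorem contDiff_sqrt_inverse_one_add_star_mul_self :
    ContDiff ℝ ∞ fun A : H →L[ℂ] H => CFC.sqrt (Ring.inverse (1 + star A * A)) := by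
  rcases subsingleton_or_nontrivial H with hH | hH
  · have : Subsingleton (H →L[ℂ] H) := ⟨fun A B => ContinuousLinearMap.ext fun x =>
      Subsingleton.elim _ _⟩
    exact contDiff_of_subsingleton
  have h1 : ContDiff ℝ ∞ fun A : H →L[ℂ] H => Ring.inverse (1 + star A * A) - 1 := by
    refine ContDiff.sub (contDiff_iff_contDiffAt.2 fun A => ?_) contDiff_const
    obtain ⟨v, hv⟩ := (isUnit_one_add_star_mul_self A).1
    have hi := contDiffAt_ringInverse ℝ (n := ∞) v
    rw [hv] at hi
    exact hi.comp A (contDiff_const.add (contDiff_star_clm.mul contDiff_id)).contDiffAt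
  have hr := binomialSeries_radius_ge_one_clm (H := H) (1 / 2)
  have h2 : ContDiffOn ℝ ∞ (binomialSeries (H →L[ℂ] H) (1 / 2 : ℝ)).sum (Metric.ball 0 1) := by
    have h := (FormalMultilinearSeries.hasFPowerSeriesOnBall _
      (zero_lt_one.trans_le hr)).analyticOnNhd
    refine (h.mono fun y hy => ?_).contDiffOn (Metric.isOpen_ball.uniqueDiffOn)
    rw [Metric.mem_eball, edist_zero_right]
    refine lt_of_lt_of_le ?_ hr
    rw [← ofReal_norm]
    exact ENNReal.ofReal_lt_one.2 (by simpa using hy)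
  -- The unit ball contains `(1 + A* A)⁻¹ - 1` for every `A`, so the result is global.
  have h3 := h2.comp_contDiff h1 (fun A => by
    simpa using (isUnit_one_add_star_mul_self A).2.2.2)
  convert h3 using 1
  funext A
  obtain ⟨-, k1, -, k2⟩ := isUnit_one_add_star_mul_self A
  exact (sum_binomialSeries_eq_sqrt k1 k2).symm

end SqrtSmooth

/-! ### Graphs, projections and oblique projections -/

section ProjectionAlgebra

variable {H : Type u} [NormedAddCommGroup H] [InnerProductSpace ℂ H] [CompleteSpace H]

/-- The formula for the graph coordinate, for an arbitrary operator in place of the projection. -/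
def graphCoordOp (p : Proj H) (q : H →L[ℂ] H) : H →L[ℂ] H :=
  (1 - p.1) * q * p.1 * Ring.inverse (p.1 * q * p.1 + (1 - p.1)) * p.1

/-- The partial isometry `(1_W + A) (1 + A* A)^{-1/2}` from `W = range p` onto the graph of `A`. -/
def graphSection (p : Proj H) (A : H →L[ℂ] H) : H →L[ℂ] H :=
  (p.1 + A) * CFC.sqrt (Ring.inverse (1 + star A * A)) * p.1

theorem offDiag_left {p : Proj H} {A : H →L[ℂ] H} (hA : A ∈ offDiag p) : p.1 * A = 0 := by
  have hA : (1 - p.1) * A * p.1 = A := hA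
  rw [← hA, ← mul_assoc, ← mul_assoc, p.2.mul_one_sub_self, zero_mul, zero_mul]

theorem offDiag_right {p : Proj H} {A : H →L[ℂ] H} (hA : A ∈ offDiag p) : A * p.1 = A := by
  have hA : (1 - p.1) * A * p.1 = A := hA
  rw [← hA, mul_assoc, p.mul_self]

theorem mem_offDiag_of {p : Proj H} {A : H →L[ℂ] H} (h1 : p.1 * A = 0) (h2 : A * p.1 = A) :
    A ∈ offDiag p := by
  change (1 - p.1) * A * p.1 = A
  rw [mul_assoc, h2, sub_mul, h1, one_mul, sub_zero]

theorem offDiag_star_left {p : Proj H} {A : H →L[ℂ] H} (hA : A ∈ offDiag p) :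
    p.1 * star A = star A := by
  have := congrArg star (offDiag_right hA)
  rwa [star_mul, p.star_eq] at this

theorem offDiag_star_right {p : Proj H} {A : H →L[ℂ] H} (hA : A ∈ offDiag p) :
    star A * p.1 = 0 := by
  have := congrArg star (offDiag_left hA)
  rwa [star_mul, p.star_eq, star_zero] at this

theorem commute_inverse {a b : H →L[ℂ] H} (ha : IsUnit a) (h : Commute a b) :
    Commute (Ring.inverse a) b := by
  obtain ⟨v, rfl⟩ := ha
  rw [Ring.inverse_unit]
  exact h.units_inv_left

theorem ringInverse_ringInverse {a : H →L[ℂ] H} (ha : IsUnit a) :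
    Ring.inverse (Ring.inverse a) = a := by
  obtain ⟨v, rfl⟩ := ha
  rw [Ring.inverse_unit, Ring.inverse_unit, inv_inv]

section Graph

variable {p : Proj H} {A : H →L[ℂ] H}

theorem commute_one_add_star_mul_self (hA : A ∈ offDiag p) : Commute (1 + star A * A) p.1 := by
  refine (Commute.one_left _).add_left ?_
  change star A * A * p.1 = p.1 * (star A * A)
  rw [mul_assoc, offDiag_right hA, ← mul_assoc, offDiag_star_left hA]

theorem commute_inverse_one_add (hA : A ∈ offDiag p) :
    Commute (Ring.inverse (1 + star A * A)) p.1 :=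
  commute_inverse (isUnit_one_add_star_mul_self A).1 (commute_one_add_star_mul_self hA)

theorem star_add_mul_add (hA : A ∈ offDiag p) :
    (p.1 + star A) * (p.1 + A) = (1 + star A * A) * p.1 := by
  rw [mul_add, add_mul, add_mul, offDiag_left hA, offDiag_star_right hA, p.mul_self, add_mul,
    one_mul, mul_assoc, offDiag_right hA]
  abel

theorem commute_sqrt {N b : H →L[ℂ] H} (h : Commute N b) : Commute (CFC.sqrt N) b :=
  Commute.cfcₙ_nnreal h _

theorem isSelfAdjoint_sqrt (N : H →L[ℂ] H) : star (CFC.sqrt N) = CFC.sqrt N :=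
  (CFC.sqrt_nonneg N).isSelfAdjoint.star_eq

theorem star_graphSection (p : Proj H) (A : H →L[ℂ] H) : star (graphSection p A) =
    p.1 * CFC.sqrt (Ring.inverse (1 + star A * A)) * (p.1 + star A) := by
  unfold graphSection
  rw [star_mul, star_mul, star_add, p.star_eq, isSelfAdjoint_sqrt, mul_assoc]

theorem graphSection_mul_proj (p : Proj H) (A : H →L[ℂ] H) :
    graphSection p A * p.1 = graphSection p A := by
  unfold graphSection
  rw [mul_assoc, p.mul_self]

/-- By `star_add_mul_add` the Gram operator of `p + A` is `(1 + A* A) p`. Both square root factors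
commute with it and with `p`, and cancel it. -/
theorem star_graphSection_mul_self (hA : A ∈ offDiag p) :
    star (graphSection p A) * graphSection p A = p.1 := by
  obtain ⟨hu, -, hN0, -⟩ := isUnit_one_add_star_mul_self A
  have hM := commute_one_add_star_mul_self hA
  have hN := commute_inverse_one_add hA
  have hNM : Ring.inverse (1 + star A * A) * (1 + star A * A) = 1 := Ring.inverse_mul_cancel _ hu
  have hNMc := commute_inverse hu (Commute.refl (1 + star A * A))
  have hs := CFC.sqrt_mul_sqrt_self (Ring.inverse (1 + star A * A)) hN0
  have hsp := commute_sqrt hN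
  have hsM := commute_sqrt hNMc
  rw [star_graphSection]
  unfold graphSection
  have e := star_add_mul_add hA
  generalize CFC.sqrt (Ring.inverse (1 + star A * A)) = s at *
  generalize Ring.inverse (1 + star A * A) = N at *
  generalize 1 + star A * A = M at *
  calc p.1 * s * (p.1 + star A) * ((p.1 + A) * s * p.1)
      = p.1 * s * ((p.1 + star A) * (p.1 + A)) * s * p.1 := by simp only [mul_assoc]
    _ = p.1 * (s * M) * (p.1 * s) * p.1 := by rw [e]; simp only [mul_assoc]
    _ = p.1 * (M * s) * (s * p.1) * p.1 := by rw [hsM.eq, hsp.eq]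
    _ = p.1 * (M * (s * s)) * (p.1 * p.1) := by simp only [mul_assoc]
    _ = p.1 := by rw [hs, ← hNMc.eq, hNM, p.mul_self, mul_one, p.mul_self]

theorem graphSection_mul_star (hA : A ∈ offDiag p) :
    graphSection p A * star (graphSection p A) =
      (p.1 + A) * Ring.inverse (1 + star A * A) * (p.1 + star A) := by
  obtain ⟨hu, -, hN0, -⟩ := isUnit_one_add_star_mul_self A
  have hN := commute_inverse_one_add hA
  have hs := CFC.sqrt_mul_sqrt_self (Ring.inverse (1 + star A * A)) hN0
  have hsp := commute_sqrt hN
  rw [star_graphSection]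
  unfold graphSection
  have e : (p.1 + A) * p.1 = p.1 + A := by rw [add_mul, p.mul_self, offDiag_right hA]
  generalize CFC.sqrt (Ring.inverse (1 + star A * A)) = s at *
  generalize Ring.inverse (1 + star A * A) = N at *
  calc (p.1 + A) * s * p.1 * (p.1 * s * (p.1 + star A))
      = (p.1 + A) * (s * (p.1 * p.1)) * (s * (p.1 + star A)) := by simp only [mul_assoc]
    _ = ((p.1 + A) * p.1) * (s * s) * (p.1 + star A) := by
        rw [p.mul_self, hsp.eq]; simp only [mul_assoc]
    _ = _ := by rw [hs, e]

theorem isStarProjection_graphSection (hA : A ∈ offDiag p) :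
    IsStarProjection (graphSection p A * star (graphSection p A)) where
  isIdempotentElem := by
    change graphSection p A * star (graphSection p A) *
      (graphSection p A * star (graphSection p A)) = _
    calc _ = graphSection p A * (star (graphSection p A) * graphSection p A) *
          star (graphSection p A) := by simp only [mul_assoc]
      _ = _ := by rw [star_graphSection_mul_self hA, graphSection_mul_proj]
  isSelfAdjoint := by simp [IsSelfAdjoint]

/-- The orthogonal projection onto the graph of `A`. -/
def graphProj (p : Proj H) (A : H →L[ℂ] H) (hA : A ∈ offDiag p) : Proj H :=
  ⟨graphSection p A * star (graphSection p A), isStarProjection_graphSection hA⟩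

theorem proj_mul_graphProj_mul_proj (hA : A ∈ offDiag p) :
    p.1 * (graphProj p A hA).1 * p.1 = Ring.inverse (1 + star A * A) * p.1 := by
  have h1 : p.1 * (p.1 + A) = p.1 := by rw [mul_add, p.mul_self, offDiag_left hA, add_zero]
  have h2 : (p.1 + star A) * p.1 = p.1 := by
    rw [add_mul, p.mul_self, offDiag_star_right hA, add_zero]
  change p.1 * (graphSection p A * star (graphSection p A)) * p.1 = _
  rw [graphSection_mul_star hA]
  calc _ = (p.1 * (p.1 + A)) * Ring.inverse (1 + star A * A) * ((p.1 + star A) * p.1) := by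
        simp only [mul_assoc]
    _ = _ := by
        rw [h1, h2, ← (commute_inverse_one_add hA).eq, mul_assoc, p.mul_self]

/-- Since `A` vanishes on `Wᗮ`, the operator `1 + A* A` is block diagonal and equals `1` there. This
is why the graph coordinate may use an inverse in the full algebra instead of one on `W`. -/
theorem compression_graphProj (hA : A ∈ offDiag p) :
    p.1 * (graphProj p A hA).1 * p.1 + (1 - p.1) = Ring.inverse (1 + star A * A) := by
  have hu := (isUnit_one_add_star_mul_self A).1
  have h1 : (1 + star A * A) * (1 - p.1) = 1 - p.1 := by
    rw [add_mul, one_mul, mul_assoc, mul_sub, mul_one, offDiag_right hA, sub_self, mul_zero,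
      add_zero]
  have h2 : Ring.inverse (1 + star A * A) * (1 - p.1) = 1 - p.1 := by
    conv_lhs => rw [← h1]
    rw [← mul_assoc, Ring.inverse_mul_cancel _ hu, one_mul]
  calc _ = Ring.inverse (1 + star A * A) * p.1 +
          Ring.inverse (1 + star A * A) * (1 - p.1) := by rw [proj_mul_graphProj_mul_proj hA, h2]
    _ = _ := by rw [← mul_add, add_sub_cancel, mul_one]

/-- The off-diagonal block of the graph projection is `A (1 + A* A)⁻¹ p`, and the inverse of the
compression cancels the middle factor. -/
theorem graphCoordOp_graphProj (hA : A ∈ offDiag p) :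
    graphCoordOp p (graphProj p A hA).1 = A := by
  have hu := (isUnit_one_add_star_mul_self A).1
  have hq : (1 - p.1) * (graphProj p A hA).1 * p.1 = A * Ring.inverse (1 + star A * A) * p.1 := by
    change (1 - p.1) * (graphSection p A * star (graphSection p A)) * p.1 = _
    rw [graphSection_mul_star hA]
    have h1 : (1 - p.1) * (p.1 + A) = A := by
      rw [mul_add, p.2.one_sub_mul_self, zero_add, sub_mul, one_mul, offDiag_left hA, sub_zero]
    have h2 : (p.1 + star A) * p.1 = p.1 := by
      rw [add_mul, p.mul_self, offDiag_star_right hA, add_zero]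
    calc _ = ((1 - p.1) * (p.1 + A)) * Ring.inverse (1 + star A * A) * ((p.1 + star A) * p.1) := by
          simp only [mul_assoc]
      _ = _ := by rw [h1, h2]
  unfold graphCoordOp
  rw [compression_graphProj hA, ringInverse_ringInverse hu, hq]
  calc _ = A * Ring.inverse (1 + star A * A) * (p.1 * (1 + star A * A)) * p.1 := by
        simp only [mul_assoc]
    _ = A * (Ring.inverse (1 + star A * A) * (1 + star A * A)) * (p.1 * p.1) := by
        rw [← (commute_one_add_star_mul_self hA).eq]; simp only [mul_assoc]
    _ = A := by rw [Ring.inverse_mul_cancel _ hu, mul_one, p.mul_self, offDiag_right hA]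

end Graph

/-- `Q` is the oblique projection onto the range of `q` along the orthogonal complement of the range
of `p`. -/
structure IsOblique (p q : Proj H) (Q : H →L[ℂ] H) : Prop where
  mul_left : q.1 * Q = Q
  mul_right : Q * q.1 = q.1
  proj_mul : p.1 * Q = p.1
  mul_proj : Q * p.1 = Q

theorem isOblique_graphProj {p : Proj H} {A : H →L[ℂ] H} (hA : A ∈ offDiag p) :
    IsOblique p (graphProj p A hA) (p.1 + A) := by
  have hu := (isUnit_one_add_star_mul_self A).1
  have e1 : (p.1 + A) * p.1 = p.1 + A := by rw [add_mul, p.mul_self, offDiag_right hA]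
  have e2 : p.1 * (p.1 + A) = p.1 := by rw [mul_add, p.mul_self, offDiag_left hA, add_zero]
  have e3 : (p.1 + A) * (p.1 + A) = p.1 + A := by
    calc _ = (p.1 + A) * p.1 * (p.1 + A) := by rw [e1]
      _ = _ := by rw [mul_assoc, e2, e1]
  refine ⟨?_, ?_, e2, e1⟩
  · change graphSection p A * star (graphSection p A) * (p.1 + A) = _
    rw [graphSection_mul_star hA, mul_assoc, star_add_mul_add hA, mul_assoc, ← mul_assoc _ _ p.1,
      Ring.inverse_mul_cancel _ hu, one_mul, e1]
  · change (p.1 + A) * (graphSection p A * star (graphSection p A)) = 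
      graphSection p A * star (graphSection p A)
    rw [graphSection_mul_star hA, ← mul_assoc, ← mul_assoc, e3]

/-- The operator `p q + (1 - p) (1 - q)`, which intertwines `q` and `p`. -/
def intertwiner (p : Proj H) (q : H →L[ℂ] H) : H →L[ℂ] H := p.1 * q + (1 - p.1) * (1 - q)

namespace IsOblique

variable {p q : Proj H} {Q : H →L[ℂ] H}

theorem sub_mem_offDiag (h : IsOblique p q Q) : Q - p.1 ∈ offDiag p :=
  mem_offDiag_of (by rw [mul_sub, h.proj_mul, p.mul_self, sub_self])
    (by rw [sub_mul, h.mul_proj, p.mul_self])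

/-- `q` and the graph projection of `Q - p` share the oblique projection `Q`, so each fixes the
range of the other; self-adjointness then forces equality. -/
theorem eq_graphProj (h : IsOblique p q Q) : q = graphProj p (Q - p.1) h.sub_mem_offDiag := by
  have h' := isOblique_graphProj h.sub_mem_offDiag
  rw [add_sub_cancel] at h'
  generalize graphProj p (Q - p.1) h.sub_mem_offDiag = q' at *
  have e1 : q'.1 * q.1 = q.1 := by rw [← h.mul_right, ← mul_assoc, h'.mul_left]
  have e2 : q.1 * q'.1 = q'.1 := by rw [← h'.mul_right, ← mul_assoc, h.mul_left]
  have e3 := congrArg star e2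
  rw [star_mul, q.star_eq, q'.star_eq, e1] at e3
  exact Subtype.ext e3

theorem isUnit_intertwiner (h : IsOblique p q Q) : IsUnit (intertwiner p q.1) := by
  have s1 : star Q * q.1 = star Q := by
    have := congrArg star h.mul_left; rwa [star_mul, q.star_eq] at this
  have s2 : q.1 * star Q = q.1 := by
    have := congrArg star h.mul_right; rwa [star_mul, q.star_eq] at this
  have s3 : star Q * p.1 = p.1 := by
    have := congrArg star h.proj_mul; rwa [star_mul, p.star_eq] at this
  have s4 : p.1 * star Q = star Q := by
    have := congrArg star h.mul_proj; rwa [star_mul, p.star_eq] at this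
  have hp := p.mul_self
  have hq := q.mul_self
  -- The inverse is `Q` on `W` and, on `Wᗮ`, the oblique projection `1 - Q*` onto the orthogonal
  -- complement of the range of `q` along `W`.
  refine ⟨⟨intertwiner p q.1, Q + (1 - star Q) * (1 - p.1), ?_, ?_⟩, rfl⟩
  · unfold intertwiner
    have a1 : (1 - q.1) * Q = 0 := by rw [sub_mul, h.mul_left, one_mul, sub_self]
    have a2 : q.1 * (1 - star Q) = 0 := by rw [mul_sub, s2, mul_one, sub_self]
    have a3 : (1 - q.1) * (1 - star Q) = 1 - star Q := by rw [sub_mul, a2, one_mul, sub_zero]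
    have a4 : (1 - p.1) * (1 - star Q) = 1 - p.1 := by
      rw [sub_mul, mul_sub p.1, s4, one_mul, mul_one]; abel
    calc _ = p.1 * (q.1 * Q) + p.1 * (q.1 * (1 - star Q)) * (1 - p.1) +
          (1 - p.1) * ((1 - q.1) * Q) + (1 - p.1) * ((1 - q.1) * (1 - star Q)) * (1 - p.1) := by
          noncomm_ring
      _ = 1 := by
          rw [a1, a2, a3, a4, h.mul_left, h.proj_mul, p.2.one_sub.isIdempotentElem.eq]
          simp
  · unfold intertwiner
    have a1 : (1 - p.1) * p.1 = 0 := p.2.one_sub_mul_self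
    have a2 : Q * (1 - p.1) = 0 := by rw [mul_sub, h.mul_proj, mul_one, sub_self]
    have a3 : (1 - star Q) * (1 - p.1) = 1 - star Q := by
      rw [mul_sub, sub_mul _ _ p.1, s3, one_mul, mul_one]; abel
    have a4 : (1 - star Q) * (1 - q.1) = 1 - q.1 := by
      rw [mul_sub, sub_mul _ _ q.1, s1, one_mul, mul_one]; abel
    calc _ = Q * p.1 * q.1 + (Q * (1 - p.1)) * (1 - q.1) +
          (1 - star Q) * ((1 - p.1) * p.1) * q.1 +
          (1 - star Q) * ((1 - p.1) * (1 - p.1)) * (1 - q.1) := by noncomm_ring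
      _ = 1 := by
          rw [a1, a2, p.2.one_sub.isIdempotentElem.eq, a3, a4, h.mul_proj, h.mul_right]
          simp

end IsOblique

/-- The intertwiner `v` satisfies `p v = v q`, so `q v⁻¹ = v⁻¹ p`; this common operator is the
oblique projection. -/
theorem exists_isOblique_of_isUnit {p q : Proj H} (h : IsUnit (intertwiner p q.1)) :
    ∃ Q, IsOblique p q Q := by
  obtain ⟨v, hv⟩ := h
  have hp := p.mul_self
  have hq := q.mul_self
  have e1 : p.1 * (v : H →L[ℂ] H) = p.1 * q.1 := by
    rw [hv]; unfold intertwiner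
    rw [mul_add, ← mul_assoc, hp, ← mul_assoc, p.2.mul_one_sub_self, zero_mul, add_zero]
  have e2 : (v : H →L[ℂ] H) * q.1 = p.1 * q.1 := by
    rw [hv]; unfold intertwiner
    rw [add_mul, mul_assoc, hq, mul_assoc, q.2.one_sub_mul_self, mul_zero, add_zero]
  have e3 : q.1 * (↑v⁻¹ : H →L[ℂ] H) = (↑v⁻¹ : H →L[ℂ] H) * p.1 := by
    rw [Units.mul_inv_eq_iff_eq_mul, mul_assoc, e1, ← e2, Units.inv_mul_cancel_left]
  refine ⟨q.1 * (↑v⁻¹ : H →L[ℂ] H), ?_, ?_, ?_, ?_⟩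
  · rw [← mul_assoc, hq]
  · rw [e3, mul_assoc, ← e2, Units.inv_mul_cancel_left]
  · rw [← mul_assoc, ← e1, Units.mul_inv_cancel_right]
  · rw [e3, mul_assoc, hp]

theorem mem_range_orthogonal_iff (p : Proj H) (x : H) :
    x ∈ (LinearMap.range (p.1 : H →ₗ[ℂ] H))ᗮ ↔ p.1 x = 0 := by
  have h : ∀ y, inner ℂ (p.1 y) x = inner ℂ y (p.1 x) := by
    intro y
    have : star p.1 = p.1 := p.star_eq
    rw [← ContinuousLinearMap.adjoint_inner_right, ← ContinuousLinearMap.star_eq_adjoint, this]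
  rw [Submodule.mem_orthogonal]
  constructor
  · intro hx
    have h1 := hx (p.1 (p.1 x)) ⟨p.1 x, rfl⟩
    exact inner_self_eq_zero.1 ((h (p.1 x)).symm.trans h1)
  · rintro hx _ ⟨y, rfl⟩
    exact (h y).trans (by rw [hx, inner_zero_right])

theorem mem_range_iff (p : Proj H) (x : H) :
    x ∈ LinearMap.range (p.1 : H →ₗ[ℂ] H) ↔ p.1 x = x :=
  ⟨by rintro ⟨y, rfl⟩; exact DFunLike.congr_fun p.mul_self y, fun h => ⟨x, h⟩⟩

theorem isClosed_range_proj (p : Proj H) :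
    IsClosed (LinearMap.range (p.1 : H →ₗ[ℂ] H) : Set H) := by
  have : (LinearMap.range (p.1 : H →ₗ[ℂ] H) : Set H) = {x | p.1 x = x} :=
    Set.ext fun x => mem_range_iff p x
  rw [this]
  exact isClosed_eq p.1.continuous continuous_id

/-- Two closed algebraic complements in a Banach space are topological complements, so the
projection along one of them is bounded. -/
theorem mem_graphDomain_iff_exists_isOblique {p q : Proj H} :
    q ∈ graphDomain p ↔ ∃ Q, IsOblique p q Q := by
  constructor
  · intro h
    have h : IsCompl (LinearMap.range (q.1 : H →ₗ[ℂ] H)) (LinearMap.range (p.1 : H →ₗ[ℂ] H))ᗮ := h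
    have hT := Submodule.IsCompl.isTopCompl_of_isClosed h (isClosed_range_proj q)
      (Submodule.isClosed_orthogonal _)
    refine ⟨Submodule.projectionL _ _ hT, ContinuousLinearMap.ext fun x => ?_,
      ContinuousLinearMap.ext fun x => ?_, ContinuousLinearMap.ext fun x => ?_,
      ContinuousLinearMap.ext fun x => ?_⟩
    · exact (mem_range_iff q _).1 (Submodule.projectionL_apply_mem hT x)
    · exact Submodule.projectionL_apply_left hT ⟨q.1 x, ⟨x, rfl⟩⟩
    · have h1 := Submodule.projectionL_apply_mem hT.symm x
      rw [Submodule.projectionL_eq_self_sub_projectionL hT, mem_range_orthogonal_iff,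
        map_sub, sub_eq_zero] at h1
      exact h1.symm
    · change Submodule.projectionL _ _ hT (p.1 x) = Submodule.projectionL _ _ hT x
      rw [← sub_eq_zero, ← map_sub, Submodule.projectionL_apply_eq_zero_iff,
        mem_range_orthogonal_iff, map_sub, sub_eq_zero]
      exact DFunLike.congr_fun p.mul_self x
  · rintro ⟨Q, h⟩
    change IsCompl _ _
    refine IsCompl.of_le ?_ ?_
    · rintro x ⟨hx, hx'⟩
      have hx : x ∈ LinearMap.range (q.1 : H →ₗ[ℂ] H) := hx
      have hx' : x ∈ (LinearMap.range (p.1 : H →ₗ[ℂ] H))ᗮ := hx'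
      rw [mem_range_iff] at hx
      rw [mem_range_orthogonal_iff] at hx'
      rw [Submodule.mem_bot]
      calc x = (Q * q.1) x := by rw [h.mul_right, hx]
        _ = (Q * p.1) x := by
          rw [h.mul_proj]; exact congrArg Q hx
        _ = 0 := by change Q (p.1 x) = 0; rw [hx', map_zero]
    · intro x _
      rw [Submodule.mem_sup]
      refine ⟨Q x, (mem_range_iff q _).2 (DFunLike.congr_fun h.mul_left x), x - Q x,
        (mem_range_orthogonal_iff p _).2 ?_, by abel⟩
      rw [map_sub, sub_eq_zero]
      exact (DFunLike.congr_fun h.proj_mul x).symm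

theorem mem_graphDomain_iff_isUnit {p q : Proj H} :
    q ∈ graphDomain p ↔ IsUnit (intertwiner p q.1) := by
  rw [mem_graphDomain_iff_exists_isOblique]
  exact ⟨fun ⟨_, h⟩ => h.isUnit_intertwiner, exists_isOblique_of_isUnit⟩

theorem graphProj_mem_graphDomain {p : Proj H} {A : H →L[ℂ] H} (hA : A ∈ offDiag p) :
    graphProj p A hA ∈ graphDomain p :=
  mem_graphDomain_iff_exists_isOblique.2 ⟨_, isOblique_graphProj hA⟩

/-- The oblique projection writes `q` as a graph projection with coordinate `Q - p`, and the
coordinate formula recovers `Q - p`. -/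
theorem eq_graphProj_of_mem_graphDomain {p q : Proj H} (h : q ∈ graphDomain p) :
    q = graphProj p (graphCoord p q) (graphCoord_mem p q) := by
  obtain ⟨Q, hQ⟩ := mem_graphDomain_iff_exists_isOblique.1 h
  have h1 := hQ.eq_graphProj
  have h2 : graphCoord p q = Q - p.1 := by
    rw [h1]; exact graphCoordOp_graphProj hQ.sub_mem_offDiag
  simp only [h2]
  exact h1

end ProjectionAlgebra

/-! ### The Cayley transform on a corner -/

section Cayley

variable {H : Type u} [NormedAddCommGroup H] [InnerProductSpace ℂ H] [CompleteSpace H]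

theorem two_mul_clm_cancel {a b : H →L[ℂ] H} (h : 2 * a = 2 * b) : a = b := by
  have h2 : (2 : ℂ) • a = (2 : ℂ) • b := by simpa only [two_smul, two_mul] using h
  exact smul_right_injective _ (two_ne_zero' ℂ) h2

theorem isUnit_of_mul_eq_two {a b : H →L[ℂ] H} (h : a * b = 2) (h' : b * a = 2) : IsUnit a := by
  have e : (2 : ℂ)⁻¹ • (2 : H →L[ℂ] H) = 1 := by
    rw [← one_add_one_eq_two (R := H →L[ℂ] H), ← two_smul ℂ (1 : H →L[ℂ] H), smul_smul]
    simp
  exact ⟨⟨a, (2 : ℂ)⁻¹ • b, by rw [mul_smul_comm, h, e], by rw [smul_mul_assoc, h', e]⟩, rfl⟩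

theorem mul_mul_of_mul_eq {a b c : H →L[ℂ] H} (h : a * b = c) (x : H →L[ℂ] H) :
    a * (b * x) = c * x := by
  rw [← mul_assoc, h]

section Skew

variable {p : Proj H} {X : H →L[ℂ] H}

theorem skewCorner_left (hX : X ∈ skewCorner p) : p.1 * X = X := by
  rw [← hX.2, ← mul_assoc, ← mul_assoc, p.mul_self]

theorem skewCorner_right (hX : X ∈ skewCorner p) : X * p.1 = X := by
  rw [← hX.2, mul_assoc, p.mul_self]

/-- For skew-adjoint `X` the invertible operator `1 + X* X` is the product of the commuting factors
`1 - X` and `1 + X`. -/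
theorem isUnit_one_sub_of_skewCorner (hX : X ∈ skewCorner p) :
    IsUnit (1 - X) ∧ IsUnit (1 + X) := by
  have h := (isUnit_one_add_star_mul_self X).1
  have e : 1 + star X * X = (1 - X) * (1 + X) := by rw [hX.1]; noncomm_ring
  rw [e] at h
  have hc : Commute (1 - X) (1 + X) := by
    change (1 - X) * (1 + X) = (1 + X) * (1 - X)
    noncomm_ring
  exact hc.isUnit_mul_iff.1 h

/-- The inverse `X ↦ (1 + X) (1 - X)⁻¹` of the Cayley coordinate. -/
def cayleyInv (p : Proj H) (X : H →L[ℂ] H) : H →L[ℂ] H :=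
  (1 + X) * Ring.inverse (1 - X) * p.1

theorem star_ringInverse {a : H →L[ℂ] H} (ha : IsUnit a) :
    star (Ring.inverse a) = Ring.inverse (star a) := by
  obtain ⟨v, rfl⟩ := ha
  rw [Ring.inverse_unit, ← Units.coe_star v, Ring.inverse_unit, Units.coe_star_inv]

/-- With `R = (1 - X)⁻¹` and `S = (1 + X)⁻¹ = R*`, the Cayley transform is `2R - 1` on `W` and its
adjoint is `2S - 1`. The relation between `R S` and `R + S` makes these mutually inverse. -/
theorem cayleyInv_facts (hX : X ∈ skewCorner p) :
    p.1 * cayleyInv p X = cayleyInv p X ∧ cayleyInv p X * p.1 = cayleyInv p X ∧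
    star (cayleyInv p X) * cayleyInv p X = p.1 ∧ cayleyInv p X * star (cayleyInv p X) = p.1 ∧
    IsUnit (1 + cayleyInv p X) ∧ cayleyCoord p (cayleyInv p X) = X := by
  obtain ⟨u1, u2⟩ := isUnit_one_sub_of_skewCorner hX
  have hl := skewCorner_left hX
  have hr := skewCorner_right hX
  have hpp := p.mul_self
  have cXp : Commute X p.1 := by rw [Commute, SemiconjBy, hl, hr]
  have cRX : Commute (Ring.inverse (1 - X)) X :=
    commute_inverse u1 ((Commute.one_left X).sub_left (Commute.refl X))
  have cRp : Commute (Ring.inverse (1 - X)) p.1 :=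
    commute_inverse u1 ((Commute.one_left p.1).sub_left cXp)
  have cSX : Commute (Ring.inverse (1 + X)) X :=
    commute_inverse u2 ((Commute.one_left X).add_left (Commute.refl X))
  have cSp : Commute (Ring.inverse (1 + X)) p.1 :=
    commute_inverse u2 ((Commute.one_left p.1).add_left cXp)
  have sR : star (Ring.inverse (1 - X)) = Ring.inverse (1 + X) := by
    rw [star_ringInverse u1, star_sub, star_one, hX.1, sub_neg_eq_add]
  have hR := Ring.inverse_mul_cancel _ u1
  have hS := Ring.inverse_mul_cancel _ u2
  have eg : star (cayleyInv p X) = p.1 * (Ring.inverse (1 + X) * (1 - X)) := by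
    unfold cayleyInv
    rw [star_mul, star_mul, sR, p.star_eq, star_add, star_one, hX.1, ← sub_eq_add_neg]
  have cRS : Commute (Ring.inverse (1 - X)) (Ring.inverse (1 + X)) :=
    (commute_inverse u2 ((Commute.one_left _).add_left cRX.symm)).symm
  have ug : cayleyInv p X = (1 + X) * Ring.inverse (1 - X) * p.1 := rfl
  rw [cayleyCoord, eg]
  rw [ug] at eg ⊢
  generalize Ring.inverse (1 - X) = R at *
  generalize Ring.inverse (1 + X) = S at *
  have hR' : R * X = R - 1 := by
    rw [mul_sub, mul_one] at hR; rw [← hR]; abel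
  have hS' : S * X = 1 - S := by
    rw [mul_add, mul_one] at hS; rw [← hS]; abel
  have hXR : X * R = R - 1 := by rw [← cRX.eq, hR']
  have hXS : X * S = 1 - S := by rw [← cSX.eq, hS']
  have e1 : (1 + X) * R * p.1 = (2 * R - 1) * p.1 := by
    rw [add_mul, hXR, one_mul, two_mul]; congr 1; abel
  have e2 : p.1 * (S * (1 - X)) = p.1 * (2 * S - 1) := by
    rw [mul_sub, hS', mul_one, two_mul]; congr 1; abel
  -- `R S = (R + S) / 2`
  have hRS : 2 * (R * S) = R + S := by
    have : R * (X * S) = R * X * S := (mul_assoc _ _ _).symm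
    rw [hXS, hR', mul_sub, mul_one, sub_mul, one_mul] at this
    have h2 : R + S = R * S + R * S := by
      rw [sub_eq_sub_iff_add_eq_add] at this
      exact this
    rw [two_mul, h2]
  rw [e1, e2]
  have c1 : p.1 * ((2 * R - 1) * p.1) = (2 * R - 1) * p.1 := by
    have : Commute p.1 (2 * R - 1) :=
      (((Commute.ofNat_right p.1 2).mul_right cRp.symm).sub_right (Commute.one_right _))
    rw [← mul_assoc, this.eq, mul_assoc, hpp]
  have k1 : (2 * S - 1) * (2 * R - 1) = 1 := by
    calc _ = 4 * (S * R) - 2 * S - 2 * R + 1 := by noncomm_ring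
      _ = 2 * (2 * (R * S)) - 2 * S - 2 * R + 1 := by rw [← cRS.eq]; noncomm_ring
      _ = 1 := by rw [hRS]; noncomm_ring
  have k2 : (2 * R - 1) * (2 * S - 1) = 1 := by
    calc _ = 2 * (2 * (R * S)) - 2 * S - 2 * R + 1 := by noncomm_ring
      _ = 1 := by rw [hRS]; noncomm_ring
  have hpS : p.1 * (2 * S - 1) = (2 * S - 1) * p.1 := by
    have : Commute p.1 (2 * S - 1) :=
      (((Commute.ofNat_right p.1 2).mul_right cSp.symm).sub_right (Commute.one_right _))
    exact this.eq
  -- The defining relation of the Cayley transform `g`: `g (p - X) = p + X`.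
  have gY : (2 * R - 1) * p.1 * (p.1 - X) = p.1 + X := by
    calc _ = (2 * R - 1) * (p.1 * p.1 - p.1 * X) := by rw [mul_assoc, mul_sub p.1]
      _ = 2 * (R * p.1) - p.1 - 2 * (R * X) + X := by rw [hpp, hl]; noncomm_ring
      _ = 2 * (R * p.1) - p.1 - 2 * (R * (X * p.1)) + X := by rw [hr]
      _ = 2 * (R * p.1) - p.1 - 2 * ((R * X) * p.1) + X := by rw [mul_assoc R]
      _ = _ := by rw [hR']; noncomm_ring
  have hp0 := p.2.mul_one_sub_self
  have Yg : (p.1 - X) * ((2 * R - 1) * p.1) = p.1 + X := by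
    rw [← gY, ← c1]
    have : Commute (p.1 - X) (2 * R - 1) := ((Commute.ofNat_right _ 2).mul_right
      (cRp.symm.sub_left cRX.symm)).sub_right (Commute.one_right _)
    have hYp : (p.1 - X) * p.1 = p.1 * (p.1 - X) := by rw [sub_mul, mul_sub, hl, hr]
    rw [c1, ← mul_assoc, this.eq, mul_assoc, hYp, ← mul_assoc]
  have u3 : IsUnit (1 + (2 * R - 1) * p.1) := by
    -- `g` vanishes on `Wᗮ`, so the inverse of `1 + g` is `1` there and `(1 - X)/2` on `W`; `b` is
    -- twice this operator.
    refine isUnit_of_mul_eq_two (b := 2 * (1 - p.1) + (p.1 - X)) ?_ ?_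
    · calc _ = 2 * (1 - p.1) + (p.1 - X) + 2 * ((2 * R - 1) * (p.1 * (1 - p.1))) +
            (2 * R - 1) * p.1 * (p.1 - X) := by noncomm_ring
        _ = 2 := by rw [gY, hp0]; noncomm_ring; rw [two_smul, one_add_one_eq_two]
    · calc _ = 2 * (1 - p.1) + (p.1 - X) + 2 * ((1 - p.1) * ((2 * R - 1) * p.1)) +
            (p.1 - X) * ((2 * R - 1) * p.1) := by noncomm_ring
        _ = 2 := by rw [Yg, sub_mul 1 p.1, c1, one_mul]; noncomm_ring; rw [two_smul, one_add_one_eq_two]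
  refine ⟨c1, by rw [mul_assoc, hpp], ?_, ?_, u3, ?_⟩
  · calc _ = p.1 * ((2 * S - 1) * (2 * R - 1)) * p.1 := by noncomm_ring
      _ = p.1 := by rw [k1, mul_one, hpp]
  · calc _ = (2 * R - 1) * (p.1 * p.1 * (2 * S - 1)) := by simp only [mul_assoc]
      _ = _ := by rw [hpp, hpS, ← mul_assoc, k2, one_mul]
  · have e3 : star (p.1 * (2 * S - 1)) = (2 * R - 1) * p.1 := by
      have := congrArg star eg
      rw [star_star, e1, e2] at this
      exact this.symm
    have hK : 2 * (p.1 * Ring.inverse (1 + (2 * R - 1) * p.1) * p.1) = p.1 - X := by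
      have h1 : (1 + (2 * R - 1) * p.1) * (p.1 - X) = 2 * p.1 := by
        rw [add_mul, gY, one_mul, two_mul]; abel
      have h2 : Ring.inverse (1 + (2 * R - 1) * p.1) * (2 * p.1) = p.1 - X := by
        rw [← h1, ← mul_assoc, Ring.inverse_mul_cancel _ u3, one_mul]
      calc _ = p.1 * (Ring.inverse (1 + (2 * R - 1) * p.1) * (2 * p.1)) := by noncomm_ring
        _ = _ := by rw [h2, mul_sub, hpp, hl]
    have hK' : 2 * star (p.1 * Ring.inverse (1 + (2 * R - 1) * p.1) * p.1) = p.1 + X := by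
      have := congrArg star hK
      rw [two_mul, star_add, star_sub, p.star_eq, hX.1, sub_neg_eq_add, ← two_mul] at this
      exact this
    have gY' : (p.1 + X) * (p.1 * (2 * S - 1)) = p.1 - X := by
      have := congrArg star gY
      rw [star_mul, star_sub, star_add, ← e3, star_star, p.star_eq, hX.1, sub_neg_eq_add,
        ← sub_eq_add_neg] at this
      exact this
    -- Each of the two outer factors of the coordinate contains a half, so the identity is proved
    -- after multiplication by four; it becomes `(p + X)² - (p - X)² = 4X`.
    apply two_mul_clm_cancel
    apply two_mul_clm_cancel
    calc _ = (2 * star (p.1 * Ring.inverse (1 + (2 * R - 1) * p.1) * p.1)) *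
          ((2 * R - 1) * p.1 - p.1 * (2 * S - 1)) *
          (2 * (p.1 * Ring.inverse (1 + (2 * R - 1) * p.1) * p.1)) := by noncomm_ring
      _ = (p.1 + X) * ((2 * R - 1) * p.1 * (p.1 - X)) -
          (p.1 + X) * (p.1 * (2 * S - 1)) * (p.1 - X) := by rw [hK, hK']; noncomm_ring
      _ = 2 * (p.1 * X) + 2 * (X * p.1) := by rw [gY, gY']; noncomm_ring
      _ = 2 * (2 * X) := by rw [hl, hr]; noncomm_ring

/-- The Cayley coordinate determines the unitary part. -/
theorem cayleyInv_cayleyCoord {g : H →L[ℂ] H} (h1 : p.1 * g = g) (h2 : g * p.1 = g)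
    (h3 : star g * g = p.1) (h4 : g * star g = p.1) (hu : IsUnit (1 + g)) :
    cayleyInv p (cayleyCoord p g) = g := by
  have hX := cayleyCoord_mem p g
  have hpp := p.mul_self
  obtain ⟨u1, u2⟩ := isUnit_one_sub_of_skewCorner hX
  have hl := skewCorner_left hX
  have hr := skewCorner_right hX
  have cKg : Commute (Ring.inverse (1 + g)) g :=
    commute_inverse hu ((Commute.one_left g).add_left (Commute.refl g))
  have cKp : Commute (Ring.inverse (1 + g)) p.1 :=
    commute_inverse hu ((Commute.one_left p.1).add_left (by rw [Commute, SemiconjBy, h1, h2]))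
  have hK := Ring.inverse_mul_cancel _ hu
  have hK' := Ring.mul_inverse_cancel _ hu
  -- Since `g` is unitary on `W`, `(1 + g*) g = p (1 + g)`.
  have key : g * Ring.inverse (1 + g) = star (Ring.inverse (1 + g)) * p.1 := by
    have e1 : (1 + star g) * g = p.1 * (1 + g) := by
      rw [add_mul, h3, mul_add, h1, one_mul, mul_one, add_comm]
    have e2 : star (Ring.inverse (1 + g)) * (1 + star g) = 1 := by
      have := congrArg star hK'
      rwa [star_mul, star_add, star_one] at this
    calc _ = star (Ring.inverse (1 + g)) * (1 + star g) * g * Ring.inverse (1 + g) := by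
          rw [e2, one_mul]
      _ = star (Ring.inverse (1 + g)) * (p.1 * (1 + g)) * Ring.inverse (1 + g) := by
          rw [mul_assoc _ (1 + star g), e1]
      _ = _ := by rw [mul_assoc, mul_assoc p.1, hK', mul_one]
  -- Unitarity reduces the manifestly skew-adjoint formula to the usual Cayley quotient.
  have hX' : cayleyCoord p g = Ring.inverse (1 + g) * (g - p.1) := by
    have e1 : star (p.1 * Ring.inverse (1 + g) * p.1) = p.1 * (g * Ring.inverse (1 + g)) := by
      rw [star_mul, star_mul, p.star_eq, key]
    have e2 : g * (g - star g) = (g - p.1) * (g + p.1) := by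
      rw [mul_sub, h4, sub_mul, mul_add, mul_add, h2, h1, hpp]; abel
    unfold cayleyCoord
    rw [e1]
    calc _ = (p.1 * g) * Ring.inverse (1 + g) * (g - star g) * p.1 *
          Ring.inverse (1 + g) * p.1 := by simp only [mul_assoc]
      _ = Ring.inverse (1 + g) * (g * (g - star g)) * p.1 * Ring.inverse (1 + g) * p.1 := by
          rw [h1, ← cKg.eq]; simp only [mul_assoc]
      _ = Ring.inverse (1 + g) * (g - p.1) * ((g * p.1 + p.1 * p.1) * Ring.inverse (1 + g)) *
          p.1 := by rw [e2, ← add_mul]; simp only [mul_assoc]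
      _ = Ring.inverse (1 + g) * (g - p.1) * (p.1 * ((1 + g) * Ring.inverse (1 + g))) * p.1 := by
          rw [h2, hpp, ← mul_assoc p.1, mul_add, h1, mul_one, add_comm g]
      _ = _ := by rw [hK', mul_one, mul_assoc, hpp, mul_assoc, sub_mul, h2, hpp]
  have hXp : cayleyCoord p g = Ring.inverse (1 + g) * (g - p.1) := hX'
  generalize cayleyCoord p g = X at *
  have a1 : (1 - X) * ((1 + g) * p.1) = 2 * p.1 := by
    have : X * ((1 + g) * p.1) = g - p.1 := by
      have c : Commute (1 + g) (g - p.1) := by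
        refine (Commute.one_left _).add_left ((Commute.refl g).sub_right ?_)
        rw [Commute, SemiconjBy, h1, h2]
      rw [hXp]
      calc _ = Ring.inverse (1 + g) * ((g - p.1) * (1 + g)) * p.1 := by simp only [mul_assoc]
        _ = Ring.inverse (1 + g) * (1 + g) * (g - p.1) * p.1 := by
            rw [← c.eq]; simp only [mul_assoc]
        _ = _ := by rw [hK, one_mul, sub_mul, h2, hpp]
    rw [sub_mul, this, add_mul, h2, one_mul, one_mul, two_mul]; abel
  have a2 : 2 * (Ring.inverse (1 - X) * p.1) = (1 + g) * p.1 := by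
    calc _ = Ring.inverse (1 - X) * (2 * p.1) := by noncomm_ring
      _ = _ := by rw [← a1, ← mul_assoc, Ring.inverse_mul_cancel _ u1, one_mul]
  have a3 : (p.1 + X) * (1 + g) = 2 * g := by
    have c : Commute (1 + g) (g - p.1) := by
      refine (Commute.one_left _).add_left ((Commute.refl g).sub_right ?_)
      rw [Commute, SemiconjBy, h1, h2]
    rw [add_mul, hXp, mul_assoc, ← c.eq, ← mul_assoc, hK, mul_add, h1, mul_one, one_mul, two_mul]
    abel
  unfold cayleyInv
  apply two_mul_clm_cancel
  calc _ = (1 + X) * (2 * (Ring.inverse (1 - X) * p.1)) := by noncomm_ring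
    _ = (1 + X) * p.1 * (1 + g) := by
        have : (1 + g) * p.1 = p.1 * (1 + g) := by
          rw [add_mul, mul_add, h1, h2, one_mul, mul_one]
        rw [a2, this, mul_assoc]
    _ = _ := by rw [add_mul, hr, one_mul, a3]

end Skew

end Cayley

section Charts

variable {H : Type u} [NormedAddCommGroup H] [InnerProductSpace ℂ H] [CompleteSpace H]

/-! ### Smoothness of the charts as functions of operators -/

theorem contDiffOn_ringInverse :
    ContDiffOn ℝ ∞ (Ring.inverse : (H →L[ℂ] H) → H →L[ℂ] H) {a | IsUnit a} := by
  rintro _ ⟨v, rfl⟩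
  exact (contDiffAt_ringInverse ℝ v).contDiffWithinAt

theorem ContDiffOn.clm_star {X : Type u} [NormedAddCommGroup X] [NormedSpace ℝ X]
    {f : X → H →L[ℂ] H} {s : Set X} (hf : ContDiffOn ℝ ∞ f s) :
    ContDiffOn ℝ ∞ (fun x => star (f x)) s :=
  contDiff_star_clm.comp_contDiffOn hf

theorem ContDiffOn.clm_ringInverse {X : Type u} [NormedAddCommGroup X] [NormedSpace ℝ X]
    {f : X → H →L[ℂ] H} {s : Set X} (hf : ContDiffOn ℝ ∞ f s) (h : ∀ x ∈ s, IsUnit (f x)) :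
    ContDiffOn ℝ ∞ (fun x => Ring.inverse (f x)) s :=
  contDiffOn_ringInverse.comp hf h

theorem contDiff_graphSection (p : Proj H) : ContDiff ℝ ∞ (graphSection p) := by
  unfold graphSection
  exact ((contDiff_const.add contDiff_id).mul
    contDiff_sqrt_inverse_one_add_star_mul_self).mul contDiff_const

/-- The domain of the extended graph chart. -/
def graphDomainOp (p : Proj H) : Set (H →L[ℂ] H) :=
  {q | IsUnit (p.1 * q * p.1 + (1 - p.1)) ∧ IsUnit (intertwiner p q)}

theorem contDiff_intertwiner (p : Proj H) : ContDiff ℝ ∞ (intertwiner p) := by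
  unfold intertwiner
  exact (contDiff_const.mul contDiff_id).add (contDiff_const.mul (contDiff_const.sub contDiff_id))

theorem contDiff_compression (p : Proj H) :
    ContDiff ℝ ∞ fun q : H →L[ℂ] H => p.1 * q * p.1 + (1 - p.1) :=
  ((contDiff_const.mul contDiff_id).mul contDiff_const).add contDiff_const

theorem isOpen_graphDomainOp (p : Proj H) : IsOpen (graphDomainOp p) :=
  (Units.isOpen.preimage (contDiff_compression p).continuous).inter
    (Units.isOpen.preimage (contDiff_intertwiner p).continuous)

theorem contDiffOn_graphCoordOp (p : Proj H) :
    ContDiffOn ℝ ∞ (graphCoordOp p) (graphDomainOp p) := by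
  unfold graphCoordOp
  refine (((contDiff_const.mul contDiff_id).mul contDiff_const).contDiffOn.mul
    ((contDiff_compression p).contDiffOn.clm_ringInverse fun q hq => hq.1)).mul contDiffOn_const

/-- For projections, invertibility of the intertwiner already implies that of the compression, which
is then `(1 + A* A)⁻¹`. Both are imposed on general operators: one cuts out the domain, the other
makes the coordinate formula smooth. -/
theorem mem_graphDomain_iff_mem_graphDomainOp {p q : Proj H} :
    q ∈ graphDomain p ↔ q.1 ∈ graphDomainOp p := by
  refine ⟨fun h => ⟨?_, mem_graphDomain_iff_isUnit.1 h⟩, fun h => mem_graphDomain_iff_isUnit.2 h.2⟩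
  rw [eq_graphProj_of_mem_graphDomain h, compression_graphProj]
  obtain ⟨v, hv⟩ := (isUnit_one_add_star_mul_self (graphCoord p q)).1
  rw [← hv, Ring.inverse_unit]
  exact Units.isUnit _

/-- The projection onto the graph of `A`, for an arbitrary operator `A`. -/
def graphProjOp (p : Proj H) (A : H →L[ℂ] H) : H →L[ℂ] H :=
  graphSection p A * star (graphSection p A)

theorem contDiff_graphProjOp (p : Proj H) : ContDiff ℝ ∞ (graphProjOp p) :=
  (contDiff_graphSection p).mul (contDiff_star_clm.comp (contDiff_graphSection p))

theorem contDiff_subtype (S : Submodule ℝ (H →L[ℂ] H)) :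
    ContDiff ℝ ∞ (Subtype.val : S → H →L[ℂ] H) :=
  S.subtypeL.contDiff

/-- The graph chart is a slice chart. -/
def grassmannianSlice (p : Proj H) :
    SliceChart (Subtype.val : Proj H → H →L[ℂ] H) (grassmannianChart p) where
  amb := H →L[ℂ] H
  ι := (offDiag p).subtypeₗᵢ
  U := graphDomainOp p
  Φ := graphCoordOp p
  Ψ := fun A : offDiag p => graphProjOp p A
  isOpen_U := isOpen_graphDomainOp p
  contDiffOn_Φ := contDiffOn_graphCoordOp p
  contDiff_Ψ := (contDiff_graphProjOp p).comp (contDiff_subtype _)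
  mem_source _ := mem_graphDomain_iff_mem_graphDomainOp
  Φ_apply _ _ := rfl
  Ψ_toFun _ hq := (congrArg Subtype.val (eq_graphProj_of_mem_graphDomain hq)).symm
  surj A := ⟨graphProj p A.1 A.2, graphProj_mem_graphDomain A.2,
    Subtype.ext (graphCoordOp_graphProj A.2)⟩

/-! ### The unitary part of a partial isometry -/

/-- The formula for the unitary part, for an arbitrary operator in place of the partial
isometry. -/
def unitaryPartOp (u₀ : PIso H) (v : H →L[ℂ] H) : H →L[ℂ] H :=
  star u₀.1 * star (graphSection u₀.tgt (graphCoordOp u₀.tgt (v * star v))) * v *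
    graphSection u₀.src (graphCoordOp u₀.src (star v * v))

/-- The domain on which the two graph coordinates of the extended chart of the set of partial
isometries are smooth. -/
def endDomainOp (u₀ : PIso H) : Set (H →L[ℂ] H) :=
  {v | v * star v ∈ graphDomainOp u₀.tgt} ∩ {v | star v * v ∈ graphDomainOp u₀.src}

/-- The domain of the extended chart of the set of partial isometries. -/
def partialIsometryDomainOp (u₀ : PIso H) : Set (H →L[ℂ] H) :=
  endDomainOp u₀ ∩ {v | IsUnit (1 + unitaryPartOp u₀ v)}

theorem contDiff_mul_star : ContDiff ℝ ∞ fun v : H →L[ℂ] H => v * star v :=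
  contDiff_id.mul contDiff_star_clm

theorem contDiff_star_mul : ContDiff ℝ ∞ fun v : H →L[ℂ] H => star v * v :=
  contDiff_star_clm.mul contDiff_id

theorem isOpen_endDomainOp (u₀ : PIso H) : IsOpen (endDomainOp u₀) :=
  ((isOpen_graphDomainOp _).preimage contDiff_mul_star.continuous).inter
    ((isOpen_graphDomainOp _).preimage contDiff_star_mul.continuous)

theorem contDiffOn_graphCoordOp_tgt (u₀ : PIso H) :
    ContDiffOn ℝ ∞ (fun v => graphCoordOp u₀.tgt (v * star v)) (endDomainOp u₀) :=
  (contDiffOn_graphCoordOp _).comp contDiff_mul_star.contDiffOn fun _ hv => hv.1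

theorem contDiffOn_graphCoordOp_src (u₀ : PIso H) :
    ContDiffOn ℝ ∞ (fun v => graphCoordOp u₀.src (star v * v)) (endDomainOp u₀) :=
  (contDiffOn_graphCoordOp _).comp contDiff_star_mul.contDiffOn fun _ hv => hv.2

theorem contDiffOn_unitaryPartOp (u₀ : PIso H) :
    ContDiffOn ℝ ∞ (unitaryPartOp u₀) (endDomainOp u₀) := by
  unfold unitaryPartOp
  exact ((contDiffOn_const.mul ((contDiff_graphSection _).comp_contDiffOn
    (contDiffOn_graphCoordOp_tgt u₀)).clm_star).mul contDiffOn_id).mul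
    ((contDiff_graphSection _).comp_contDiffOn (contDiffOn_graphCoordOp_src u₀))

theorem isOpen_partialIsometryDomainOp (u₀ : PIso H) : IsOpen (partialIsometryDomainOp u₀) :=
  (contDiffOn_const.add (contDiffOn_unitaryPartOp u₀)).continuousOn.isOpen_inter_preimage
    (isOpen_endDomainOp u₀) Units.isOpen

theorem contDiffOn_cayleyCoord (p : Proj H) :
    ContDiffOn ℝ ∞ (cayleyCoord p) {g | IsUnit (1 + g)} := by
  unfold cayleyCoord
  have h : ContDiffOn ℝ ∞ (fun g : H →L[ℂ] H => p.1 * Ring.inverse (1 + g) * p.1)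
      {g | IsUnit (1 + g)} :=
    (contDiffOn_const.mul ((contDiffOn_const.add contDiffOn_id).clm_ringInverse
      fun g hg => hg)).mul contDiffOn_const
  exact (h.clm_star.mul (contDiffOn_id.sub contDiffOn_id.clm_star)).mul h

/-- The coordinates of the extended chart of the set of partial isometries. -/
def partialIsometryCoordOp (u₀ : PIso H) (v : H →L[ℂ] H) :
    (H →L[ℂ] H) × (H →L[ℂ] H) × (H →L[ℂ] H) :=
  (graphCoordOp u₀.tgt (v * star v), graphCoordOp u₀.src (star v * v),
    cayleyCoord u₀.src (unitaryPartOp u₀ v))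

theorem contDiffOn_partialIsometryCoordOp (u₀ : PIso H) :
    ContDiffOn ℝ ∞ (partialIsometryCoordOp u₀) (partialIsometryDomainOp u₀) := by
  have hsub : partialIsometryDomainOp u₀ ⊆ endDomainOp u₀ := Set.inter_subset_left
  have h1 := (contDiffOn_graphCoordOp_tgt u₀).mono hsub
  have h2 := (contDiffOn_graphCoordOp_src u₀).mono hsub
  have h3 : ContDiffOn ℝ ∞ (fun v => cayleyCoord u₀.src (unitaryPartOp u₀ v))
      (partialIsometryDomainOp u₀) :=
    (contDiffOn_cayleyCoord _).comp ((contDiffOn_unitaryPartOp u₀).mono hsub)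
      fun _ hv => hv.2
  have h4 := h2.prodMk h3
  have h5 := h1.prodMk h4
  have e : (fun v => (graphCoordOp u₀.tgt (v * star v), graphCoordOp u₀.src (star v * v),
      cayleyCoord u₀.src (unitaryPartOp u₀ v))) = partialIsometryCoordOp u₀ := by
    funext v
    rw [partialIsometryCoordOp]
  rw [← e]
  with_reducible exact h5

/-- The inverse of the chart of the set of partial isometries. -/
def partialIsometryOfCoord (u₀ : PIso H) (A B X : H →L[ℂ] H) : H →L[ℂ] H :=
  graphSection u₀.tgt A * u₀.1 * cayleyInv u₀.src X * star (graphSection u₀.src B)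

theorem unitaryPart_eq (u₀ v : PIso H) : unitaryPart u₀ v = unitaryPartOp u₀ v.1 := rfl

theorem mem_partialIsometryDomain_iff {u₀ v : PIso H} :
    v ∈ partialIsometryDomain u₀ ↔ v.1 ∈ partialIsometryDomainOp u₀ := by
  have ht : v.tgt ∈ graphDomain u₀.tgt ↔ v.tgt.1 ∈ graphDomainOp u₀.tgt :=
    mem_graphDomain_iff_mem_graphDomainOp
  have hs : v.src ∈ graphDomain u₀.src ↔ v.src.1 ∈ graphDomainOp u₀.src :=
    mem_graphDomain_iff_mem_graphDomainOp
  have hu : IsUnit (1 + unitaryPart u₀ v) ↔ IsUnit (1 + unitaryPartOp u₀ v.1) := by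
    rw [unitaryPart_eq]
  exact ⟨fun h => ⟨⟨ht.1 h.1, hs.1 h.2.1⟩, hu.1 h.2.2⟩,
    fun h => ⟨ht.2 h.1.1, hs.2 h.1.2, hu.2 h.2⟩⟩

namespace PIso

variable (v : PIso H)

theorem mul_src : v.1 * v.src.1 = v.1 := v.mul_star_mul

theorem src_mul_star : v.src.1 * star v.1 = star v.1 := by
  have := congrArg star v.mul_src
  rwa [star_mul, v.src.star_eq] at this

theorem tgt_mul : v.tgt.1 * v.1 = v.1 := by
  change v.1 * star v.1 * v.1 = v.1
  rw [_root_.mul_assoc]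
  exact v.mul_star_mul

theorem star_mul_tgt : star v.1 * v.tgt.1 = star v.1 := by
  have := congrArg star v.tgt_mul
  rwa [star_mul, v.tgt.star_eq] at this

end PIso

section UnitaryPart

variable {u₀ : PIso H} {A B : H →L[ℂ] H}

/-- The unitary part is unitary on the initial space, and it determines the partial isometry. -/
theorem unitaryPart_facts {v : PIso H} {S T : H →L[ℂ] H}
    (hS : star S * S = u₀.tgt.1) (hS' : S * star S = v.tgt.1)
    (hT : star T * T = u₀.src.1) (hT' : T * star T = v.src.1) (hTp : T * u₀.src.1 = T)
    (hSp : S * u₀.tgt.1 = S) :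
    u₀.src.1 * (star u₀.1 * star S * v.1 * T) = star u₀.1 * star S * v.1 * T ∧
    (star u₀.1 * star S * v.1 * T) * u₀.src.1 = star u₀.1 * star S * v.1 * T ∧
    star (star u₀.1 * star S * v.1 * T) * (star u₀.1 * star S * v.1 * T) = u₀.src.1 ∧
    (star u₀.1 * star S * v.1 * T) * star (star u₀.1 * star S * v.1 * T) = u₀.src.1 ∧
    S * u₀.1 * (star u₀.1 * star S * v.1 * T) * star T = v.1 := by
  have hu : u₀.1 * star u₀.1 = u₀.tgt.1 := rfl
  have hu' : star u₀.1 * u₀.1 = u₀.src.1 := rfl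
  have hv : v.1 * star v.1 = v.tgt.1 := rfl
  have hv' : star v.1 * v.1 = v.src.1 := rfl
  have hpS : u₀.tgt.1 * star S = star S := by
    have := congrArg star hSp
    rwa [star_mul, u₀.tgt.star_eq] at this
  have hvv := v.mul_src
  have hvs := v.src_mul_star
  have hvt := v.tgt_mul
  have hvst := v.star_mul_tgt
  have huu := u₀.mul_src
  have hus := u₀.src_mul_star
  have hut := u₀.tgt_mul
  have hust := u₀.star_mul_tgt
  have hTT : T * (star T * T) = T := by rw [hT, hTp]
  have hSS : star S * (S * star S) = star S := by rw [← mul_assoc, hS, hpS]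
  have hvT : v.src.1 * T = T := by rw [← hT', mul_assoc, hTT]
  have hvS : star S * v.tgt.1 = star S := by rw [← hS', hSS]
  refine ⟨?_, ?_, ?_, ?_, ?_⟩
  · simp only [← mul_assoc, hus]
  · simp only [mul_assoc, hTp]
  · simp only [star_mul, star_star, mul_assoc]
    rw [mul_mul_of_mul_eq hu, mul_mul_of_mul_eq hpS, mul_mul_of_mul_eq hS',
      mul_mul_of_mul_eq hvst, mul_mul_of_mul_eq hv', hvT, hT]
  · simp only [star_mul, star_star, mul_assoc]
    rw [mul_mul_of_mul_eq hT', mul_mul_of_mul_eq hvv, mul_mul_of_mul_eq hv,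
      mul_mul_of_mul_eq hvS, mul_mul_of_mul_eq hS, hut, hu']
  · simp only [mul_assoc]
    rw [mul_mul_of_mul_eq hu, mul_mul_of_mul_eq hpS, mul_mul_of_mul_eq hS', hT', hvv, hvt]

/-- The inverse Cayley transform restores the unitary part `g`, and the cross-sections `S`, `T` at
the two ends give back `v = S u₀ g T*`. -/
theorem partialIsometryOfCoord_toFun {v : PIso H} (hv : v ∈ partialIsometryDomain u₀) :
    partialIsometryOfCoord u₀ (graphCoord u₀.tgt v.tgt) (graphCoord u₀.src v.src)
      (cayleyCoord u₀.src (unitaryPart u₀ v)) = v.1 := by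
  obtain ⟨h1, h2, h3⟩ := hv
  obtain ⟨k1, k2, k3, k4, k5⟩ := unitaryPart_facts (u₀ := u₀) (v := v)
    (S := graphSection u₀.tgt (graphCoord u₀.tgt v.tgt))
    (T := graphSection u₀.src (graphCoord u₀.src v.src))
    (star_graphSection_mul_self (graphCoord_mem _ _))
    (congrArg Subtype.val (eq_graphProj_of_mem_graphDomain h1)).symm
    (star_graphSection_mul_self (graphCoord_mem _ _))
    (congrArg Subtype.val (eq_graphProj_of_mem_graphDomain h2)).symm
    (graphSection_mul_proj _ _) (graphSection_mul_proj _ _)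
  unfold partialIsometryOfCoord
  rw [cayleyInv_cayleyCoord (g := unitaryPart u₀ v) k1 k2 k3 k4 h3]
  exact k5

/-- The ends of the partial isometry with given coordinates. -/
theorem partialIsometryOfCoord_facts {S T g : H →L[ℂ] H}
    (hS : star S * S = u₀.tgt.1) (hT : star T * T = u₀.src.1) (hTp : T * u₀.src.1 = T)
    (hSp : S * u₀.tgt.1 = S) (h1 : u₀.src.1 * g = g) (h2 : g * u₀.src.1 = g)
    (h3 : star g * g = u₀.src.1) (h4 : g * star g = u₀.src.1) :
    (S * u₀.1 * g * star T) * star (S * u₀.1 * g * star T) = S * star S ∧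
    star (S * u₀.1 * g * star T) * (S * u₀.1 * g * star T) = T * star T ∧
    star u₀.1 * star S * (S * u₀.1 * g * star T) * T = g := by
  have hu : u₀.1 * star u₀.1 = u₀.tgt.1 := rfl
  have hu' : star u₀.1 * u₀.1 = u₀.src.1 := rfl
  have huu := u₀.mul_src
  have hut := u₀.tgt_mul
  refine ⟨?_, ?_, ?_⟩
  · simp only [star_mul, star_star, mul_assoc]
    rw [mul_mul_of_mul_eq hT, mul_mul_of_mul_eq h2, mul_mul_of_mul_eq h4,
      mul_mul_of_mul_eq huu, mul_mul_of_mul_eq hu, mul_mul_of_mul_eq hSp]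
  · simp only [star_mul, star_star, mul_assoc]
    rw [mul_mul_of_mul_eq hS, mul_mul_of_mul_eq hut, mul_mul_of_mul_eq hu',
      mul_mul_of_mul_eq h1, mul_mul_of_mul_eq h3, mul_mul_of_mul_eq hTp]
  · simp only [mul_assoc]
    rw [mul_mul_of_mul_eq hS, mul_mul_of_mul_eq hut, mul_mul_of_mul_eq hu', hT, h2, h1]

/-- The chart is onto: the inverse Cayley transform of any `X` is unitary on the initial space with
`1 + g` invertible, so the three coordinates can be prescribed independently. The ends are recorded
for use in the restricted case. -/
theorem exists_partialIsometry_of_coord {X : H →L[ℂ] H} (hA : A ∈ offDiag u₀.tgt)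
    (hB : B ∈ offDiag u₀.src) (hX : X ∈ skewCorner u₀.src) :
    ∃ v : PIso H, v.tgt = graphProj u₀.tgt A hA ∧ v.src = graphProj u₀.src B hB ∧
      v ∈ partialIsometryDomain u₀ ∧ graphCoord u₀.tgt v.tgt = A ∧ graphCoord u₀.src v.src = B ∧
      cayleyCoord u₀.src (unitaryPart u₀ v) = X := by
  obtain ⟨g1, g2, g3, g4, g5, g6⟩ := cayleyInv_facts hX
  obtain ⟨f1, f2, f3⟩ := partialIsometryOfCoord_facts (u₀ := u₀)
    (star_graphSection_mul_self hA) (star_graphSection_mul_self hB)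
    (graphSection_mul_proj _ _) (graphSection_mul_proj _ _) g1 g2 g3 g4
  let v : PIso H := ⟨partialIsometryOfCoord u₀ A B X, by
    unfold partialIsometryOfCoord
    rw [f2]
    exact (graphProj u₀.src B hB).2⟩
  have e1 : v.tgt = graphProj u₀.tgt A hA := Subtype.ext f1
  have e2 : v.src = graphProj u₀.src B hB := Subtype.ext f2
  have e3 : graphCoord u₀.tgt v.tgt = A := by rw [e1]; exact graphCoordOp_graphProj hA
  have e4 : graphCoord u₀.src v.src = B := by rw [e2]; exact graphCoordOp_graphProj hB
  have e5 : unitaryPart u₀ v = cayleyInv u₀.src X := by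
    change star u₀.1 * star (graphSection u₀.tgt (graphCoord u₀.tgt v.tgt)) * v.1 *
      graphSection u₀.src (graphCoord u₀.src v.src) = _
    rw [e3, e4]
    exact f3
  refine ⟨v, e1, e2, ⟨?_, ?_, ?_⟩, e3, e4, ?_⟩
  · rw [e1]; exact graphProj_mem_graphDomain hA
  · rw [e2]; exact graphProj_mem_graphDomain hB
  · rw [e5]; exact g5
  · rw [e5]; exact g6

end UnitaryPart

theorem contDiff_cayleyInv (p : Proj H) :
    ContDiff ℝ ∞ fun X : skewCorner p => cayleyInv p (X : H →L[ℂ] H) := by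
  unfold cayleyInv
  have h := contDiff_subtype (skewCorner p)
  rw [← contDiffOn_univ] at h ⊢
  exact ((contDiffOn_const.add h).mul ((contDiffOn_const.sub h).clm_ringInverse
    fun X _ => (isUnit_one_sub_of_skewCorner X.2).1)).mul contDiffOn_const

theorem contDiff_partialIsometryOfCoord (u₀ : PIso H) (S T : Submodule ℝ (H →L[ℂ] H)) :
    ContDiff ℝ ∞ fun z : S × T × skewCorner u₀.src =>
      partialIsometryOfCoord u₀ z.1 z.2.1 z.2.2 := by
  unfold partialIsometryOfCoord
  have h1 : ContDiff ℝ ∞ fun z : S × T × skewCorner u₀.src =>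
      graphSection u₀.tgt (z.1 : H →L[ℂ] H) :=
    (contDiff_graphSection _).comp ((contDiff_subtype S).comp contDiff_fst)
  have h2 : ContDiff ℝ ∞ fun z : S × T × skewCorner u₀.src =>
      star (graphSection u₀.src (z.2.1 : H →L[ℂ] H)) :=
    contDiff_star_clm.comp ((contDiff_graphSection _).comp
      ((contDiff_subtype T).comp (contDiff_fst.comp contDiff_snd)))
  have h3 : ContDiff ℝ ∞ fun z : S × T × skewCorner u₀.src =>
      cayleyInv u₀.src (z.2.2 : H →L[ℂ] H) :=
    (contDiff_cayleyInv _).comp (contDiff_snd.comp contDiff_snd)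
  exact ((h1.mul contDiff_const).mul h3).mul h2

/-- The inclusion of a product of three subspaces. -/
def subtypeProd₃ (S T R : Submodule ℝ (H →L[ℂ] H)) :
    (S × T × R) →ₗᵢ[ℝ] (H →L[ℂ] H) × (H →L[ℂ] H) × (H →L[ℂ] H) where
  toLinearMap := S.subtype.prodMap (T.subtype.prodMap R.subtype)
  norm_map' _ := rfl

theorem partialIsometryCoordOp_apply (u₀ v : PIso H) :
    partialIsometryCoordOp u₀ v.1 = (graphCoord u₀.tgt v.tgt, graphCoord u₀.src v.src,
      cayleyCoord u₀.src (unitaryPart u₀ v)) := rfl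

/-- The charts of the set of partial isometries are slice charts. -/
def partialIsometrySlice (u₀ : PIso H) :
    SliceChart (Subtype.val : PIso H → H →L[ℂ] H) (partialIsometryChart u₀) where
  amb := (H →L[ℂ] H) × (H →L[ℂ] H) × (H →L[ℂ] H)
  ι := subtypeProd₃ (offDiag u₀.tgt) (offDiag u₀.src) (skewCorner u₀.src)
  U := partialIsometryDomainOp u₀
  Φ := partialIsometryCoordOp u₀
  Ψ := fun z : offDiag u₀.tgt × offDiag u₀.src × skewCorner u₀.src =>
    partialIsometryOfCoord u₀ z.1 z.2.1 z.2.2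
  isOpen_U := isOpen_partialIsometryDomainOp u₀
  contDiffOn_Φ := contDiffOn_partialIsometryCoordOp u₀
  contDiff_Ψ := contDiff_partialIsometryOfCoord u₀ _ _
  mem_source _ := mem_partialIsometryDomain_iff
  Φ_apply := by
    intro (v : PIso H) _
    exact partialIsometryCoordOp_apply u₀ v
  Ψ_toFun _ hv := partialIsometryOfCoord_toFun hv
  surj z := by
    obtain ⟨v, -, -, hv, h1, h2, h3⟩ :=
      exists_partialIsometry_of_coord z.1.2 z.2.1.2 z.2.2.2
    exact ⟨v, hv, Prod.ext (Subtype.ext h1) (Prod.ext (Subtype.ext h2) (Subtype.ext h3))⟩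

/-- Only the outer factors matter, so `q` need not be a projection; products of partial isometries
that are not composable need this generality. -/
theorem graphCoordOp_mem (p : Proj H) (q : H →L[ℂ] H) : graphCoordOp p q ∈ offDiag p := by
  change (1 - p.1) * graphCoordOp p q * p.1 = graphCoordOp p q
  have h1 : (1 - p.1) * (1 - p.1) = 1 - p.1 := p.2.one_sub.isIdempotentElem.eq
  have h2 := p.mul_self
  unfold graphCoordOp
  simp only [mul_assoc, h2]
  simp only [← mul_assoc, h1]

theorem mem_graphDomain_self (p : Proj H) : p ∈ graphDomain p :=
  mem_graphDomain_iff_exists_isOblique.2 ⟨p.1, p.mul_self, p.mul_self, p.mul_self, p.mul_self⟩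

theorem unitaryPart_self (u : PIso H) : unitaryPart u u = u.src.1 := by
  have h : ∀ p : Proj H, crossSection p p = p.1 := by
    intro p
    have h0 : graphCoord p p = 0 := by
      unfold graphCoord
      rw [p.2.one_sub_mul_self]
      simp
    unfold crossSection
    rw [h0]
    simp [p.mul_self]
  unfold unitaryPart
  rw [h, h, u.tgt.star_eq, u.star_mul_tgt, mul_assoc, u.mul_src]
  rfl

theorem mem_partialIsometryDomain_self (u : PIso H) : u ∈ partialIsometryDomain u := by
  refine ⟨mem_graphDomain_self _, mem_graphDomain_self _, ?_⟩
  rw [unitaryPart_self]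
  -- For an idempotent, `(1 + p)(2 - p) = 2`.
  refine isUnit_of_mul_eq_two (b := 2 - u.src.1) ?_ ?_
  · rw [mul_sub, add_mul, add_mul, u.src.mul_self, one_mul, one_mul, mul_two]; abel
  · rw [sub_mul, mul_add, mul_add, u.src.mul_self, mul_one, mul_one, two_mul]; abel

/-! ### The groupoid of all partial isometries -/

theorem isBanachLieGroupoid_partialIsometryGroupoid :
    (partialIsometryGroupoid H).IsBanachLieGroupoid
      (partialIsometryAtlas H) (grassmannianAtlas H) where
  manifold_arrows := isBanachManifold_of_sliceChart partialIsometrySlice Subtype.val_injective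
    fun u => ⟨u, mem_partialIsometryDomain_self u⟩
  manifold_objects := isBanachManifold_of_sliceChart grassmannianSlice Subtype.val_injective
    fun p => ⟨p, mem_graphDomain_self p⟩
  surjective_s p := ⟨_, (partialIsometryGroupoid H).s_unit p⟩
  surjective_t p := ⟨_, (partialIsometryGroupoid H).t_unit p⟩
  submersion_s := by
    refine isSubmersion_of_sliceChart partialIsometrySlice grassmannianSlice
      Subtype.val_injective Subtype.val_injective (fun _ => rfl) contDiff_star_mul fun u => ?_
    let L : (offDiag u.tgt × offDiag u.src × skewCorner u.src) →L[ℝ] offDiag u.src :=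
      ContinuousLinearMap.fst ℝ _ _ ∘L ContinuousLinearMap.snd ℝ _ _
    let R : offDiag u.src →L[ℝ] (offDiag u.tgt × offDiag u.src × skewCorner u.src) :=
      ContinuousLinearMap.inr ℝ _ _ ∘L ContinuousLinearMap.inl ℝ _ _
    have hR : Function.RightInverse R L := fun _ => rfl
    exact ⟨u.src, L, hR.surjective, ContinuousLinearMap.closedComplemented_ker_of_rightInverse L R hR,
      fun v hv => hv.2.1, fun v hv => rfl⟩
  submersion_t := by
    refine isSubmersion_of_sliceChart partialIsometrySlice grassmannianSlice
      Subtype.val_injective Subtype.val_injective (fun _ => rfl) contDiff_mul_star fun u => ?_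
    let L : (offDiag u.tgt × offDiag u.src × skewCorner u.src) →L[ℝ] offDiag u.tgt :=
      ContinuousLinearMap.fst ℝ _ _
    let R : offDiag u.tgt →L[ℝ] (offDiag u.tgt × offDiag u.src × skewCorner u.src) :=
      ContinuousLinearMap.inl ℝ _ _
    have hR : Function.RightInverse R L := fun _ => rfl
    exact ⟨u.tgt, L, hR.surjective, ContinuousLinearMap.closedComplemented_ker_of_rightInverse L R hR,
      fun v hv => hv.1, fun v hv => rfl⟩
  smooth_mul := by
    refine SetGroupoid.isSmoothMul_of_sliceChart _ partialIsometrySlice (fun _ _ _ => rfl) ?_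
    intro g h k _
    exact ⟨(⟨_, graphCoordOp_mem _ _⟩, ⟨_, graphCoordOp_mem _ _⟩, ⟨_, cayleyCoord_mem _ _⟩), rfl⟩
  embedding_unit := isEmbedding_of_sliceChart partialIsometrySlice grassmannianSlice
    Subtype.val_injective (fun u => ⟨u, mem_partialIsometryDomain_self u⟩)
    (fun p => ⟨p, mem_graphDomain_self p⟩) fun _ => rfl
  bijective_inv := Function.Involutive.bijective fun v => Subtype.ext (star_star v.1)
  smooth_inv := isSmoothMap_of_sliceChart partialIsometrySlice partialIsometrySlice
    Subtype.val_injective (fun _ => rfl) contDiff_star_clm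

end Charts

/-! ### Fredholm operators and compact perturbations -/

section Fredholm

variable {E F : Type u} [NormedAddCommGroup E] [InnerProductSpace ℂ E]
  [NormedAddCommGroup F] [InnerProductSpace ℂ F]

open scoped LinearMap.FiniteRangeSetoid

/-- Compact operators into a Hilbert space can be approximated by operators of finite rank. -/
theorem IsCompactOperator.exists_hasNoetherianRange_norm_sub_lt {K : E →L[ℂ] F}
    (hK : IsCompactOperator K) {ε : ℝ} (hε : 0 < ε) :
    ∃ G : E →L[ℂ] F, (G : E →ₗ[ℂ] F).HasNoetherianRange ∧ ‖K - G‖ < ε := by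
  obtain ⟨C, hC, hKC⟩ := hK.image_closedBall_subset_compact (f := (K : E →ₗ[ℂ] F)) 1
  obtain ⟨t, -, htf, ht⟩ := hC.finite_cover_balls (half_pos hε)
  -- `V` is spanned by a finite `ε/2`-net of a compact set containing the image of the unit ball;
  -- the approximation is `K` followed by the orthogonal projection onto `V`.
  let V := Submodule.span ℂ t
  have hV : FiniteDimensional ℂ V := FiniteDimensional.span_of_finite ℂ htf
  refine ⟨V.starProjection ∘L K, ?_, ?_⟩
  · have h1 : (V.starProjection : F →ₗ[ℂ] F).HasNoetherianRange := by
      rw [LinearMap.hasNoetherianRange_iff_range]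
      have : LinearMap.range (V.starProjection : F →ₗ[ℂ] F) = V := V.range_starProjection
      rw [this]
      infer_instance
    exact h1.comp_right _
  · refine (ContinuousLinearMap.opNorm_le_of_unit_norm (𝕜 := ℂ) (half_pos hε).le
      fun x hx => ?_).trans_lt (half_lt_self hε)
    have hx' : K x ∈ C := hKC ⟨x, by simp [hx], rfl⟩
    obtain ⟨y, hy, hxy⟩ := Set.mem_iUnion₂.1 (ht hx')
    change ‖K x - V.starProjection (K x)‖ ≤ _
    rw [Submodule.starProjection_minimal (U := V) (K x)]
    refine (ciInf_le ⟨0, by rintro _ ⟨z, rfl⟩; positivity⟩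
      (⟨y, Submodule.subset_span hy⟩ : V)).trans ?_
    rw [← dist_eq_norm]
    exact (Metric.mem_ball.1 hxy).le

/-- A compact perturbation of the identity is invertible modulo operators of finite rank. -/
theorem IsCompactOperator.exists_isQuasiInverse_one_add {E : Type u} [NormedAddCommGroup E]
    [InnerProductSpace ℂ E] [CompleteSpace E] {K : E →L[ℂ] E}
    (hK : IsCompactOperator K) : ∃ G : E →L[ℂ] E,
      (G : E →ₗ[ℂ] E).IsQuasiInverse ((1 + K : E →L[ℂ] E) : E →ₗ[ℂ] E) := by
  obtain ⟨G, hG, hKG⟩ := hK.exists_hasNoetherianRange_norm_sub_lt one_pos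
  -- `1 + K = v + G` with `v = 1 + (K - G)` invertible by the Neumann series and `G` of finite rank,
  -- so `v⁻¹` is the quasi-inverse.
  let v : (E →L[ℂ] E)ˣ := Units.oneSub (-(K - G)) (by rwa [norm_neg])
  have hv : (1 + K : E →L[ℂ] E) = v + G := by
    change 1 + K = 1 - -(K - G) + G
    abel
  refine ⟨(v⁻¹ : (E →L[ℂ] E)ˣ), ?_, ?_⟩
  · refine LinearMap.FiniteRangeSetoid.equiv_iff_hasNoetherianRange.2 ?_
    have h : (((v⁻¹ : (E →L[ℂ] E)ˣ) : E →L[ℂ] E) : E →ₗ[ℂ] E) ∘ₗ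
        ((1 + K : E →L[ℂ] E) : E →ₗ[ℂ] E) - .id =
        (((v⁻¹ : (E →L[ℂ] E)ˣ) : E →L[ℂ] E) : E →ₗ[ℂ] E) ∘ₗ (G : E →ₗ[ℂ] E) := by
      have h0 : ((v⁻¹ : (E →L[ℂ] E)ˣ) : E →L[ℂ] E) * (1 + K) - 1 =
          ((v⁻¹ : (E →L[ℂ] E)ˣ) : E →L[ℂ] E) * G := by
        rw [hv, mul_add, Units.inv_mul]; abel
      exact congrArg ContinuousLinearMap.toLinearMap h0
    rw [h]
    exact hG.comp_left _
  · refine LinearMap.FiniteRangeSetoid.equiv_iff_hasNoetherianRange.2 ?_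
    have h : ((1 + K : E →L[ℂ] E) : E →ₗ[ℂ] E) ∘ₗ
        (((v⁻¹ : (E →L[ℂ] E)ˣ) : E →L[ℂ] E) : E →ₗ[ℂ] E) - .id =
        (G : E →ₗ[ℂ] E) ∘ₗ (((v⁻¹ : (E →L[ℂ] E)ˣ) : E →L[ℂ] E) : E →ₗ[ℂ] E) := by
      have h0 : (1 + K) * ((v⁻¹ : (E →L[ℂ] E)ˣ) : E →L[ℂ] E) - 1 =
          G * ((v⁻¹ : (E →L[ℂ] E)ˣ) : E →L[ℂ] E) := by
        rw [hv, add_mul, Units.mul_inv]; abel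
      exact congrArg ContinuousLinearMap.toLinearMap h0
    rw [h]
    exact hG.comp_right _

theorem ContinuousLinearMap.IsFredholm.comp_of_inverse {D : Type u} [NormedAddCommGroup D]
    [InnerProductSpace ℂ D] {T : E →L[ℂ] F} (hT : T.IsFredholm) {R : D →L[ℂ] E}
    {R' : E →L[ℂ] D} (h : R' ∘L R = ContinuousLinearMap.id ℂ D)
    (h' : R ∘L R' = ContinuousLinearMap.id ℂ E) : (T ∘L R).IsFredholm := by
  obtain ⟨S, hS⟩ := hT.exists_isQuasiInverse
  have hR : (R' : E →ₗ[ℂ] D).IsQuasiInverse (R : D →ₗ[ℂ] E) := by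
    refine ⟨?_, ?_⟩
    · have e : (R' : E →ₗ[ℂ] D) ∘ₗ (R : D →ₗ[ℂ] E) = .id :=
        congrArg ContinuousLinearMap.toLinearMap h
      change _ ∘ₗ _ ≈ _
      rw [e]
    · have e : (R : D →ₗ[ℂ] E) ∘ₗ (R' : E →ₗ[ℂ] D) = .id :=
        congrArg ContinuousLinearMap.toLinearMap h'
      change _ ∘ₗ _ ≈ _
      rw [e]
  exact ContinuousLinearMap.IsFredholm.of_isQuasiInverse (v := R' ∘L S) (hR.comp hS)

variable [CompleteSpace E] [CompleteSpace F]

/-- An operator that is invertible modulo compact operators is Fredholm. -/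
theorem ContinuousLinearMap.isFredholm_of_comp_eq_one_add {T : E →L[ℂ] F} {S : F →L[ℂ] E}
    {K : E →L[ℂ] E} {K' : F →L[ℂ] F} (hK : IsCompactOperator K) (hK' : IsCompactOperator K')
    (h : S ∘L T = 1 + K) (h' : T ∘L S = 1 + K') : T.IsFredholm := by
  obtain ⟨G, hG, -⟩ := hK.exists_isQuasiInverse_one_add
  obtain ⟨G', -, hG'⟩ := hK'.exists_isQuasiInverse_one_add
  rw [← h] at hG
  rw [← h'] at hG'
  have h1 : ((G ∘L S : F →L[ℂ] E) : F →ₗ[ℂ] E) ∘ₗ (T : E →ₗ[ℂ] F) ≈ .id := hG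
  have h2 : (T : E →ₗ[ℂ] F) ∘ₗ ((S ∘L G' : F →L[ℂ] E) : F →ₗ[ℂ] E) ≈ .id := hG'
  -- A left and a right inverse modulo finite rank agree modulo finite rank, as in any quotient
  -- category.
  have h3 : ((G ∘L S : F →L[ℂ] E) : F →ₗ[ℂ] E) ≈ ((S ∘L G' : F →L[ℂ] E) : F →ₗ[ℂ] E) := by
    have h4 := LinearMap.FiniteRangeSetoid.equiv_comp_right
      (u := ((S ∘L G' : F →L[ℂ] E) : F →ₗ[ℂ] E)) h1
    have h5 := LinearMap.FiniteRangeSetoid.equiv_comp_left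
      (u' := ((G ∘L S : F →L[ℂ] E) : F →ₗ[ℂ] E)) h2
    exact Setoid.trans (Setoid.symm h5) h4
  refine ContinuousLinearMap.IsFredholm.of_isQuasiInverse (v := G ∘L S) ⟨h1, ?_⟩
  exact Setoid.trans
    (LinearMap.FiniteRangeSetoid.equiv_comp_left (u' := (T : E →ₗ[ℂ] F)) h3) h2

/-- A quasi-inverse of `T` inverts `T + K` modulo compact operators, which is enough for the
Fredholm property. -/
theorem ContinuousLinearMap.IsFredholm.add_isCompactOperator {T K : E →L[ℂ] F}
    (hT : T.IsFredholm) (hK : IsCompactOperator K) : (T + K).IsFredholm := by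
  obtain ⟨S, hS, hS'⟩ := hT.exists_isQuasiInverse
  have h1 : IsCompactOperator (S ∘L T - 1 : E →L[ℂ] E) := isCompactOperator_of_hasNoetherianRange _
    (LinearMap.FiniteRangeSetoid.equiv_iff_hasNoetherianRange.1 hS)
  have h2 : IsCompactOperator (T ∘L S - 1 : F →L[ℂ] F) := isCompactOperator_of_hasNoetherianRange _
    (LinearMap.FiniteRangeSetoid.equiv_iff_hasNoetherianRange.1 hS')
  refine ContinuousLinearMap.isFredholm_of_comp_eq_one_add (S := S)
    (K := (S ∘L T - 1) + S ∘L K) (K' := (T ∘L S - 1) + K ∘L S)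
    (h1.add (hK.clm_comp S)) (h2.add (hK.comp_clm S)) ?_ ?_
  · rw [ContinuousLinearMap.comp_add]; abel
  · rw [ContinuousLinearMap.add_comp]; abel

theorem IsCompactOperator.mul_mul_of_mul_eq {H : Type u} [NormedAddCommGroup H]
    [NormedSpace ℂ H] {a t u : H →L[ℂ] H}
    (h : IsCompactOperator (a * t : H →L[ℂ] H)) (e : t * u = u) (b : H →L[ℂ] H) :
    IsCompactOperator (a * (u * b) : H →L[ℂ] H) := by
  have h' : a * (u * b) = a * t * (u * b) := by
    rw [mul_assoc, ← mul_assoc t, e]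
  rw [h']
  exact h.comp_clm (u * b)

end Fredholm

/-! ### The restricted Grassmannian and its groupoid -/

section RestrictedGrassmannian

variable {H : Type u} [NormedAddCommGroup H] [InnerProductSpace ℂ H] [CompleteSpace H]
variable {Hp : Submodule ℂ H} [Hp.HasOrthogonalProjection]

/-- The restricted Grassmannian contains the graphs of the compact operators over its points. -/
theorem graphProj_mem_resGrassmannian {p : Proj H} (hp : p ∈ resGrassmannian Hp)
    {A : H →L[ℂ] H} (hA : A ∈ compactOffDiag p) :
    graphProj p A hA.1 ∈ resGrassmannian Hp := by
  have hQ := isOblique_graphProj hA.1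
  generalize graphProj p A hA.1 = q at hQ
  let W := LinearMap.range (p.1 : H →ₗ[ℂ] H)
  let V := LinearMap.range (q.1 : H →ₗ[ℂ] H)
  have : CompleteSpace W := (isClosed_range_proj p).completeSpace_coe
  have : CompleteSpace V := (isClosed_range_proj q).completeSpace_coe
  have : CompleteSpace Hp := by
    rw [← Hp.orthogonal_orthogonal]
    infer_instance
  -- `R` projects the graph `V` onto `W` and `R'` lifts `W` to the graph; they are mutually inverse.
  let R : V →L[ℂ] W := (p.1).codRestrict W (fun x => LinearMap.mem_range_self _ x) ∘L V.subtypeL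
  let R' : W →L[ℂ] V := (p.1 + A).codRestrict V
    (fun x => ⟨(p.1 + A) x, DFunLike.congr_fun hQ.mul_left x⟩) ∘L W.subtypeL
  have hV (x : V) : (x : H) = p.1 x + A (p.1 x) := by
    have h1 : q.1 x = x := (mem_range_iff q x).1 x.2
    have h2 : (p.1 + A) (q.1 x) = q.1 x := DFunLike.congr_fun hQ.mul_right (x : H)
    have h3 : A (p.1 x) = A x := DFunLike.congr_fun (offDiag_right hA.1) (x : H)
    rw [h1] at h2
    rw [h3]
    exact h2.symm
  have hAc : IsCompactOperator A := hA.2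
  refine ⟨?_, ?_⟩
  · let T : W →L[ℂ] Hp := Hp.orthogonalProjectionOnto ∘L W.subtypeL
    -- The projection `V → Hp` is this compact perturbation of `W → Hp`, composed with the
    -- isomorphism `R`.
    have hT : (T + Hp.orthogonalProjectionOnto ∘L A ∘L W.subtypeL).IsFredholm :=
      ContinuousLinearMap.IsFredholm.add_isCompactOperator hp.1
        ((hAc.comp_clm W.subtypeL).clm_comp Hp.orthogonalProjectionOnto)
    have h1 : R' ∘L R = ContinuousLinearMap.id ℂ V := by
      ext x
      change p.1 (p.1 x) + A (p.1 x) = (x : H)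
      rw [show p.1 (p.1 x) = p.1 x from DFunLike.congr_fun p.mul_self (x : H), ← hV]
    have h2 : R ∘L R' = ContinuousLinearMap.id ℂ W := by
      ext x
      change p.1 ((p.1 + A) x) = (x : H)
      rw [show p.1 ((p.1 + A) x) = p.1 x from DFunLike.congr_fun hQ.proj_mul (x : H)]
      exact (mem_range_iff p x).1 x.2
    have h3 := hT.comp_of_inverse h1 h2
    refine (congrArg ContinuousLinearMap.IsFredholm (ContinuousLinearMap.ext fun x => ?_)).mpr h3
    change Hp.orthogonalProjectionOnto (x : H) = Hp.orthogonalProjectionOnto (p.1 x) +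
      Hp.orthogonalProjectionOnto (A (p.1 x))
    rw [← map_add, ← hV]
  · have h1 := hp.2.comp_clm R
    have h2 := (hAc.comp_clm (p.1 ∘L V.subtypeL)).clm_comp Hpᗮ.orthogonalProjectionOnto
    refine (congrArg IsCompactOperator (funext fun x => ?_)).mpr (h1.add h2)
    change Hpᗮ.orthogonalProjectionOnto (x : H) = Hpᗮ.orthogonalProjectionOnto (p.1 x) +
      Hpᗮ.orthogonalProjectionOnto (A (p.1 x))
    rw [← map_add, ← hV]

theorem graphCoordOp_mem_compactOffDiag {p : Proj H} {q : H →L[ℂ] H}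
    (h : IsCompactOperator ((1 - p.1) * q : H →L[ℂ] H)) :
    graphCoordOp p q ∈ compactOffDiag p := by
  refine ⟨graphCoordOp_mem p q, ?_⟩
  have e : graphCoordOp p q = ((1 - p.1) * q) *
    (p.1 * Ring.inverse (p.1 * q * p.1 + (1 - p.1)) * p.1) := by
    unfold graphCoordOp; simp only [mul_assoc]
  rw [e]
  exact h.comp_clm _

variable (Hp)

/-- The graph charts of the restricted Grassmannian are slice charts. -/
def resGrassmannianSlice (p : {p // p ∈ resGrassmannian Hp}) :
    SliceChart (fun q : {p // p ∈ resGrassmannian Hp} => q.1.1) (resGrassmannianAtlas Hp p) where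
  amb := H →L[ℂ] H
  ι := (compactOffDiag p.1).subtypeₗᵢ
  U := graphDomainOp p.1
  Φ := graphCoordOp p.1
  Ψ := fun A : compactOffDiag p.1 => graphProjOp p.1 A
  isOpen_U := isOpen_graphDomainOp p.1
  contDiffOn_Φ := contDiffOn_graphCoordOp p.1
  contDiff_Ψ := (contDiff_graphProjOp p.1).comp (contDiff_subtype _)
  mem_source _ := mem_graphDomain_iff_mem_graphDomainOp
  Φ_apply _ _ := rfl
  Ψ_toFun _ hq := (congrArg Subtype.val (eq_graphProj_of_mem_graphDomain hq)).symm
  surj A := ⟨⟨graphProj p.1 A.1 A.2.1, graphProj_mem_resGrassmannian p.2 A.2⟩,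
    graphProj_mem_graphDomain A.2.1, Subtype.ext (graphCoordOp_graphProj A.2.1)⟩

theorem mem_resPartialIsometryAtlas_source_iff (u₀ v : ResPIso Hp) :
    v ∈ (resPartialIsometryAtlas Hp u₀).source ↔ v.1 ∈ partialIsometryDomain u₀.1 := Iff.rfl

theorem resPartialIsometryAtlas_toFun_eq {u₀ v : ResPIso Hp}
    {z : compactOffDiag u₀.1.tgt × compactOffDiag u₀.1.src × skewCorner u₀.1.src}
    (h1 : graphCoord u₀.1.tgt v.1.tgt = z.1) (h2 : graphCoord u₀.1.src v.1.src = z.2.1)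
    (h3 : cayleyCoord u₀.1.src (unitaryPart u₀.1 v.1) = z.2.2) :
    (resPartialIsometryAtlas Hp u₀).toFun v = z :=
  Prod.ext (Subtype.ext h1) (Prod.ext (Subtype.ext h2) (Subtype.ext h3))

/-- The charts of the set of partial isometries over the restricted Grassmannian are slice
charts. -/
def resPartialIsometrySlice (u₀ : ResPIso Hp) :
    SliceChart (fun v : ResPIso Hp => v.1.1) (resPartialIsometryAtlas Hp u₀) where
  amb := (H →L[ℂ] H) × (H →L[ℂ] H) × (H →L[ℂ] H)
  ι := subtypeProd₃ (compactOffDiag u₀.1.tgt) (compactOffDiag u₀.1.src) (skewCorner u₀.1.src)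
  U := partialIsometryDomainOp u₀.1
  Φ := partialIsometryCoordOp u₀.1
  Ψ := fun z : compactOffDiag u₀.1.tgt × compactOffDiag u₀.1.src × skewCorner u₀.1.src =>
    partialIsometryOfCoord u₀.1 z.1 z.2.1 z.2.2
  isOpen_U := isOpen_partialIsometryDomainOp u₀.1
  contDiffOn_Φ := contDiffOn_partialIsometryCoordOp u₀.1
  contDiff_Ψ := contDiff_partialIsometryOfCoord u₀.1 _ _
  mem_source := by
    intro (v : ResPIso Hp)
    exact mem_partialIsometryDomain_iff (u₀ := u₀.1) (v := v.1)
  Φ_apply := by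
    intro (v : ResPIso Hp) _
    exact partialIsometryCoordOp_apply u₀.1 v.1
  Ψ_toFun _ hv := partialIsometryOfCoord_toFun hv
  surj z := by
    obtain ⟨v, ht, hs, hv, h1, h2, h3⟩ :=
      exists_partialIsometry_of_coord (u₀ := u₀.1) z.1.2.1 z.2.1.2.1 z.2.2.2
    have ht' : v.tgt ∈ resGrassmannian Hp := ht ▸ graphProj_mem_resGrassmannian u₀.2.2 z.1.2
    have hs' : v.src ∈ resGrassmannian Hp := hs ▸ graphProj_mem_resGrassmannian u₀.2.1 z.2.1.2
    exact ⟨⟨v, hs', ht'⟩, (mem_resPartialIsometryAtlas_source_iff Hp u₀ _).2 hv,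
      resPartialIsometryAtlas_toFun_eq Hp h1 h2 h3⟩

theorem injective_val_val_proj :
    Function.Injective fun q : {p // p ∈ resGrassmannian Hp} => q.1.1 :=
  Subtype.val_injective.comp Subtype.val_injective

theorem injective_val_val_partialIsometry : Function.Injective fun v : ResPIso Hp => v.1.1 :=
  Subtype.val_injective.comp Subtype.val_injective

theorem mem_resGrassmannianAtlas_source_self (p : {p // p ∈ resGrassmannian Hp}) :
    p ∈ (resGrassmannianAtlas Hp p).source :=
  mem_graphDomain_self p.1

theorem mem_resPartialIsometryAtlas_source_self (u : ResPIso Hp) :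
    u ∈ (resPartialIsometryAtlas Hp u).source :=
  mem_partialIsometryDomain_self u.1

/-- A product of elements of the restricted groupoid has compact graph coordinates, also if the
factors are not composable. -/
theorem resPartialIsometry_mul_mem_range (g h k : ResPIso Hp) :
    partialIsometryCoordOp k.1 (g.1.1 * h.1.1) ∈
      Set.range (subtypeProd₃ (compactOffDiag k.1.tgt) (compactOffDiag k.1.src)
        (skewCorner k.1.src)) := by
  -- The target of `g` fixes `g` and the source of `h` fixes `star h`, so compactness of `(1 - p) q`
  -- for points of the restricted Grassmannian passes to the products, without composability.
  have h1 := (isCompactOperator_one_sub_mul k.2.2 g.2.2).mul_mul_of_mul_eq g.1.tgt_mul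
    (h.1.1 * star (g.1.1 * h.1.1))
  have h2 := (isCompactOperator_one_sub_mul k.2.1 h.2.1).mul_mul_of_mul_eq h.1.src_mul_star
    (star g.1.1 * (g.1.1 * h.1.1))
  rw [← mul_assoc g.1.1] at h1
  rw [← mul_assoc (star h.1.1), ← star_mul] at h2
  exact ⟨(⟨_, graphCoordOp_mem_compactOffDiag h1⟩, ⟨_, graphCoordOp_mem_compactOffDiag h2⟩,
    ⟨_, cayleyCoord_mem _ _⟩), rfl⟩

theorem isBanachLieGroupoid_resPartialIsometryGroupoid :
    (resPartialIsometryGroupoid Hp).IsBanachLieGroupoid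
      (resPartialIsometryAtlas Hp) (resGrassmannianAtlas Hp) where
  manifold_arrows := isBanachManifold_of_sliceChart (resPartialIsometrySlice Hp)
    (injective_val_val_partialIsometry Hp)
    fun u => ⟨u, mem_resPartialIsometryAtlas_source_self Hp u⟩
  manifold_objects := isBanachManifold_of_sliceChart (resGrassmannianSlice Hp)
    (injective_val_val_proj Hp) fun p => ⟨p, mem_resGrassmannianAtlas_source_self Hp p⟩
  surjective_s p := ⟨_, (resPartialIsometryGroupoid Hp).s_unit p⟩
  surjective_t p := ⟨_, (resPartialIsometryGroupoid Hp).t_unit p⟩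
  submersion_s := by
    refine isSubmersion_of_sliceChart (resPartialIsometrySlice Hp) (resGrassmannianSlice Hp)
      (injective_val_val_partialIsometry Hp) (injective_val_val_proj Hp) (fun _ => rfl)
      contDiff_star_mul fun u => ?_
    let L : (compactOffDiag u.1.tgt × compactOffDiag u.1.src × skewCorner u.1.src) →L[ℝ]
        compactOffDiag u.1.src :=
      ContinuousLinearMap.fst ℝ _ _ ∘L ContinuousLinearMap.snd ℝ _ _
    let R : compactOffDiag u.1.src →L[ℝ]
        (compactOffDiag u.1.tgt × compactOffDiag u.1.src × skewCorner u.1.src) :=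
      ContinuousLinearMap.inr ℝ _ _ ∘L ContinuousLinearMap.inl ℝ _ _
    have hR : Function.RightInverse R L := fun _ => rfl
    exact ⟨⟨u.1.src, u.2.1⟩, L, hR.surjective,
      ContinuousLinearMap.closedComplemented_ker_of_rightInverse L R hR,
      fun v hv => hv.2.1, fun v hv => rfl⟩
  submersion_t := by
    refine isSubmersion_of_sliceChart (resPartialIsometrySlice Hp) (resGrassmannianSlice Hp)
      (injective_val_val_partialIsometry Hp) (injective_val_val_proj Hp) (fun _ => rfl)
      contDiff_mul_star fun u => ?_
    let L : (compactOffDiag u.1.tgt × compactOffDiag u.1.src × skewCorner u.1.src) →L[ℝ]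
        compactOffDiag u.1.tgt :=
      ContinuousLinearMap.fst ℝ _ _
    let R : compactOffDiag u.1.tgt →L[ℝ]
        (compactOffDiag u.1.tgt × compactOffDiag u.1.src × skewCorner u.1.src) :=
      ContinuousLinearMap.inl ℝ _ _
    have hR : Function.RightInverse R L := fun _ => rfl
    exact ⟨⟨u.1.tgt, u.2.2⟩, L, hR.surjective,
      ContinuousLinearMap.closedComplemented_ker_of_rightInverse L R hR,
      fun v hv => hv.1, fun v hv => rfl⟩
  smooth_mul := SetGroupoid.isSmoothMul_of_sliceChart _ (resPartialIsometrySlice Hp)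
    (fun _ _ _ => rfl) fun g h k _ => resPartialIsometry_mul_mem_range Hp g h k
  embedding_unit := isEmbedding_of_sliceChart (resPartialIsometrySlice Hp)
    (resGrassmannianSlice Hp) (injective_val_val_proj Hp)
    (fun u => ⟨u, mem_resPartialIsometryAtlas_source_self Hp u⟩)
    (fun p => ⟨p, mem_resGrassmannianAtlas_source_self Hp p⟩) fun _ => rfl
  bijective_inv := Function.Involutive.bijective fun v =>
    Subtype.ext (Subtype.ext (star_star v.1.1))
  smooth_inv := isSmoothMap_of_sliceChart (resPartialIsometrySlice Hp)
    (resPartialIsometrySlice Hp) (injective_val_val_partialIsometry Hp) (fun _ => rfl)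
    contDiff_star_clm

theorem isHom_resPartialIsometryGroupoid :
    (resPartialIsometryGroupoid Hp).IsHom (partialIsometryGroupoid H)
      Subtype.val Subtype.val where
  map_s _ := rfl
  map_t _ := rfl
  map_unit _ := rfl
  map_inv _ := rfl
  map_mul _ _ _ _ := rfl

/-- The inclusion of the compact into the bounded operators. -/
def compactOffDiagInclusion (p : Proj H) : compactOffDiag p →ₗᵢ[ℝ] offDiag p where
  toLinearMap := Submodule.inclusion inf_le_left
  norm_map' _ := rfl

/-- The inclusion of the model spaces of the restricted groupoid. -/
def resModelInclusion (p q : Proj H) : (compactOffDiag p × compactOffDiag q × skewCorner q) →ₗᵢ[ℝ]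
    (offDiag p × offDiag q × skewCorner q) where
  toLinearMap := (compactOffDiagInclusion p).toLinearMap.prodMap
    ((compactOffDiagInclusion q).toLinearMap.prodMap LinearMap.id)
  norm_map' _ := rfl

theorem isImmersedSubmanifold_resGrassmannian :
    IsImmersedSubmanifold (resGrassmannianAtlas Hp) (grassmannianAtlas H) Subtype.val :=
  isImmersedSubmanifold_of_sliceChart (resGrassmannianSlice Hp) grassmannianSlice
    (injective_val_val_proj Hp) Subtype.val_injective Subtype.val_injective (fun _ => rfl)
    contDiff_id fun p => ⟨p.1, compactOffDiagInclusion p.1, fun _ hq => hq, fun _ _ => rfl⟩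

theorem isImmersedSubmanifold_resPartialIsometry :
    IsImmersedSubmanifold (resPartialIsometryAtlas Hp) (partialIsometryAtlas H) Subtype.val :=
  isImmersedSubmanifold_of_sliceChart (resPartialIsometrySlice Hp) partialIsometrySlice
    (injective_val_val_partialIsometry Hp) Subtype.val_injective Subtype.val_injective
    (fun _ => rfl) contDiff_id
    fun u => ⟨u.1, resModelInclusion u.1.tgt u.1.src, fun _ hv => hv, fun _ _ => rfl⟩

end RestrictedGrassmannian

/-! ### Whitley's argument for bounded sequences, and diagonal operators -/

section Whitley

open scoped ENNReal

/-- There are uncountably many infinite sets of natural numbers, any two of which have a finite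
intersection. -/
theorem exists_almostDisjoint_family : ∃ A : (ℕ → Bool) → Set ℕ,
    (∀ x, (A x).Infinite) ∧ ∀ x y, x ≠ y → (A x ∩ A y).Finite := by
  -- `c x n` codes the initial segment of `x` of length `n`; distinct branches of the binary tree
  -- share only finitely many segments.
  let c : (ℕ → Bool) → ℕ → ℕ := fun x n => Encodable.encode ((List.range n).map x)
  have hc : ∀ x y n m, c x n = c y m → n = m ∧ ∀ i < n, x i = y i := by
    intro x y n m h
    have h1 : (List.range n).map x = (List.range m).map y := Encodable.encode_injective h
    have h2 : n = m := by simpa using congrArg List.length h1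
    subst h2
    exact ⟨rfl, fun i hi => List.map_inj_left.1 h1 i (List.mem_range.2 hi)⟩
  refine ⟨fun x => Set.range (c x), fun x => Set.infinite_range_of_injective fun n m h =>
    (hc x x n m h).1, fun x y hxy => ?_⟩
  obtain ⟨i, hi⟩ := Function.ne_iff.1 hxy
  refine ((Set.finite_Iic i).image (c x)).subset ?_
  rintro _ ⟨⟨n, rfl⟩, ⟨m, hm⟩⟩
  refine ⟨n, ?_, rfl⟩
  by_contra hn
  exact hi ((hc y x m n hm).2 i (by have := (hc y x m n hm).1; simp at hn; omega)).symm

/-- The indicator function of a set of natural numbers, as a bounded sequence. -/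
def boundedIndicator (S : Set ℕ) : lp (fun _ : ℕ => ℂ) ∞ :=
  ⟨S.indicator 1, memℓp_infty ⟨1, by
    rintro _ ⟨n, rfl⟩
    by_cases h : n ∈ S <;> simp [h]⟩⟩

theorem boundedIndicator_apply (S : Set ℕ) (n : ℕ) :
    boundedIndicator S n = S.indicator 1 n := rfl

/-- A functional on the bounded sequences that vanishes on the finitely supported ones is nonzero on
only countably many members of an almost disjoint family. -/
theorem countable_setOf_boundedIndicator_ne_zero {κ : Type*} {A : κ → Set ℕ}
    (hA : ∀ x y, x ≠ y → (A x ∩ A y).Finite) (φ : lp (fun _ : ℕ => ℂ) ∞ →L[ℝ] ℝ)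
    (h : ∀ a : lp (fun _ : ℕ => ℂ) ∞, (Function.support a).Finite → φ a = 0) :
    {x | φ (boundedIndicator (A x)) ≠ 0}.Countable := by
  classical
  have hs : Summable fun x => |φ (boundedIndicator (A x))| := by
    refine summable_of_sum_le (c := ‖φ‖) (fun _ => abs_nonneg _) fun F => ?_
    -- `G` is the finite set of overlaps within `F`; deleting it makes the sets disjoint without
    -- changing the values of `φ`.
    let G : Set ℕ := ⋃ x ∈ F, ⋃ y ∈ F, ⋃ _ : x ≠ y, A x ∩ A y
    have hG : G.Finite := F.finite_toSet.biUnion fun x _ => F.finite_toSet.biUnion fun y _ =>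
      Set.finite_iUnion fun hxy => hA x y hxy
    have h1 : ∀ x, φ (boundedIndicator (A x)) = φ (boundedIndicator (A x \ G)) := by
      intro x
      rw [← sub_eq_zero, ← map_sub]
      refine h _ (hG.subset fun n hn => ?_)
      by_contra hnG
      refine hn ?_
      change boundedIndicator (A x) n - boundedIndicator (A x \ G) n = 0
      simp [boundedIndicator_apply, Set.indicator, hnG]
    let s : κ → ℝ := fun x => SignType.sign (φ (boundedIndicator (A x)))
    have h2 : ∑ x ∈ F, |φ (boundedIndicator (A x))| =
        φ (∑ x ∈ F, s x • boundedIndicator (A x \ G)) := by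
      rw [map_sum]
      refine Finset.sum_congr rfl fun x _ => ?_
      rw [map_smul, ← h1, smul_eq_mul, sign_mul_self]
    -- At each coordinate at most one summand is nonzero, so the sum has norm at most one whatever
    -- the size of `F`; this bounds the sum of the `|φ|` by `‖φ‖`.
    have h3 : ‖∑ x ∈ F, s x • boundedIndicator (A x \ G)‖ ≤ 1 := by
      refine lp.norm_le_of_forall_le zero_le_one fun n => ?_
      rw [lp.coeFn_sum, Finset.sum_apply]
      have h4 : ∀ x ∈ F, ‖(s x • boundedIndicator (A x \ G)) n‖ ≤ if n ∈ A x \ G then 1 else 0 := by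
        intro x _
        change ‖s x • boundedIndicator (A x \ G) n‖ ≤ _
        rw [boundedIndicator_apply]
        have : |s x| ≤ 1 := by
          rcases lt_trichotomy (φ (boundedIndicator (A x))) 0 with h | h | h <;> simp [s, h]
        split_ifs with hn
        · rw [Set.indicator_of_mem hn]
          simpa using this
        · rw [Set.indicator_of_notMem hn]; simp
      refine (norm_sum_le_of_le F h4).trans ?_
      rw [Finset.sum_boole]
      have : (F.filter fun x => n ∈ A x \ G).card ≤ 1 := by
        refine Finset.card_le_one.2 fun x hx y hy => ?_
        rw [Finset.mem_filter] at hx hy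
        by_contra hxy
        refine hx.2.2 ?_
        simp only [G, Set.mem_iUnion]
        exact ⟨x, hx.1, y, hy.1, hxy, hx.2.1, hy.2.1⟩
      exact_mod_cast this
    rw [h2]
    calc φ _ ≤ ‖φ _‖ := Real.le_norm_self _
      _ ≤ ‖φ‖ * 1 := φ.le_of_opNorm_le_of_le le_rfl h3
      _ = ‖φ‖ := mul_one _
  refine hs.countable_support.mono fun x hx => ?_
  simpa using hx

/-- A bounded operator on the bounded sequences, with values in a space with a countable separating
family of functionals, that vanishes on the finitely supported sequences also vanishes on the
indicator function of some infinite set. -/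
theorem exists_infinite_boundedIndicator_eq_zero {Y : Type*} [NormedAddCommGroup Y]
    [NormedSpace ℝ Y] {κ : Type*} [Countable κ] (φ : κ → Y →L[ℝ] ℝ)
    (hφ : ∀ y, (∀ k, φ k y = 0) → y = 0) (Φ : lp (fun _ : ℕ => ℂ) ∞ →L[ℝ] Y)
    (h : ∀ a : lp (fun _ : ℕ => ℂ) ∞, (Function.support a).Finite → Φ a = 0) :
    ∃ S : Set ℕ, S.Infinite ∧ Φ (boundedIndicator S) = 0 := by
  obtain ⟨A, hA, hA'⟩ := exists_almostDisjoint_family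
  -- Each functional excludes countably many indices, hence so does the countable family; the index
  -- set is uncountable by Cantor's diagonal argument.
  have hc : (⋃ k, {x | (φ k ∘L Φ) (boundedIndicator (A x)) ≠ 0}).Countable :=
    Set.countable_iUnion fun k => countable_setOf_boundedIndicator_ne_zero hA' _ fun a ha => by
      change φ k (Φ a) = 0
      rw [h a ha, map_zero]
  have hu : ¬ (Set.univ : Set (ℕ → Bool)).Countable := by
    intro hu
    have := Set.countable_univ_iff.1 hu
    obtain ⟨f, hf⟩ := exists_surjective_nat (ℕ → Bool)
    obtain ⟨n, hn⟩ := hf fun n => !f n n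
    have := congrFun hn n
    simp at this
  obtain ⟨x, hx⟩ : ∃ x, x ∉ ⋃ k, {x | (φ k ∘L Φ) (boundedIndicator (A x)) ≠ 0} := by
    by_contra! H
    exact hu (hc.mono fun x _ => H x)
  refine ⟨A x, hA x, hφ _ fun k => ?_⟩
  by_contra hk
  exact hx (Set.mem_iUnion.2 ⟨k, hk⟩)

/-- The diagonal operator with bounded entries on the space of square summable sequences. -/
def diagonalOp : lp (fun _ : ℕ => ℂ) ∞ →L[ℂ] lp (fun _ : ℕ => ℂ) 2 →L[ℂ] lp (fun _ : ℕ => ℂ) 2 :=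
  lp.holderL 2 (fun _ => ContinuousLinearMap.mul ℂ ℂ) (K := 1) fun _ => by simp

theorem diagonalOp_apply (a : lp (fun _ : ℕ => ℂ) ∞) (x : lp (fun _ : ℕ => ℂ) 2) (n : ℕ) :
    diagonalOp a x n = a n * x n := rfl

/-- A finite sum of rank-one operators, one for each point of the support. -/
theorem isCompactOperator_diagonalOp {a : lp (fun _ : ℕ => ℂ) ∞}
    (ha : (Function.support a).Finite) : IsCompactOperator (diagonalOp a) := by
  let ev (n : ℕ) : lp (fun _ : ℕ => ℂ) 2 →L[ℂ] ℂ := lp.evalCLM ℂ (fun _ : ℕ => ℂ) 2 n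
  have e : diagonalOp a = ∑ n ∈ ha.toFinset,
      (ContinuousLinearMap.toSpanSingleton ℂ (lp.single 2 n (a n))) ∘L ev n := by
    ext x m
    rw [diagonalOp_apply, sum_apply, lp.coeFn_sum, Finset.sum_apply]
    have h : ∀ n ∈ ha.toFinset, ((ContinuousLinearMap.toSpanSingleton ℂ (lp.single 2 n (a n)) ∘L
        ev n) x : ℕ → ℂ) m = if m = n then a m * x m else 0 := by
      intro n _
      change x n • (lp.single 2 n (a n) : lp (fun _ : ℕ => ℂ) 2) m = _
      split_ifs with hmn
      · subst hmn
        rw [lp.single_apply_self, smul_eq_mul, mul_comm]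
      · rw [lp.single_apply_ne _ _ _ hmn, smul_zero]
    rw [Finset.sum_congr rfl h, Finset.sum_ite_eq]
    split_ifs with hm
    · rfl
    · have : a m = 0 := by simpa using hm
      rw [this, zero_mul]
  rw [e]
  change _ ∈ compactOperator (RingHom.id ℂ) (lp (fun _ : ℕ => ℂ) 2) (lp (fun _ : ℕ => ℂ) 2)
  refine Submodule.sum_mem (compactOperator (RingHom.id ℂ) (lp (fun _ : ℕ => ℂ) 2)
    (lp (fun _ : ℕ => ℂ) 2)) fun n _ => ?_
  have h := (isCompactOperator_id (E := ℂ)).comp_clm (ev n)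
  exact h.clm_comp (ContinuousLinearMap.toSpanSingleton ℂ
    (lp.single 2 n (a n) : lp (fun _ : ℕ => ℂ) 2))

/-- The operator fixes infinitely many standard unit vectors, and distinct ones are at distance at
least one, so no subsequence is Cauchy. -/
theorem not_isCompactOperator_diagonalOp {S : Set ℕ} (hS : S.Infinite) :
    ¬ IsCompactOperator (diagonalOp (boundedIndicator S)) := by
  intro h
  obtain ⟨C, hC, hSC⟩ := h.image_closedBall_subset_compact
    (f := (diagonalOp (boundedIndicator S) : lp (fun _ : ℕ => ℂ) 2 →ₗ[ℂ] lp (fun _ : ℕ => ℂ) 2)) 1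
  have : Infinite S := hS.to_subtype
  let j := Infinite.natEmbedding S
  let e : ℕ → lp (fun _ : ℕ => ℂ) 2 := fun n => lp.single 2 (j n : ℕ) 1
  have he : ∀ n, e n ∈ C := by
    intro n
    refine hSC ⟨e n, ?_, ?_⟩
    · rw [mem_closedBall_zero_iff, lp.norm_single (by norm_num)]
      simp
    · ext m
      change boundedIndicator S m * e n m = e n m
      by_cases hm : m = j n
      · subst hm
        rw [boundedIndicator_apply, Set.indicator_of_mem (j n).2]
        simp
      · simp [e, Pi.single_eq_of_ne hm]
  obtain ⟨x, -, ψ, hψ, hx⟩ := hC.isSeqCompact he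
  obtain ⟨N, hN⟩ := Metric.cauchySeq_iff.1 hx.cauchySeq 1 one_pos
  have h1 := hN N le_rfl (N + 1) (Nat.le_succ N)
  refine h1.not_ge ?_
  rw [dist_eq_norm]
  have h2 : (j (ψ N) : ℕ) ≠ j (ψ (N + 1)) := fun h =>
    (hψ N.lt_succ_self).ne (j.injective (Subtype.ext h))
  refine le_trans ?_ (lp.norm_apply_le_norm (by norm_num) _ (j (ψ N) : ℕ))
  change 1 ≤ ‖e (ψ N) (j (ψ N)) - e (ψ (N + 1)) (j (ψ N))‖
  simp [e, Pi.single_eq_of_ne h2]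

/-- An infinite-dimensional Hilbert space contains the space of square summable sequences. -/
theorem exists_linearIsometry_lp {E : Type*} [NormedAddCommGroup E] [InnerProductSpace ℂ E]
    [CompleteSpace E] (h : ¬ FiniteDimensional ℂ E) :
    Nonempty (lp (fun _ : ℕ => ℂ) 2 →ₗᵢ[ℂ] E) := by
  obtain ⟨w, b, -⟩ := exists_hilbertBasis ℂ E
  have hw : Infinite w := by
    by_contra hw
    rw [not_infinite_iff_finite] at hw
    have := Fintype.ofFinite w
    exact h b.toOrthonormalBasis.toBasis.finiteDimensional_of_finite
  have hv := b.orthonormal.comp _ (Infinite.natEmbedding w).injective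
  exact ⟨hv.orthogonalFamily.linearIsometry⟩

end Whitley

/-! ### The inclusions do not split -/

section NotSplit

theorem Submodule.ClosedComplemented.exists_clm_of_range {X Y : Type*} [NormedAddCommGroup X]
    [NormedSpace ℝ X] [NormedAddCommGroup Y] [NormedSpace ℝ Y] {L : X →L[ℝ] Y}
    (h : (LinearMap.range (L : X →ₗ[ℝ] Y)).ClosedComplemented) :
    ∃ P : Y →L[ℝ] Y, (∀ y, ∃ x, P y = L x) ∧ ∀ x, P (L x) = L x := by
  obtain ⟨π, hπ⟩ := h
  refine ⟨Submodule.subtypeL _ ∘L π, fun y => ?_, fun x => ?_⟩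
  · obtain ⟨x, hx⟩ := (π y).2
    exact ⟨x, hx.symm⟩
  · exact congrArg Subtype.val (hπ ⟨L x, LinearMap.mem_range_self _ x⟩)

open scoped ENNReal

variable {H : Type u} [NormedAddCommGroup H] [InnerProductSpace ℂ H]

/-- The real functionals `A ↦ re ⟪y, A x⟫` on operators. -/
def reInnerApply (x y : H) : (H →L[ℂ] H) →L[ℝ] ℝ :=
  Complex.reCLM ∘L ((innerSL ℂ y ∘L ContinuousLinearMap.apply ℂ H x).restrictScalars ℝ)

/-- Density extends the vanishing of the real part to all `y`; taking `y = A x` gives `‖A x‖² = 0`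
for `x` in the dense sequence. This is where separability supplies a countable separating family. -/
theorem eq_zero_of_reInnerApply_denseSeq [TopologicalSpace.SeparableSpace H] (A : H →L[ℂ] H)
    (h : ∀ k : ℕ × ℕ, reInnerApply (TopologicalSpace.denseSeq H k.1)
      (TopologicalSpace.denseSeq H k.2) A = 0) : A = 0 := by
  have hd := TopologicalSpace.denseRange_denseSeq H
  have h1 : ∀ n, A (TopologicalSpace.denseSeq H n) = 0 := by
    intro n
    have h2 : (fun y => (inner ℂ y (A (TopologicalSpace.denseSeq H n))).re) = fun _ => 0 :=
      hd.equalizer (by fun_prop) continuous_const (funext fun m => h (n, m))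
    have h3 := congrFun h2 (A (TopologicalSpace.denseSeq H n))
    have h4 := inner_self_eq_norm_sq (𝕜 := ℂ) (A (TopologicalSpace.denseSeq H n))
    have h5 : ‖A (TopologicalSpace.denseSeq H n)‖ ^ 2 = 0 := h4.symm.trans h3
    exact norm_eq_zero.1 (pow_eq_zero_iff two_ne_zero |>.1 h5)
  have h2 : (A : H → H) = fun _ => 0 :=
    hd.equalizer A.continuous continuous_const (funext h1)
  exact ContinuousLinearMap.ext (congrFun h2)

variable [CompleteSpace H]

/-- The compact operators are not the kernel of a bounded operator on the space of all bounded
operators between two infinite-dimensional subspaces. -/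
theorem not_forall_eq_zero_iff_isCompactOperator [TopologicalSpace.SeparableSpace H]
    {Hp : Submodule ℂ H} [Hp.HasOrthogonalProjection]
    (hp : ¬ FiniteDimensional ℂ Hp) (hm : ¬ FiniteDimensional ℂ Hpᗮ)
    {p : Proj H} (h : p.1 = Hp.starProjection) (T : offDiag p →L[ℝ] offDiag p) :
    ¬ ∀ A, T A = 0 ↔ IsCompactOperator A.1 := by
  intro hT
  have : CompleteSpace Hp := by
    rw [← Hp.orthogonal_orthogonal]
    infer_instance
  obtain ⟨J⟩ := exists_linearIsometry_lp hp
  obtain ⟨J'⟩ := exists_linearIsometry_lp hm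
  let R : H →L[ℂ] lp (fun _ : ℕ => ℂ) 2 :=
    J.toContinuousLinearMap.adjoint ∘L Hp.orthogonalProjectionOnto
  let L : lp (fun _ : ℕ => ℂ) 2 →L[ℂ] H := Hpᗮ.subtypeL ∘L J'.toContinuousLinearMap
  -- Bounded sequences enter as diagonal operators between copies of `ℓ²` inside `Hp` and `Hpᗮ`;
  -- finitely supported sequences give compact operators, which `T` kills.
  let D₀ : lp (fun _ : ℕ => ℂ) ∞ →L[ℝ] (H →L[ℂ] H) :=
    ((ContinuousLinearMap.compL ℂ _ _ _ L ∘L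
      (ContinuousLinearMap.compL ℂ _ _ _).flip R ∘L diagonalOp)).restrictScalars ℝ
  have hL : (1 - p.1) ∘L L = L := by
    ext x
    have h0 : Hp.starProjection (J' x : H) = 0 :=
      (Hp.starProjection_apply_eq_zero_iff).2 (J' x).2
    change (J' x : H) - p.1 (J' x : H) = (J' x : H)
    rw [h, h0, sub_zero]
  have hR : R ∘L p.1 = R := by
    ext1 x
    have h0 : Hp.orthogonalProjectionOnto (Hp.starProjection x) = Hp.orthogonalProjectionOnto x :=
      Hp.orthogonalProjectionOnto_mem_subspace_eq_self (Hp.orthogonalProjectionOnto x)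
    change J.toContinuousLinearMap.adjoint (Hp.orthogonalProjectionOnto (p.1 x)) = _
    rw [h, h0]
    rfl
  let D : lp (fun _ : ℕ => ℂ) ∞ →L[ℝ] offDiag p := D₀.codRestrict (offDiag p) fun a => by
    change (1 - p.1) ∘L (L ∘L diagonalOp a ∘L R) ∘L p.1 = L ∘L diagonalOp a ∘L R
    ext x
    have h1 : R (p.1 x) = R x := DFunLike.congr_fun hR x
    change ((1 - p.1) ∘L L) (diagonalOp a (R (p.1 x))) = _
    rw [h1, hL]
    rfl
  obtain ⟨S, hS, hS'⟩ := exists_infinite_boundedIndicator_eq_zero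
    (fun k : ℕ × ℕ => reInnerApply (TopologicalSpace.denseSeq H k.1)
      (TopologicalSpace.denseSeq H k.2) ∘L (offDiag p).subtypeL)
    (fun A hA => Subtype.ext (eq_zero_of_reInnerApply_denseSeq A.1 hA)) (T ∘L D) fun a ha =>
      (hT _).2 ((isCompactOperator_diagonalOp ha).comp_clm R |>.clm_comp L)
  have hc : IsCompactOperator (L ∘L diagonalOp (boundedIndicator S) ∘L R) := (hT _).1 hS'
  refine not_isCompactOperator_diagonalOp hS ?_
  -- Compressing by the adjoints of the two isometric embeddings recovers the diagonal operator.
  have h1 := (hc.comp_clm (Hp.subtypeL ∘L J.toContinuousLinearMap)).clm_comp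
    (J'.toContinuousLinearMap.adjoint ∘L Hpᗮ.orthogonalProjectionOnto)
  refine (congrArg IsCompactOperator (funext fun x => ?_)).mpr h1
  have h2 : Hp.orthogonalProjectionOnto (J x : H) = J x :=
    Hp.orthogonalProjectionOnto_mem_subspace_eq_self (J x)
  have h3 : ∀ y, Hpᗮ.orthogonalProjectionOnto (J' y : H) = J' y := fun y =>
    Hpᗮ.orthogonalProjectionOnto_mem_subspace_eq_self (J' y)
  have h4 : ∀ y, J.toContinuousLinearMap.adjoint (J y) = y := fun y =>
    DFunLike.congr_fun J.adjoint_comp_self y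
  have h5 : ∀ y, J'.toContinuousLinearMap.adjoint (J' y) = y := fun y =>
    DFunLike.congr_fun J'.adjoint_comp_self y
  change _ = J'.toContinuousLinearMap.adjoint (Hpᗮ.orthogonalProjectionOnto (J' (diagonalOp
    (boundedIndicator S) (J.toContinuousLinearMap.adjoint
      (Hp.orthogonalProjectionOnto (J x : H)))) : H))
  rw [h2, h3, h4, h5]

/-- The projection onto `Hp` belongs to the restricted Grassmannian. -/
theorem starProjection_mem_resGrassmannian (Hp : Submodule ℂ H) [Hp.HasOrthogonalProjection] :
    (⟨Hp.starProjection, isStarProjection_starProjection⟩ : Proj H) ∈ resGrassmannian Hp := by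
  let W := LinearMap.range (Hp.starProjection : H →ₗ[ℂ] H)
  have hW : ∀ x : W, (x : H) ∈ Hp := by
    rintro ⟨_, y, rfl⟩
    exact (Hp.orthogonalProjectionOnto y).2
  let R : W →L[ℂ] Hp := Hp.orthogonalProjectionOnto ∘L W.subtypeL
  let R' : Hp →L[ℂ] W := Hp.subtypeL.codRestrict W fun x =>
    ⟨x, Hp.starProjection_eq_self_iff.2 x.2⟩
  refine ⟨?_, ?_⟩
  · have h0 : (ContinuousLinearMap.id ℂ Hp).IsFredholm :=
      ContinuousLinearMap.IsFredholm.of_isQuasiInverse (v := ContinuousLinearMap.id ℂ Hp)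
        (LinearEquiv.refl ℂ Hp).isQuasiInverse
    refine h0.comp_of_inverse (R := R) (R' := R') ?_ ?_
    · ext x
      exact Hp.starProjection_eq_self_iff.2 (hW x)
    · ext x
      exact Hp.starProjection_eq_self_iff.2 x.2
  · refine (congrArg IsCompactOperator (funext fun x => ?_)).mpr
      (isCompactOperator_zero (M₁ := W) (M₂ := Hpᗮ))
    change Hpᗮ.orthogonalProjectionOnto (x : H) = 0
    exact Submodule.orthogonalProjectionOnto_apply_of_mem_orthogonal
      (Hp.le_orthogonal_orthogonal (hW x))

variable [TopologicalSpace.SeparableSpace H] {Hp : Submodule ℂ H} [Hp.HasOrthogonalProjection]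

/-- At the point `Hp`, a bounded projection `P` onto the compact operators would make `1 - P` an
operator whose kernel is exactly the compact ones. -/
theorem not_isSplitImmersedSubmanifold_resGrassmannian
    (hp : ¬ FiniteDimensional ℂ Hp) (hm : ¬ FiniteDimensional ℂ Hpᗮ) :
    ¬ IsSplitImmersedSubmanifold
      (resGrassmannianAtlas Hp) (grassmannianAtlas H) Subtype.val := by
  intro h
  let p : {p // p ∈ resGrassmannian Hp} := ⟨_, starProjection_mem_resGrassmannian Hp⟩
  obtain ⟨P, hP, hP'⟩ : ∃ P : offDiag p.1 →L[ℝ] offDiag p.1,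
      (∀ A, ∃ B, P A = compactOffDiagInclusion p.1 B) ∧
        ∀ B, P (compactOffDiagInclusion p.1 B) = compactOffDiagInclusion p.1 B :=
    (exists_range_eq_of_isSplitImmersedSubmanifold (resGrassmannianSlice Hp)
      grassmannianSlice (injective_val_val_proj Hp) Subtype.val_injective (i := p) (j := p.1)
      (compactOffDiagInclusion p.1).toContinuousLinearMap (fun _ hq => hq) (fun _ _ => rfl)
      h).exists_clm_of_range
  refine not_forall_eq_zero_iff_isCompactOperator hp hm (p := p.1) rfl
    (ContinuousLinearMap.id ℝ _ - P) fun A => ⟨fun hA => ?_, fun hA => ?_⟩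
  · obtain ⟨B, hB⟩ := hP A
    have h1 : A = compactOffDiagInclusion p.1 B := (sub_eq_zero.1 hA).trans hB
    rw [h1]
    exact B.2.2
  · exact sub_eq_zero.2 (hP' ⟨A.1, A.2, hA⟩).symm

/-- At the unit over `Hp`, a projection of the product model is compressed to the target coordinate,
`A ↦ (P (A, 0)).1`, which is again a projection onto the compact operators. -/
theorem not_isSplitImmersedSubmanifold_resPartialIsometry
    (hp : ¬ FiniteDimensional ℂ Hp) (hm : ¬ FiniteDimensional ℂ Hpᗮ) :
    ¬ IsSplitImmersedSubmanifold
      (resPartialIsometryAtlas Hp) (partialIsometryAtlas H) Subtype.val := by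
  intro h
  let p : {p // p ∈ resGrassmannian Hp} := ⟨_, starProjection_mem_resGrassmannian Hp⟩
  let u : ResPIso Hp := (resPartialIsometryGroupoid Hp).unit p
  have hu : u.1.tgt.1 = Hp.starProjection :=
    congrArg Subtype.val ((partialIsometryGroupoid H).t_unit p.1)
  let L : (compactOffDiag u.1.tgt × compactOffDiag u.1.src × skewCorner u.1.src) →ₗᵢ[ℝ]
      (offDiag u.1.tgt × offDiag u.1.src × skewCorner u.1.src) := resModelInclusion u.1.tgt u.1.src
  obtain ⟨P, hP, hP'⟩ : ∃ P : (offDiag u.1.tgt × offDiag u.1.src × skewCorner u.1.src) →L[ℝ]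
      (offDiag u.1.tgt × offDiag u.1.src × skewCorner u.1.src),
      (∀ A, ∃ B, P A = L B) ∧ ∀ B, P (L B) = L B :=
    (exists_range_eq_of_isSplitImmersedSubmanifold (resPartialIsometrySlice Hp)
      partialIsometrySlice (injective_val_val_partialIsometry Hp) Subtype.val_injective (i := u)
      (j := u.1) L.toContinuousLinearMap (fun _ hq => hq) (fun _ _ => rfl) h).exists_clm_of_range
  refine not_forall_eq_zero_iff_isCompactOperator hp hm hu
    (ContinuousLinearMap.id ℝ _ - ContinuousLinearMap.fst ℝ _ _ ∘L P ∘L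
      ContinuousLinearMap.inl ℝ _ _) fun A => ⟨fun hA => ?_, fun hA => ?_⟩
  · obtain ⟨B, hB⟩ := hP (A, 0)
    have h1 : A = compactOffDiagInclusion u.1.tgt B.1 :=
      (sub_eq_zero.1 hA).trans (congrArg Prod.fst hB)
    rw [h1]
    exact B.1.2.2
  · exact sub_eq_zero.2 (congrArg Prod.fst (hP' (⟨A.1, A.2, hA⟩, 0))).symm

end NotSplit

end

theorem mainTheorem5 {H : Type u} [NormedAddCommGroup H] [InnerProductSpace ℂ H] [CompleteSpace H]
    [TopologicalSpace.SeparableSpace H]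
    (Hp : Submodule ℂ H) [Hp.HasOrthogonalProjection]
    (hp : ¬ FiniteDimensional ℂ Hp) (hm : ¬ FiniteDimensional ℂ Hpᗮ) :
    -- both are Banach Lie groupoids
    (partialIsometryGroupoid H).IsBanachLieGroupoid
      (partialIsometryAtlas H) (grassmannianAtlas H) ∧
    (resPartialIsometryGroupoid Hp).IsBanachLieGroupoid
      (resPartialIsometryAtlas Hp) (resGrassmannianAtlas Hp) ∧
    -- the inclusions form a morphism of groupoids
    (resPartialIsometryGroupoid Hp).IsHom (partialIsometryGroupoid H)
      Subtype.val Subtype.val ∧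
    -- they are immersed submanifolds, on arrows and on objects
    IsImmersedSubmanifold (resPartialIsometryAtlas Hp) (partialIsometryAtlas H) Subtype.val ∧
    IsImmersedSubmanifold (resGrassmannianAtlas Hp) (grassmannianAtlas H) Subtype.val ∧
    -- neither of them is split immersed
    ¬ IsSplitImmersedSubmanifold
        (resPartialIsometryAtlas Hp) (partialIsometryAtlas H) Subtype.val ∧
    ¬ IsSplitImmersedSubmanifold
        (resGrassmannianAtlas Hp) (grassmannianAtlas H) Subtype.val :=
  ⟨isBanachLieGroupoid_partialIsometryGroupoid,
    isBanachLieGroupoid_resPartialIsometryGroupoid Hp,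
    isHom_resPartialIsometryGroupoid Hp,
    isImmersedSubmanifold_resPartialIsometry Hp,
    isImmersedSubmanifold_resGrassmannian Hp,
    not_isSplitImmersedSubmanifold_resPartialIsometry hp hm,
    not_isSplitImmersedSubmanifold_resGrassmannian hp hm⟩
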